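/- Let $n \ge 2$ and let $s$ be real with $s-\frac n2\in(0,1)$. Let $\mathbb S^n\subset\mathbb R^{n+1}$ be the unit sphere with its (non-normalized) surface measure $d\omega$, let $P_\ell$ be the $L^2(\mathbb S^n)$-orthogonal projection onto the spherical harmonics of degree $\ell$, and let $H^s(\mathbb S^n)$ be the real Sobolev space of all $u$ with $\sum_\ell (1+\ell(\ell+n-1))^s\|P_\ell u\|_2^2<\infty$; its elements are identified with continuous functions. For $u,w\in H^s(\mathbb S^n)$ put $$a_{2s}[u,w]=\sum_{\ell\ge 0}\alpha_{2s}(\ell)\,(P_\ell u,P_\ell w),\quad \alpha_{2s}(\ell)=\frac{\Gamma(\ell+\frac n2+s)}{\Gamma(\ell+\frac n2-s)},\quad a_{2s}[u]=a_{2s}[u,u],$$ $$\mathcal S_s=(4\pi)^s\,\frac{\Gamma(\frac{n+2s}2)}{\Gamma(\frac{n-2s}2)}\Big(\frac{\Gamma(\frac n2)}{\Gamma(n)}\Big)^{2s/n},\qquad \|u\|_q=\Big(\int_{\mathbb S^n}u^q\,d\omega\Big)^{1/q}\ (u>0,\ q\neq 0),$$ $$\mathcal M=\big\{\omega\mapsto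 c\,(1-\zeta\cdot\omega)^{\frac{2s-n}{2}}:\ c>0,\ \zeta\in\mathbb R^{n+1},\ |\zeta|<1\big\}.$$ For $h\in\mathcal M$ let $T_h\mathcal M$ be the tangent space of the manifold $\mathcal M$ at $h$, and let $(T_h\mathcal M)^\perp=\{\rho\in H^s(\mathbb S^n): a_{2s}[\rho,\varphi]=0\ \text{for all }\varphi\in T_h\mathcal M\}$. For $0<u\in H^s(\mathbb S^n)\setminus\mathcal M$ define $$\mathsf d(u)=\inf\{a_{2s}[\rho]:\ u=h+\rho,\ h\in\mathcal M,\ \rho\in(T_h\mathcal M)^\perp\},\qquad \mathcal E(u)=\frac{a_{2s}[u]-\mathcal S_s\|u\|_{\frac{2n}{n-2s}}^2}{\mathsf d(u)},$$ and let $c_{BE}(s)=\inf\{\mathcal E(u):\ 0<u\in H^s(\mathbb S^n)\setminus\mathcal M\}$. For a conformal map $\Phi$ of $\mathbb S^n$ onto itself with Jacobian $J_\Phi=|\det D\Phi|$ write $u_\Phi(\omega)=u(\Phi(\omega))\,J_\Phi(\omega)^{\frac{n-2s}{2n}}$. Let $(u_k)$ be a minimizing sequence for $c_{BE}(s)$,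 that is, $0<u_k\in H^s(\mathbb S^n)\setminus\mathcal M$ for all $k$ and $\mathcal E(u_k)\to c_{BE}(s)$. Then there exist $c_k\in(0,\infty)$ and conformal maps $\Phi_k$ of $\mathbb S^n$ such that the functions $v_k:=c_k\,(u_k)_{\Phi_k}$ satisfy the normalization $$\int_{\mathbb S^n}v_k\,d\omega=|\mathbb S^n|,\qquad \int_{\mathbb S^n}\omega\,v_k(\omega)\,d\omega=0\qquad\text{for all }k,$$ and such that, along a subsequence, $v_k\to v$ weakly in $H^s(\mathbb S^n)$ and strongly in $L^\infty(\mathbb S^n)$ for some $v\in H^s(\mathbb S^n)\setminus\mathcal M$ with $v\ge 0$. (By the normalization, $v\not\equiv0$.) -/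

import Mathlib

open MeasureTheory Filter Topology
open scoped ContDiff Manifold RealInnerProductSpace

namespace RevSobolev

noncomputable section

/-- The ambient space `ℝ^{n+1}` with its Euclidean inner product. -/
abbrev Amb (n : ℕ) : Type := EuclideanSpace ℝ (Fin (n + 1))

/-- The unit sphere `𝕊^n ⊂ ℝ^{n+1}`. -/
abbrev Sph (n : ℕ) : Type := Metric.sphere (0 : Amb n) 1

/-- The standard, non-normalized surface measure `dω` on `𝕊^n`. -/
abbrev surf (n : ℕ) : Measure (Sph n) := (volume : Measure (Amb n)).toSphere

/-- The real Hilbert space `L²(𝕊^n)`. -/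
abbrev L2 (n : ℕ) : Type := Lp ℝ 2 (surf n)

/-! ### Spherical harmonics -/

/-- Homogeneous harmonic polynomials of degree `l` in `n + 1` variables. -/
def harmonicPoly (n l : ℕ) : Submodule ℝ (MvPolynomial (Fin (n + 1)) ℝ) :=
  MvPolynomial.homogeneousSubmodule (Fin (n + 1)) ℝ l ⊓
    LinearMap.ker (∑ i : Fin (n + 1),
      ((MvPolynomial.pderiv i : Derivation ℝ (MvPolynomial (Fin (n + 1)) ℝ)
          (MvPolynomial (Fin (n + 1)) ℝ)).toLinearMap ∘ₗ
        (MvPolynomial.pderiv i : Derivation ℝ (MvPolynomial (Fin (n + 1)) ℝ)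
          (MvPolynomial (Fin (n + 1)) ℝ)).toLinearMap))

/-- Restriction of a polynomial to the sphere. -/
def polyRestrict (n : ℕ) : MvPolynomial (Fin (n + 1)) ℝ →ₗ[ℝ] C(Sph n, ℝ) where
  toFun p :=
    { toFun := fun x => MvPolynomial.eval (fun i => (x : Amb n) i) p
      continuous_toFun := by
        refine (MvPolynomial.continuous_eval p).comp ?_
        fun_prop }
  map_add' p q := by ext x; simp
  map_smul' r p := by ext x; simp [MvPolynomial.smul_eval]

/-- The class in `L²(𝕊^n)` of a continuous function. -/
def toL2 (n : ℕ) : C(Sph n, ℝ) →L[ℝ] L2 n := ContinuousMap.toLp 2 (surf n) ℝ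

/-- The space `E_l ⊂ L²(𝕊^n)` of spherical harmonics of degree `l`. -/
def sphHarm (n l : ℕ) : Submodule ℝ (L2 n) :=
  (harmonicPoly n l).map ((toL2 n).toLinearMap ∘ₗ polyRestrict n)

instance sphHarm_finiteDimensional (n l : ℕ) : FiniteDimensional ℝ (sphHarm n l) := by
  have h1 : FiniteDimensional ℝ (MvPolynomial.homogeneousSubmodule (Fin (n + 1)) ℝ l) :=
    Module.Finite.iff_fg.2 (MvPolynomial.homogeneousSubmodule_fg (σ := Fin (n + 1)) (R := ℝ) l)
  have h2 : FiniteDimensional ℝ (harmonicPoly n l) :=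
    Submodule.finiteDimensional_inf_left _ _
  unfold sphHarm
  infer_instance

/-- The `L²`-orthogonal projection `P_l` onto the spherical harmonics of degree `l`. -/
def proj (n l : ℕ) : L2 n →L[ℝ] L2 n := (sphHarm n l).starProjection

/-! ### The Sobolev space `H^s(𝕊^n)` -/

/-- The symbol of `(1 - Δ)^s` on `𝕊^n`; recall that `-Δ = l (l + n - 1)` on `E_l`. -/
def hsWeight (n : ℕ) (s : ℝ) (l : ℕ) : ℝ := (1 + (l : ℝ) * ((l : ℝ) + n - 1)) ^ s

/-- Membership of an `L²` function in `H^s(𝕊^n)`. -/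
def MemHs (n : ℕ) (s : ℝ) (f : L2 n) : Prop :=
  Summable fun l : ℕ => hsWeight n s l * ‖proj n l f‖ ^ 2

/-- The inner product of `H^s(𝕊^n)`. -/
def hsInner (n : ℕ) (s : ℝ) (f g : L2 n) : ℝ :=
  ∑' l : ℕ, hsWeight n s l * ⟪proj n l f, proj n l g⟫

/-- Weak convergence in the Hilbert space `H^s(𝕊^n)`. -/
def WeakConvHs (n : ℕ) (s : ℝ) (f : ℕ → L2 n) (g : L2 n) : Prop :=
  (∀ k, MemHs n s (f k)) ∧ MemHs n s g ∧
    ∀ φ : L2 n, MemHs n s φ →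
      Tendsto (fun k => hsInner n s (f k) φ) atTop (𝓝 (hsInner n s g φ))

/-! ### The quadratic form and the Sobolev constant -/

/-- The eigenvalue `α_{2s}(l)`. -/
def alpha (n : ℕ) (s : ℝ) (l : ℕ) : ℝ :=
  Real.Gamma ((l : ℝ) + n / 2 + s) / Real.Gamma ((l : ℝ) + n / 2 - s)

/-- The bilinear form `a_{2s}[f, g]` (absolutely convergent on `H^s`). -/
def form (n : ℕ) (s : ℝ) (f g : L2 n) : ℝ :=
  ∑' l : ℕ, alpha n s l * ⟪proj n l f, proj n l g⟫

/-- The best constant `𝒮_s` in the reverse Sobolev inequality. -/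
def sobolevConst (n : ℕ) (s : ℝ) : ℝ :=
  (4 * Real.pi) ^ s * (Real.Gamma (((n : ℝ) + 2 * s) / 2) / Real.Gamma (((n : ℝ) - 2 * s) / 2)) *
    (Real.Gamma ((n : ℝ) / 2) / Real.Gamma (n : ℝ)) ^ (2 * s / n)

/-- `‖u‖_q = (∫ u^q dω)^{1/q}` for a positive function `u` and `q ≠ 0`, possibly `q < 0`. -/
def qNorm (n : ℕ) (q : ℝ) (u : C(Sph n, ℝ)) : ℝ :=
  (∫ x, (u x) ^ q ∂(surf n)) ^ (1 / q)

/-! ### The manifold of optimizers -/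

/-- The function `ω ↦ c (1 - ζ·ω)^{(2s-n)/2}`. -/
def bubble (n : ℕ) (s c : ℝ) (ζ : Amb n) (x : Sph n) : ℝ :=
  c * (1 - ⟪ζ, (x : Amb n)⟫) ^ ((2 * s - n) / 2)

/-- The manifold `ℳ` of optimizers. -/
def optimizers (n : ℕ) (s : ℝ) : Set C(Sph n, ℝ) :=
  {h | ∃ (c : ℝ) (ζ : Amb n), 0 < c ∧ ‖ζ‖ < 1 ∧ ∀ x, h x = bubble n s c ζ x}

/-- The tangent space `T_h ℳ`: velocities at `h` of the curves in `ℳ` that are obtained by moving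
the parameters `(c, ζ) ∈ (0,∞) × B(0,1)` of `h` along straight lines, that is, the range of the
differential of the global parametrization `(c, ζ) ↦ bubble c ζ` of `ℳ`. -/
def tangent (n : ℕ) (s : ℝ) (h : C(Sph n, ℝ)) : Set C(Sph n, ℝ) :=
  {φ | ∃ (c : ℝ) (ζ : Amb n), 0 < c ∧ ‖ζ‖ < 1 ∧ (∀ x, h x = bubble n s c ζ x) ∧
    ∃ (τ : ℝ) (η : Amb n), ∀ x,
      HasDerivAt (fun t : ℝ => bubble n s (c + t * τ) (ζ + t • η) x) (φ x) 0}

/-- The `a_{2s}`-orthogonal complement `(T_h ℳ)^⊥` in `H^s(𝕊^n)`. -/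
def tangentPerp (n : ℕ) (s : ℝ) (h : C(Sph n, ℝ)) : Set C(Sph n, ℝ) :=
  {ρ | MemHs n s (toL2 n ρ) ∧ ∀ φ ∈ tangent n s h, form n s (toL2 n ρ) (toL2 n φ) = 0}

/-! ### The stability quotient -/

/-- The modified distance `𝖽(u)`. -/
def dist2 (n : ℕ) (s : ℝ) (u : C(Sph n, ℝ)) : ℝ :=
  sInf {d | ∃ h ρ : C(Sph n, ℝ), h ∈ optimizers n s ∧ ρ ∈ tangentPerp n s h ∧ u = h + ρ ∧
    d = form n s (toL2 n ρ) (toL2 n ρ)}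

/-- The stability quotient `ℰ(u)`. -/
def quotient (n : ℕ) (s : ℝ) (u : C(Sph n, ℝ)) : ℝ :=
  (form n s (toL2 n u) (toL2 n u) -
      sobolevConst n s * qNorm n (2 * n / ((n : ℝ) - 2 * s)) u ^ 2) / dist2 n s u

/-- The admissible functions `0 < u ∈ H^s(𝕊^n) ∖ ℳ`. For `s > n/2` the elements of `H^s(𝕊^n)` are
continuous functions, and positivity is pointwise positivity of the continuous representative. -/
def admissible (n : ℕ) (s : ℝ) : Set C(Sph n, ℝ) :=
  {u | (∀ x, 0 < u x) ∧ MemHs n s (toL2 n u) ∧ u ∉ optimizers n s}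

/-- The best stability constant `c_BE(s)`. -/
def cBE (n : ℕ) (s : ℝ) : ℝ := sInf (quotient n s '' admissible n s)

/-- `(u_k)` is a minimizing sequence for `c_BE(s)`. -/
def IsMinimizing (n : ℕ) (s : ℝ) (u : ℕ → C(Sph n, ℝ)) : Prop :=
  (∀ k, u k ∈ admissible n s) ∧ Tendsto (fun k => quotient n s (u k)) atTop (𝓝 (cBE n s))

/-! ### Conformal maps -/

/-- The differential at `x ∈ 𝕊^n` of a map `f` from `𝕊^n` to `ℝ^{n+1}`. -/
def sphDeriv {n : ℕ} (f : Sph n → Amb n) (x : Sph n) : TangentSpace (𝓡 n) x →L[ℝ] Amb n :=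
  mfderiv (𝓡 n) 𝓘(ℝ, Amb n) f x

/-- A conformal map of `𝕊^n` onto itself: a diffeomorphism `Φ` with
`⟨dΦ_x X, dΦ_x Y⟩ = λ(x)² ⟨X, Y⟩` for all tangent vectors `X, Y` at `x`, where the metric is the
one induced by `ℝ^{n+1}` through the inclusion. The conformal factor `λ > 0` is determined by `Φ`
and is automatically continuous (for `n ≥ 1`). -/
structure ConformalMap (n : ℕ) where
  toDiffeo : Diffeomorph (𝓡 n) (𝓡 n) (Sph n) (Sph n) ∞
  factor : C(Sph n, ℝ)
  factor_pos : ∀ x, 0 < factor x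
  conformal : ∀ (x : Sph n) (X Y : TangentSpace (𝓡 n) x),
    ⟪sphDeriv (fun y => (toDiffeo y : Amb n)) x X, sphDeriv (fun y => (toDiffeo y : Amb n)) x Y⟫ =
      factor x ^ 2 *
        ⟪sphDeriv (fun y => (y : Amb n)) x X, sphDeriv (fun y => (y : Amb n)) x Y⟫

/-- The Jacobian `J_Φ = |det DΦ| = λ^n` of a conformal map with conformal factor `λ`. -/
def ConformalMap.jacobian {n : ℕ} (Φ : ConformalMap n) (x : Sph n) : ℝ := Φ.factor x ^ n

/-- The transformed function `u_Φ(ω) = u(Φ(ω)) J_Φ(ω)^{(n-2s)/(2n)}`. -/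
def pullback {n : ℕ} (s : ℝ) (Φ : ConformalMap n) (u : C(Sph n, ℝ)) : C(Sph n, ℝ) where
  toFun x := u (Φ.toDiffeo x) * Φ.jacobian x ^ (((n : ℝ) - 2 * s) / (2 * n))
  continuous_toFun := by
    refine (u.continuous.comp Φ.toDiffeo.continuous).mul ?_
    refine Continuous.rpow_const (Φ.factor.continuous.pow n) fun x => Or.inl ?_
    exact (pow_pos (Φ.factor_pos x) n).ne'

end

end RevSobolev

open RevSobolev

/-! Write σ = s - n/2 and q = 2n/(n-2s) < 0. The symbol `alpha` is negative at l = 0, and positive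
and strictly increasing for l ≥ 1. Up to rotations the conformal maps of the sphere are Lorentz
boosts acting on the light cone; they are parametrized by w ∈ ℝ^{n+1}, and u ↦ u_Φ becomes `twist σ
w`.

Conformal invariance of the form (`form_twist`) comes from the kernel (1 - x·y)^σ. Its covariance is
a change of variables (`riesz_twist`), and differentiating that covariance along boosts yields its
eigenvalues on spherical harmonics (`riesz_polyRestrict`), which are a constant multiple of
1/`alpha` (`alpha_mul_rieszEig`). The same duality gives the Hölder embedding of H^s
(`exists_holder`).

If u = h + ρ with h a multiple of `twist σ w 1` and ρ orthogonal to h, then a[ρ] = a[u] - α(0)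
m(w)²/|S|, where m(w) is `boostMass σ u w`, the integral of u boosted by -w. As α(0) < 0, minimizing
a[ρ] amounts to minimizing m. For u > 0 the function m is coercive, and at its minimum the boosted
function has vanishing center of mass, which is exactly the missing orthogonality to the tangent
space. Hence 𝖽(u) is attained at that boost (`dist2_eq`), and the quotient of u equals
`deficit`/`gap` of the normalized representative v (`exists_normalization`). Normalization removes
the degrees 0 and 1 from `gap`, so that `gap` v ≥ α(2) ‖v - 1‖₂².

The infimum is strictly below 1 - α(1)/α(2) (`cBE_lt`): for v = 1 - τf, with f a quadratic harmonic
and ∫ f³ > 0, the second-order expansion of the quotient gives this value and the cubic term lowers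
it. In particular the infimum is below 1. Since `deficit` ≥ `gap` + α(0)|S|, the gaps of a
normalized minimizing sequence are eventually bounded, and Hölder continuity with Arzelà–Ascoli
gives uniform and weak convergence along a subsequence (`exists_subseq_tendsto`). A limit in ℳ would
be normalized, hence equal to 1, and near 1 the quotient is at least 1 - α(1)/α(2) up to an
arbitrarily small error (`exists_le_deficit`), which contradicts the strict bound. -/

namespace RevSobolev

noncomputable section

/-! ### Lorentz boosts acting on the light cone -/

/-- The time component `√(1 + |w|²)` of the point of the hyperboloid with space component `w`. -/
def lorentz {n : ℕ} (w : Amb n) : ℝ := √(1 + ‖w‖ ^ 2)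

/-- The action on `ℝ^{n+1}`, identified with the future light cone, of the Lorentz boost with
velocity `w / lorentz w`. -/
def boost {n : ℕ} (w X : Amb n) : Amb n := X + (⟪w, X⟫ / (1 + lorentz w) + ‖X‖) • w

/-- The factor by which `boost w` stretches the norm of a unit vector. -/
def stretch {n : ℕ} (w x : Amb n) : ℝ := lorentz w + ⟪w, x⟫

section Boost

variable {n : ℕ}

lemma lorentz_sq (w : Amb n) : lorentz w ^ 2 = 1 + ‖w‖ ^ 2 :=
  Real.sq_sqrt (by positivity)

lemma lorentz_pos (w : Amb n) : 0 < lorentz w := Real.sqrt_pos.2 (by positivity)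

lemma one_le_lorentz (w : Amb n) : 1 ≤ lorentz w := by
  have := lorentz_sq w
  nlinarith [lorentz_pos w, sq_nonneg ‖w‖]

@[simp] lemma lorentz_neg (w : Amb n) : lorentz (-w) = lorentz w := by simp [lorentz]

@[simp] lemma lorentz_zero : lorentz (0 : Amb n) = 1 := by simp [lorentz]

lemma norm_lt_lorentz (w : Amb n) : ‖w‖ < lorentz w := by
  have := lorentz_sq w
  nlinarith [lorentz_pos w, norm_nonneg w]

lemma stretch_pos (w : Amb n) {x : Amb n} (hx : ‖x‖ ≤ 1) : 0 < stretch w x := by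
  have h1 := norm_lt_lorentz w
  have h2 := abs_real_inner_le_norm w x
  have h3 := (abs_le.1 h2).1
  have : ‖w‖ * ‖x‖ ≤ ‖w‖ := mul_le_of_le_one_right (norm_nonneg _) hx
  unfold stretch
  linarith

lemma lorentz_mul_norm_add_nonneg (w X : Amb n) : 0 ≤ lorentz w * ‖X‖ + ⟪w, X⟫ := by
  have h1 := norm_lt_lorentz w
  have h3 := (abs_le.1 (abs_real_inner_le_norm w X)).1
  nlinarith [norm_nonneg X]

lemma inner_boost_left (w X : Amb n) :
    ⟪w, boost w X⟫ = lorentz w * ⟪w, X⟫ + (lorentz w ^ 2 - 1) * ‖X‖ := by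
  have h := lorentz_sq w
  have h2 : (1 + lorentz w) ≠ 0 := by have := lorentz_pos w; positivity
  rw [boost, inner_add_right, real_inner_smul_right, real_inner_self_eq_norm_sq]
  have : ‖w‖ ^ 2 = lorentz w ^ 2 - 1 := by linarith
  rw [this]
  field_simp
  ring

/-- Invariance of the Lorentz product of the null vectors (|X|, X) and (|Y|, Y): the boosted time
components are the two factors `lorentz w * ‖·‖ + ⟪w, ·⟫`. The norm formula and the conformal
covariance of 1 - x·y both follow from it. -/
lemma inner_boost (w X Y : Amb n) :
    ⟪boost w X, boost w Y⟫ = ⟪X, Y⟫ +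
      (lorentz w * ‖X‖ + ⟪w, X⟫) * (lorentz w * ‖Y‖ + ⟪w, Y⟫) - ‖X‖ * ‖Y‖ := by
  have h := lorentz_sq w
  have h2 : (1 + lorentz w) ≠ 0 := by have := lorentz_pos w; positivity
  simp only [boost, inner_add_right, inner_add_left, real_inner_smul_right, real_inner_smul_left,
    real_inner_self_eq_norm_sq, real_inner_comm w X]
  have : ‖w‖ ^ 2 = lorentz w ^ 2 - 1 := by linarith
  rw [this]
  field_simp
  ring

lemma norm_boost (w X : Amb n) : ‖boost w X‖ = lorentz w * ‖X‖ + ⟪w, X⟫ := by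
  have := inner_boost w X X
  rw [real_inner_self_eq_norm_sq, real_inner_self_eq_norm_sq] at this
  have h := lorentz_mul_norm_add_nonneg w X
  rw [← abs_of_nonneg (norm_nonneg (boost w X)), ← abs_of_nonneg h, ← sq_eq_sq_iff_abs_eq_abs]
  linarith

@[simp] lemma boost_neg_boost (w X : Amb n) : boost (-w) (boost w X) = X := by
  have h := lorentz_sq w
  have h2 : (1 + lorentz w) ≠ 0 := by have := lorentz_pos w; positivity
  have key : ⟪-w, boost w X⟫ / (1 + lorentz (-w)) + ‖boost w X‖ = ⟪w, X⟫ / (1 + lorentz w) + ‖X‖ := by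
    rw [inner_neg_left, inner_boost_left, norm_boost, lorentz_neg]
    field_simp
    ring
  rw [boost, key, boost]
  module

@[simp] lemma boost_boost_neg (w X : Amb n) : boost w (boost (-w) X) = X := by
  simpa using boost_neg_boost (-w) X

@[simp] lemma boost_zero_right (w : Amb n) : boost w 0 = 0 := by simp [boost]

@[simp] lemma boost_zero_left (X : Amb n) : boost 0 X = X := by simp [boost]

lemma boost_smul (w X : Amb n) {r : ℝ} (hr : 0 ≤ r) : boost w (r • X) = r • boost w X := by
  simp only [boost, real_inner_smul_right, norm_smul, Real.norm_of_nonneg hr]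
  module

lemma boost_ne_zero (w : Amb n) {X : Amb n} (hX : X ≠ 0) : boost w X ≠ 0 := fun h => hX <| by
  rw [← boost_neg_boost w X, h, boost_zero_right]

/-- The differential of `boost w` at `X ≠ 0`. -/
def boostDeriv (w X : Amb n) : Amb n →L[ℝ] Amb n :=
  ContinuousLinearMap.id ℝ _ +
    (innerSL ℝ ((1 + lorentz w)⁻¹ • w + ‖X‖⁻¹ • X)).smulRight w

lemma hasFDerivAt_boost (w : Amb n) {X : Amb n} (hX : X ≠ 0) :
    HasFDerivAt (boost w) (boostDeriv w X) X := by
  have h1 : HasFDerivAt (fun X : Amb n => ‖X‖) (‖X‖⁻¹ • innerSL ℝ X) X := by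
    have := (hasStrictFDerivAt_norm_sq X).hasFDerivAt.sqrt (by simpa using hX)
    simp only [Real.sqrt_sq (norm_nonneg _)] at this
    refine this.congr_fderiv ?_
    have : ‖X‖ ≠ 0 := norm_ne_zero_iff.2 hX
    ext v
    simp
    field_simp
  have h2 : HasFDerivAt (fun X : Amb n => ⟪w, X⟫) (innerSL ℝ w) X := (innerSL ℝ w).hasFDerivAt
  have h3 : HasFDerivAt (boost w) _ X :=
    (hasFDerivAt_id X).add ((((h2.mul_const ((1 + lorentz w)⁻¹)).add h1)).smul_const w)
  refine h3.congr_fderiv ?_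
  ext v
  simp [boostDeriv, mul_comm]

/-- The differential is the identity plus a rank-one map, so its determinant is one plus the
functional evaluated at w. -/
lemma det_boostDeriv (w : Amb n) {X : Amb n} (hX : X ≠ 0) :
    (boostDeriv w X).det = stretch w (‖X‖⁻¹ • X) := by
  have : ((boostDeriv w X : Amb n →L[ℝ] Amb n) : Amb n →ₗ[ℝ] Amb n) =
      LinearMap.transvection
        ((innerSL ℝ ((1 + lorentz w)⁻¹ • w + ‖X‖⁻¹ • X) : Amb n →L[ℝ] ℝ) : Amb n →ₗ[ℝ] ℝ) w := by
    ext v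
    simp [boostDeriv, LinearMap.transvection]
  rw [ContinuousLinearMap.det, this, LinearMap.transvection.det]
  have h := lorentz_sq w
  have h2 : (1 + lorentz w) ≠ 0 := by have := lorentz_pos w; positivity
  have h3 : ‖w‖ ^ 2 = lorentz w ^ 2 - 1 := by linarith
  simp [stretch, inner_smul_right, h3, real_inner_comm]
  field_simp
  ring

/-! ### Conformal maps of the sphere induced by boosts -/

@[simp] lemma norm_coe_sph (x : Sph n) : ‖(x : Amb n)‖ = 1 := norm_eq_of_mem_sphere x

lemma coe_sph_ne_zero (x : Sph n) : (x : Amb n) ≠ 0 := ne_zero_of_mem_unit_sphere x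

lemma stretch_coe_pos (w : Amb n) (x : Sph n) : 0 < stretch w x := stretch_pos w (by simp)

lemma norm_boost_coe (w : Amb n) (x : Sph n) : ‖boost w x‖ = stretch w x := by
  simp [norm_boost, stretch]

/-- The conformal map of the sphere induced by the boost with parameter `w`. -/
def sphBoost (w : Amb n) (x : Sph n) : Sph n :=
  ⟨(stretch w x)⁻¹ • boost w x, by
    simp [norm_smul, norm_boost_coe, abs_of_pos (stretch_coe_pos w x),
      (stretch_coe_pos w x).ne']⟩

lemma coe_sphBoost (w : Amb n) (x : Sph n) :
    (sphBoost w x : Amb n) = (stretch w x)⁻¹ • boost w x := rfl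

lemma stretch_smul_sphBoost (w : Amb n) (x : Sph n) :
    stretch w x • (sphBoost w x : Amb n) = boost w x := by
  rw [coe_sphBoost, smul_inv_smul₀ (stretch_coe_pos w x).ne']

lemma stretch_neg_sphBoost (w : Amb n) (x : Sph n) :
    stretch (-w) (sphBoost w x) = (stretch w x)⁻¹ := by
  have h := norm_boost_coe (-w) (sphBoost w x)
  rw [coe_sphBoost, boost_smul _ _ (inv_nonneg.2 (stretch_coe_pos w x).le), boost_neg_boost,
    norm_smul, norm_coe_sph, mul_one, Real.norm_of_nonneg (inv_nonneg.2 (stretch_coe_pos w x).le)]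
    at h
  exact h.symm

lemma stretch_sphBoost_neg (w : Amb n) (x : Sph n) :
    stretch w (sphBoost (-w) x) = (stretch (-w) x)⁻¹ := by
  simpa using stretch_neg_sphBoost (-w) x

@[simp] lemma sphBoost_neg_sphBoost (w : Amb n) (x : Sph n) : sphBoost (-w) (sphBoost w x) = x := by
  ext1
  rw [coe_sphBoost, stretch_neg_sphBoost, coe_sphBoost,
    boost_smul _ _ (inv_nonneg.2 (stretch_coe_pos w x).le), boost_neg_boost, inv_inv,
    smul_inv_smul₀ (stretch_coe_pos w x).ne']

@[simp] lemma sphBoost_sphBoost_neg (w : Amb n) (x : Sph n) : sphBoost w (sphBoost (-w) x) = x := by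
  simpa using sphBoost_neg_sphBoost (-w) x

/-- 1 - x·y is, up to sign, the Lorentz product of (1, x) and (1, y). The boost preserves it, and
rescaling the images to time component 1 divides by the two stretch factors. -/
lemma one_sub_inner_sphBoost (w : Amb n) (x y : Sph n) :
    1 - ⟪(sphBoost w x : Amb n), (sphBoost w y : Amb n)⟫ =
      (1 - ⟪(x : Amb n), (y : Amb n)⟫) / (stretch w x * stretch w y) := by
  have hx := (stretch_coe_pos w x).ne'
  have hy := (stretch_coe_pos w y).ne'
  rw [coe_sphBoost, coe_sphBoost, real_inner_smul_left, real_inner_smul_right, inner_boost]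
  simp only [norm_coe_sph, mul_one]
  change 1 - (stretch w x)⁻¹ * ((stretch w y)⁻¹ * (_ + stretch w x * stretch w y - 1)) = _
  field_simp
  ring

lemma contDiff_stretch (w : Amb n) {m : ℕ∞ω} : ContDiff ℝ m (stretch w) := by
  unfold stretch
  exact contDiff_const.add (innerSL ℝ w).contDiff

lemma contDiffAt_boost (w : Amb n) {X : Amb n} (hX : X ≠ 0) {m : ℕ∞ω} :
    ContDiffAt ℝ m (boost w) X := by
  unfold boost
  have h : ContDiffAt ℝ m (fun X => ⟪w, X⟫ / (1 + lorentz w) + ‖X‖) X :=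
    ((innerSL ℝ w).contDiff.contDiffAt.div_const _).add (contDiffAt_norm ℝ hX)
  exact contDiffAt_id.add (h.smul contDiffAt_const)

lemma contDiffAt_inv_stretch_smul_boost (w : Amb n) (x : Sph n) {m : ℕ∞ω} :
    ContDiffAt ℝ m (fun X => (stretch w X)⁻¹ • boost w X) (x : Amb n) :=
  ((contDiff_stretch w).contDiffAt.inv (stretch_coe_pos w x).ne').smul
    (contDiffAt_boost w (coe_sph_ne_zero x))

lemma contMDiff_sphBoost (w : Amb n) : ContMDiff (𝓡 n) (𝓡 n) ∞ (sphBoost w) := by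
  have := Fact.mk (@finrank_euclideanSpace_fin ℝ _ (n + 1))
  refine ContMDiff.codRestrict_sphere (f := fun x : Sph n => (stretch w x)⁻¹ • boost w x) ?_ _
  intro x
  exact ((contDiffAt_inv_stretch_smul_boost w x).contMDiffAt).comp x
    (contMDiff_coe_sphere (E := Amb n) (n := n)).contMDiffAt

/-- `sphBoost w` as a diffeomorphism. -/
def sphBoostDiffeo (w : Amb n) : Diffeomorph (𝓡 n) (𝓡 n) (Sph n) (Sph n) ∞ where
  toFun := sphBoost w
  invFun := sphBoost (-w)
  left_inv := sphBoost_neg_sphBoost w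
  right_inv := sphBoost_sphBoost_neg w
  contMDiff_toFun := contMDiff_sphBoost w
  contMDiff_invFun := contMDiff_sphBoost (-w)

/-- The restriction of `stretch w` to the sphere. -/
def stretchC (w : Amb n) : C(Sph n, ℝ) where
  toFun x := stretch w x
  continuous_toFun := ((contDiff_stretch (m := 0) w).continuous).comp continuous_subtype_val

lemma boostDeriv_apply_of_inner_eq_zero (w : Amb n) (x : Sph n) {V : Amb n}
    (hV : ⟪(x : Amb n), V⟫ = 0) :
    boostDeriv w x V = V + (⟪w, V⟫ / (1 + lorentz w)) • w := by
  simp [boostDeriv, hV, div_eq_inv_mul]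

/-- On vectors tangent at x the differential of the boost adds ⟪w,V⟫⟪w,W⟫ to the inner product
(`hVW`); the radial correction from differentiating the normalization removes exactly this term. -/
lemma inner_sphBoost_deriv (w : Amb n) (x : Sph n) {V W : Amb n}
    (hV : ⟪(x : Amb n), V⟫ = 0) (hW : ⟪(x : Amb n), W⟫ = 0) {D : Amb n →L[ℝ] Amb n}
    (hD : HasFDerivAt (fun X => (stretch w X)⁻¹ • boost w X) D (x : Amb n)) :
    ⟪D V, D W⟫ = (stretch w x)⁻¹ ^ 2 * ⟪V, W⟫ := by
  have hx := (stretch_coe_pos w x).ne'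
  have h1 : HasFDerivAt (stretch w) (innerSL ℝ w) (x : Amb n) :=
    ((innerSL ℝ w).hasFDerivAt).const_add _
  have h2 := ((hasDerivAt_inv hx).comp_hasFDerivAt _ h1).fun_smul (hasFDerivAt_boost w (coe_sph_ne_zero x))
  have key : ∀ U : Amb n, ⟪(x : Amb n), U⟫ = 0 → D U = (stretch w x)⁻¹ •
      (U + (⟪w, U⟫ / (1 + lorentz w)) • w) - ((stretch w x)⁻¹ ^ 2 * ⟪w, U⟫) • boost w x := by
    intro U hU
    rw [hD.unique h2]
    simp [boostDeriv_apply_of_inner_eq_zero w x hU]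
    module
  have h := lorentz_sq w
  have h0 : (1 + lorentz w) ≠ 0 := by have := lorentz_pos w; positivity
  have hw : ‖w‖ ^ 2 = lorentz w ^ 2 - 1 := by linarith
  have hB : ⟪boost w x, boost w (x : Amb n)⟫ = stretch w x ^ 2 := by
    rw [real_inner_self_eq_norm_sq, norm_boost_coe]
  have hwB : ⟪w, boost w (x : Amb n)⟫ = lorentz w * ⟪w, (x : Amb n)⟫ + (lorentz w ^ 2 - 1) := by
    simp [inner_boost_left]
  have hUB : ∀ U : Amb n, ⟪(x : Amb n), U⟫ = 0 → ⟪U + (⟪w, U⟫ / (1 + lorentz w)) • w,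
      boost w (x : Amb n)⟫ = stretch w x * ⟪w, U⟫ := by
    intro U hU
    rw [inner_add_left, real_inner_smul_left, hwB, boost, inner_add_right, real_inner_smul_right,
      real_inner_comm, hU, norm_coe_sph, real_inner_comm w U, stretch]
    field_simp
    ring
  have hVW : ⟪V + (⟪w, V⟫ / (1 + lorentz w)) • w, W + (⟪w, W⟫ / (1 + lorentz w)) • w⟫ =
      ⟪V, W⟫ + ⟪w, V⟫ * ⟪w, W⟫ := by
    simp only [inner_add_left, inner_add_right, real_inner_smul_left, real_inner_smul_right,
      real_inner_self_eq_norm_sq, hw, real_inner_comm w V]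
    field_simp
    ring
  rw [key V hV, key W hW, inner_sub_left, inner_sub_right, inner_sub_right]
  simp only [real_inner_smul_left, real_inner_smul_right, hVW, hUB V hV, hB,
    real_inner_comm (W + _) (boost w (x : Amb n)), hUB W hW]
  field_simp
  ring

/-- The conformal map `sphBoost w`, with conformal factor `1 / stretch w`. -/
def boostConformal (w : Amb n) : ConformalMap n where
  toDiffeo := sphBoostDiffeo w
  factor := ⟨fun x => (stretch w x)⁻¹,
    (stretchC w).continuous.inv₀ fun x => (stretch_coe_pos w x).ne'⟩
  factor_pos x := inv_pos.2 (stretch_coe_pos w x)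
  conformal x X Y := by
    have := Fact.mk (@finrank_euclideanSpace_fin ℝ _ (n + 1))
    have hi : MDifferentiableAt (𝓡 n) 𝓘(ℝ, Amb n) (fun y : Sph n => (y : Amb n)) x :=
      (contMDiff_coe_sphere (E := Amb n) (n := n) (m := 1)).contMDiffAt.mdifferentiableAt one_ne_zero
    have hF := (contDiffAt_inv_stretch_smul_boost w x (m := 1)).differentiableAt one_ne_zero
    have hd : sphDeriv (fun y => (sphBoostDiffeo w y : Amb n)) x =
        (fderiv ℝ (fun X => (stretch w X)⁻¹ • boost w X) (x : Amb n)).comp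
          (sphDeriv (fun y => (y : Amb n)) x) := by
      unfold sphDeriv
      rw [← mfderiv_eq_fderiv]
      exact mfderiv_comp x hF.mdifferentiableAt hi
    -- The inclusion maps tangent vectors into the orthogonal complement of x, where
    -- `inner_sphBoost_deriv` applies.
    have ho : ∀ Z : TangentSpace (𝓡 n) x, ⟪(x : Amb n), sphDeriv (fun y => (y : Amb n)) x Z⟫ = 0 := by
      intro Z
      have := range_mvfderiv_subtypeVal (E := Amb n) (n := n) x
      have h2 : sphDeriv (fun y => (y : Amb n)) x Z ∈ (Submodule.span ℝ {(x : Amb n)})ᗮ := by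
        rw [← this]
        exact ⟨Z, rfl⟩
      exact Submodule.mem_orthogonal_singleton_iff_inner_right.1 h2
    rw [hd]
    exact inner_sphBoost_deriv w x (ho X) (ho Y) hF.hasFDerivAt

end Boost

/-! ### Change of variables on the sphere -/

section ChangeOfVariables

variable {n : ℕ}

lemma lintegral_polar {g : Amb n → ENNReal} (hg : Measurable g) :
    ∫⁻ X, g X = ∫⁻ x : Sph n,
      (∫⁻ r in Set.Ioi (0 : ℝ), ENNReal.ofReal (r ^ n) * g (r • (x : Amb n))) ∂(surf n) := by
  have hd : Module.finrank ℝ (Amb n) - 1 = n := by simp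
  have mp := (volume : Measure (Amb n)).measurePreserving_homeomorphUnitSphereProd
  rw [hd] at mp
  have h1 : ∫⁻ X, g X = ∫⁻ X : ({(0 : Amb n)}ᶜ : Set (Amb n)), g X ∂((volume : Measure (Amb n)).comap (↑)) := by
    rw [lintegral_subtype_comap (measurableSet_singleton _).compl, restrict_compl_singleton]
  have h2 := mp.symm (homeomorphUnitSphereProd (Amb n)).toMeasurableEquiv
  rw [h1, ← h2.lintegral_comp (f := fun X => g X) (hg.comp measurable_subtype_coe), lintegral_prod]
  · refine lintegral_congr fun x => ?_
    rw [Measure.volumeIoiPow, lintegral_withDensity_eq_lintegral_mul]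
    · rw [← lintegral_subtype_comap measurableSet_Ioi
        (fun r => ENNReal.ofReal (r ^ n) * g (r • (x : Amb n)))]
      rfl
    · fun_prop
    · exact hg.comp (by fun_prop)
  · exact (((hg.comp measurable_subtype_coe)).comp
      (homeomorphUnitSphereProd (Amb n)).toMeasurableEquiv.symm.measurable).aemeasurable

lemma lintegral_Ioi_pow_indicator {b : ℝ} (hb : 0 < b) (c : ENNReal) :
    ∫⁻ r in Set.Ioi (0 : ℝ), ENNReal.ofReal (r ^ n) * (Set.Iio b).indicator (fun _ => c) r =
      ENNReal.ofReal (b ^ (n + 1) / (n + 1)) * c := by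
  have h1 : ∀ r : ℝ, ENNReal.ofReal (r ^ n) * (Set.Iio b).indicator (fun _ => c) r =
      (Set.Iio b).indicator (fun r => ENNReal.ofReal (r ^ n) * c) r := by
    intro r
    by_cases hr : r ∈ Set.Iio b <;> simp [hr]
  simp_rw [h1]
  rw [lintegral_indicator measurableSet_Iio, Measure.restrict_restrict measurableSet_Iio,
    lintegral_mul_const _ (by fun_prop)]
  congr 1
  have h2 : Set.Iio b ∩ Set.Ioi 0 = Set.Ioo 0 b := by ext; simp [and_comm]
  rw [h2, Measure.restrict_congr_set Ioo_ae_eq_Ioc, ← ofReal_integral_eq_lintegral_ofReal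
    (intervalIntegral.intervalIntegrable_pow n).1, ← intervalIntegral.integral_of_le hb.le]
  · simp
  · filter_upwards [ae_restrict_mem measurableSet_Ioc] with y hy
    exact pow_nonneg hy.1.le _

/-- The spherical Jacobian is read off from the ambient one. Extend g to be constant along rays, cut
off at the unit ball, and substitute `boost w` in ℝ^{n+1}. Positive homogeneity turns the ball into
{r < 1/stretch} on each ray, so the radial integral gives stretch^{-(n+1)}; the determinant
contributes one factor of stretch, which leaves stretch^{-n}. -/
lemma lintegral_comp_sphBoost (w : Amb n) {g : Amb n → ENNReal} (hg : Measurable g) :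
    ∫⁻ x : Sph n, ENNReal.ofReal ((stretch w x)⁻¹ ^ n) * g (sphBoost w x) ∂(surf n) =
      ∫⁻ x : Sph n, g x ∂(surf n) := by
  set G : Amb n → ENNReal := fun Y => (Set.Iio (1 : ℝ)).indicator (fun _ => g (‖Y‖⁻¹ • Y)) ‖Y‖ with hG
  have hGm : Measurable G := by
    have : G = (norm ⁻¹' (Set.Iio (1 : ℝ))).indicator (fun Y => g (‖Y‖⁻¹ • Y)) := by
      ext Y
      simp only [hG, Set.indicator]
      rfl
    rw [this]
    exact (hg.comp (by fun_prop)).indicator (measurable_norm measurableSet_Iio)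
  have hbm : Measurable (boost w) := by
    unfold boost
    fun_prop
  have hsm : Measurable (stretch w) := by
    unfold stretch
    fun_prop
  have e1 : ∫⁻ X, G X = ENNReal.ofReal (1 / (n + 1)) * ∫⁻ x : Sph n, g x ∂(surf n) := by
    rw [lintegral_polar hGm, ← lintegral_const_mul _ (f := fun x : Sph n => g x)
      (hg.comp measurable_subtype_coe)]
    refine lintegral_congr fun x => ?_
    have := lintegral_Ioi_pow_indicator (n := n) one_pos (g x)
    rw [one_pow] at this
    rw [← this]
    refine setLIntegral_congr_fun measurableSet_Ioi fun r (hr : 0 < r) => ?_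
    simp [hG, norm_smul, abs_of_pos hr, smul_smul, inv_mul_cancel₀ hr.ne']
  set H : Amb n → ENNReal := fun X => ENNReal.ofReal (stretch w (‖X‖⁻¹ • X)) * G (boost w X) with hH
  have hHm : Measurable H :=
    (hsm.comp (by fun_prop)).ennreal_ofReal.mul (hGm.comp hbm)
  have e2 : ∫⁻ X, G X = ∫⁻ X, H X := by
    have him : boost w '' {0}ᶜ = {0}ᶜ := by
      ext Y
      refine ⟨?_, fun hY => ⟨boost (-w) Y, boost_ne_zero _ hY, boost_boost_neg w Y⟩⟩
      rintro ⟨X, hX, rfl⟩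
      exact boost_ne_zero w hX
    have := lintegral_image_eq_lintegral_abs_det_fderiv_mul (volume : Measure (Amb n))
      (measurableSet_singleton (0 : Amb n)).compl
      (fun X hX => (hasFDerivAt_boost w hX).hasFDerivWithinAt)
      (fun X _ Y _ h => by rw [← boost_neg_boost w X, h, boost_neg_boost]) G
    rw [him, restrict_compl_singleton] at this
    rw [this]
    refine lintegral_congr_ae ?_
    filter_upwards [compl_mem_ae_iff.2 (measure_singleton (0 : Amb n))] with X hX
    have hX : X ≠ 0 := hX
    rw [det_boostDeriv w hX, abs_of_pos]
    exact stretch_pos w (by simp [norm_smul, hX])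
  have e3 : ∫⁻ X, H X = ENNReal.ofReal (1 / (n + 1)) *
      ∫⁻ x : Sph n, ENNReal.ofReal ((stretch w x)⁻¹ ^ n) * g (sphBoost w x) ∂(surf n) := by
    have hm : Measurable fun x : Sph n =>
        ENNReal.ofReal ((stretch w x)⁻¹ ^ n) * g (sphBoost w x) := by
      have h1 : Measurable fun x : Sph n => (stretch w x)⁻¹ := (hsm.comp measurable_subtype_coe).inv
      exact (h1.pow_const n).ennreal_ofReal.mul
        (hg.comp (h1.smul (hbm.comp measurable_subtype_coe)))
    rw [lintegral_polar hHm, ← lintegral_const_mul _ hm]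
    refine lintegral_congr fun x => ?_
    have ha := stretch_coe_pos w x
    have := lintegral_Ioi_pow_indicator (n := n) (inv_pos.2 ha)
      (ENNReal.ofReal (stretch w x) * g (sphBoost w x))
    calc _ = _ := setLIntegral_congr_fun measurableSet_Ioi fun r (hr : 0 < r) => ?_
      _ = _ := this
      _ = _ := ?_
    · have h1 : (r < (stretch w x)⁻¹) ↔ ‖boost w (r • (x : Amb n))‖ < 1 := by
        rw [boost_smul w _ hr.le, norm_smul, norm_boost_coe, Real.norm_of_nonneg hr.le,
          lt_inv_comm₀ hr ha, ← div_lt_one₀ (inv_pos.2 hr), div_inv_eq_mul,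
          mul_comm]
      have h2 : ‖boost w (r • (x : Amb n))‖⁻¹ • boost w (r • (x : Amb n)) = sphBoost w x := by
        rw [boost_smul w _ hr.le, norm_smul, norm_boost_coe, Real.norm_of_nonneg hr.le, smul_smul,
          mul_inv, mul_right_comm, inv_mul_cancel₀ hr.ne', one_mul, coe_sphBoost]
      have h3 : ‖r • (x : Amb n)‖⁻¹ • r • (x : Amb n) = x := by
        simp [norm_smul, abs_of_pos hr, smul_smul, inv_mul_cancel₀ hr.ne']
      simp only [hH, hG, h3, h2]
      congr 1
      by_cases h : r < (stretch w x)⁻¹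
      · rw [Set.indicator_of_mem (s := Set.Iio (1 : ℝ)) (h1.1 h), Set.indicator_of_mem (Set.mem_Iio.2 h)]
      · rw [Set.indicator_of_notMem (s := Set.Iio (1 : ℝ)) (fun h' => h (h1.2 h')), Set.indicator_of_notMem (s := Set.Iio (stretch w x)⁻¹) h,
          mul_zero]
    · rw [← mul_assoc, ← mul_assoc, ← ENNReal.ofReal_mul (by positivity),
        ← ENNReal.ofReal_mul (by positivity)]
      congr 2
      rw [pow_succ]
      field_simp
  have hc : ENNReal.ofReal (1 / ((n : ℝ) + 1)) ≠ 0 := by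
    rw [ENNReal.ofReal_ne_zero_iff]
    positivity
  rw [e1, e3] at e2
  exact ((ENNReal.mul_right_inj hc ENNReal.ofReal_ne_top).1 e2).symm

lemma continuous_sphBoost (w : Amb n) : Continuous (sphBoost w) := (contMDiff_sphBoost w).continuous

lemma map_sphBoost (w : Amb n) :
    ((surf n).withDensity fun x => ENNReal.ofReal ((stretch w x)⁻¹ ^ n)).map (sphBoost w) =
      surf n := by
  have hsm : Measurable fun x : Sph n => ENNReal.ofReal ((stretch w x)⁻¹ ^ n) :=
    (((stretchC w).continuous.measurable).inv.pow_const n).ennreal_ofReal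
  refine Measure.ext_of_lintegral _ fun f hf => ?_
  -- `lintegral_comp_sphBoost` takes ambient functions, so f is first extended measurably off the
  -- sphere.
  obtain ⟨g, hg, hgf⟩ := (MeasurableEmbedding.subtype_coe
    (Metric.isClosed_sphere (x := (0 : Amb n)) (ε := 1)).measurableSet).exists_measurable_extend hf
    (fun _ => ⟨0⟩)
  rw [lintegral_map hf (continuous_sphBoost w).measurable,
    lintegral_withDensity_eq_lintegral_mul _ hsm
      (g := fun x => f (sphBoost w x)) (hf.comp (continuous_sphBoost w).measurable)]
  subst hgf
  exact lintegral_comp_sphBoost w hg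

/-- Change of variables under the conformal map `sphBoost w`. -/
lemma integral_comp_sphBoost {F : Type*} [NormedAddCommGroup F] [NormedSpace ℝ F]
    (w : Amb n) (f : C(Sph n, F)) :
    ∫ x, ((stretch w x)⁻¹ ^ n) • f (sphBoost w x) ∂(surf n) = ∫ x, f x ∂(surf n) := by
  have hm : Measurable fun x : Sph n => Real.toNNReal ((stretch w x)⁻¹ ^ n) :=
    (((stretchC w).continuous.measurable).inv.pow_const n).real_toNNReal
  conv_rhs => rw [← map_sphBoost w]
  rw [(sphBoostDiffeo w).toHomeomorph.measurableEmbedding.integral_map (f := sphBoost w)]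
  have := integral_withDensity_eq_integral_smul (μ := surf n) hm (fun x => f (sphBoost w x))
  refine Eq.trans (integral_congr_ae (.of_forall fun x => ?_)) this.symm
  rw [NNReal.smul_def, Real.coe_toNNReal _ (pow_nonneg (inv_nonneg.2 (stretch_coe_pos w x).le) _)]

lemma integrable_surf {F : Type*} [NormedAddCommGroup F] [SecondCountableTopology F] (f : C(Sph n, F)) :
    Integrable f (surf n) :=
  f.continuous.integrable_of_hasCompactSupport (HasCompactSupport.of_compactSpace f)

/-- The action of a linear isometry on the sphere. -/
def sphIsom (A : Amb n ≃ₗᵢ[ℝ] Amb n) : Sph n ≃ₜ Sph n where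
  toFun x := ⟨A x, by simp⟩
  invFun x := ⟨A.symm x, by simp⟩
  left_inv x := by simp
  right_inv x := by simp
  continuous_toFun := by fun_prop
  continuous_invFun := by fun_prop

@[simp] lemma coe_sphIsom (A : Amb n ≃ₗᵢ[ℝ] Amb n) (x : Sph n) : (sphIsom A x : Amb n) = A x := rfl

lemma measurePreserving_sphIsom (A : Amb n ≃ₗᵢ[ℝ] Amb n) :
    MeasurePreserving (sphIsom A) (surf n) (surf n) := by
  refine ⟨(sphIsom A).continuous.measurable, Measure.ext fun s hs => ?_⟩
  rw [Measure.map_apply (sphIsom A).continuous.measurable hs, surf, Measure.toSphere_apply' _ hs,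
    Measure.toSphere_apply' _ ((sphIsom A).continuous.measurable hs)]
  congr 1
  conv_rhs => rw [← A.measurePreserving.measure_preimage_emb A.toHomeomorph.measurableEmbedding]
  congr 1
  ext X
  simp only [Set.mem_smul, Set.mem_image, Set.mem_preimage]
  constructor
  · rintro ⟨r, hr, _, ⟨x, hx, rfl⟩, h⟩
    exact ⟨r, hr, _, ⟨sphIsom A x, hx, rfl⟩, by simp [← h]⟩
  · rintro ⟨r, hr, _, ⟨x, hx, rfl⟩, h⟩
    refine ⟨r, hr, _, ⟨(sphIsom A).symm x, by simpa using hx, rfl⟩, ?_⟩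
    apply A.injective
    rw [map_smul, ← coe_sphIsom, Homeomorph.apply_symm_apply]
    exact h

lemma integral_comp_sphIsom {F : Type*} [NormedAddCommGroup F] [NormedSpace ℝ F]
    (A : Amb n ≃ₗᵢ[ℝ] Amb n) (f : Sph n → F) :
    ∫ x, f (sphIsom A x) ∂(surf n) = ∫ x, f x ∂(surf n) :=
  (measurePreserving_sphIsom A).integral_comp (sphIsom A).measurableEmbedding f

/-- The reflection in the hyperplane orthogonal to x - y exchanges x and y and preserves the surface
measure. -/
lemma integral_inner_coe_comp_congr (f : ℝ → ℝ) (x y : Sph n) :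
    ∫ z : Sph n, f ⟪(x : Amb n), (z : Amb n)⟫ ∂(surf n) =
      ∫ z : Sph n, f ⟪(y : Amb n), (z : Amb n)⟫ ∂(surf n) := by
  have hA := Submodule.reflection_sub (F := Amb n) (v := (x : Amb n)) (w := (y : Amb n)) (by simp)
  set A := (Submodule.span ℝ {(x : Amb n) - y})ᗮ.reflection
  rw [← integral_comp_sphIsom A (fun z : Sph n => f ⟪(y : Amb n), (z : Amb n)⟫)]
  refine integral_congr_ae (.of_forall fun z => ?_)
  simp only [coe_sphIsom]
  rw [← hA, A.inner_map_map]

lemma integral_coe_eq_zero : ∫ x : Sph n, (x : Amb n) ∂(surf n) = 0 := by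
  have := integral_comp_sphIsom (LinearIsometryEquiv.neg ℝ) (fun x : Sph n => (x : Amb n))
  simp only [coe_sphIsom, LinearIsometryEquiv.coe_neg, integral_neg] at this
  have h2 : (2 : ℝ) • ∫ x : Sph n, (x : Amb n) ∂(surf n) = 0 := by
    rw [two_smul]
    nth_rw 1 [← this]
    exact neg_add_cancel _
  exact (smul_eq_zero.1 h2).resolve_left two_ne_zero

lemma integral_inner_eq_zero (v : Amb n) : ∫ x : Sph n, ⟪v, (x : Amb n)⟫ ∂(surf n) = 0 := by
  have h := integral_inner (𝕜 := ℝ) (integrable_surf (⟨fun x : Sph n => (x : Amb n), by fun_prop⟩ : C(Sph n, Amb n))) v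
  simp only [ContinuousMap.coe_mk, integral_coe_eq_zero, inner_zero_right] at h
  exact h

lemma surf_real_univ_pos : 0 < (surf n).real Set.univ := by
  rw [surf, Measure.toSphere_real_apply_univ]
  have : 0 < (volume : Measure (Amb n)).real (Metric.ball 0 1) :=
    ENNReal.toReal_pos (Metric.measure_ball_pos _ _ one_pos).ne' measure_ball_lt_top.ne
  simp only [finrank_euclideanSpace, Fintype.card_fin]
  positivity

end ChangeOfVariables

/-! ### Twisted compositions and the Riesz kernel operator -/

section Operators

variable {n : ℕ}

/-- The weighted composition `u ↦ (u ∘ sphBoost w) * stretch w ^ e`. -/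
def twist (e : ℝ) (w : Amb n) : C(Sph n, ℝ) →ₗ[ℝ] C(Sph n, ℝ) where
  toFun u :=
    { toFun := fun x => u (sphBoost w x) * stretch w x ^ e
      continuous_toFun := (u.continuous.comp (continuous_sphBoost w)).mul
        ((stretchC w).continuous.rpow_const fun x => Or.inl (stretch_coe_pos w x).ne') }
  map_add' u v := by ext x; simp [add_mul]
  map_smul' c u := by ext x; simp [mul_assoc]

@[simp] lemma twist_apply (e : ℝ) (w : Amb n) (u : C(Sph n, ℝ)) (x : Sph n) :
    twist e w u x = u (sphBoost w x) * stretch w x ^ e := rfl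

@[simp] lemma twist_neg_twist (e : ℝ) (w : Amb n) (u : C(Sph n, ℝ)) :
    twist e (-w) (twist e w u) = u := by
  ext x
  have h := stretch_coe_pos (-w) x
  simp only [twist_apply, sphBoost_sphBoost_neg, stretch_sphBoost_neg]
  rw [Real.inv_rpow h.le, mul_assoc, inv_mul_cancel₀ (Real.rpow_pos_of_pos h _).ne', mul_one]

@[simp] lemma twist_twist_neg (e : ℝ) (w : Amb n) (u : C(Sph n, ℝ)) :
    twist e w (twist e (-w) u) = u := by simpa using twist_neg_twist e (-w) u

lemma twist_zero (e : ℝ) (u : C(Sph n, ℝ)) : twist e 0 u = u := by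
  ext x
  have h : sphBoost 0 x = x := by ext1; simp [coe_sphBoost, stretch]
  simp [h, stretch]

/-- Weights adding up to -n multiply to the Jacobian, so the two twists are dual to each other under
integration. -/
lemma integral_twist_mul_twist {e e' : ℝ} (he : e + e' = -n) (w : Amb n) (u f : C(Sph n, ℝ)) :
    ∫ x, twist e w u x * twist e' w f x ∂(surf n) = ∫ x, u x * f x ∂(surf n) := by
  refine Eq.trans ?_ (integral_comp_sphBoost w (u * f))
  refine integral_congr_ae (.of_forall fun x => ?_)
  have h := stretch_coe_pos w x
  have h2 : stretch w x ^ e * stretch w x ^ e' = (stretch w x)⁻¹ ^ n := by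
    rw [← Real.rpow_add h, he, Real.rpow_neg h.le, Real.rpow_natCast, inv_pow]
  simp only [twist_apply, ContinuousMap.mul_apply, smul_eq_mul, ← h2]
  ring

lemma integral_twist_mul {e e' : ℝ} (he : e + e' = -n) (w : Amb n) (u f : C(Sph n, ℝ)) :
    ∫ x, twist e w u x * f x ∂(surf n) = ∫ x, u x * twist e' (-w) f x ∂(surf n) := by
  rw [← integral_twist_mul_twist he w u (twist e' (-w) f), twist_twist_neg]

/-- Links the conformal action in the theorem with `twist`: the Jacobian is stretch^{-n}, and -n ·
(n - 2s)/(2n) = s - n/2. -/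
lemma pullback_boostConformal (hn : n ≠ 0) (s : ℝ) (w : Amb n) (u : C(Sph n, ℝ)) :
    pullback s (boostConformal w) u = twist (s - n / 2) w u := by
  ext x
  have h := stretch_coe_pos w x
  change u (sphBoost w x) * ((stretch w x)⁻¹ ^ n) ^ (((n : ℝ) - 2 * s) / (2 * n)) = _
  rw [twist_apply, ← Real.rpow_natCast, ← Real.rpow_mul (inv_nonneg.2 h.le), Real.inv_rpow h.le,
    ← Real.rpow_neg h.le]
  congr 2
  field_simp
  ring

/-- The kernel `(1 - x·y)^e`, a multiple of `|x - y|^{2e}` on the sphere. -/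
def rieszKer (e : ℝ) (x y : Sph n) : ℝ := (1 - ⟪(x : Amb n), (y : Amb n)⟫) ^ e

lemma one_sub_inner_nonneg (x y : Sph n) : 0 ≤ 1 - ⟪(x : Amb n), (y : Amb n)⟫ := by
  have := real_inner_le_norm (x : Amb n) (y : Amb n)
  simp at this
  linarith

lemma rieszKer_comm (e : ℝ) (x y : Sph n) : rieszKer e x y = rieszKer e y x := by
  rw [rieszKer, rieszKer, real_inner_comm]

lemma rieszKer_nonneg (e : ℝ) (x y : Sph n) : 0 ≤ rieszKer e x y :=
  Real.rpow_nonneg (one_sub_inner_nonneg x y) _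

lemma continuous_rieszKer {e : ℝ} (he : 0 < e) :
    Continuous (Function.uncurry (rieszKer e : Sph n → Sph n → ℝ)) := by
  have h : Continuous fun z : Sph n × Sph n => 1 - ⟪(z.1 : Amb n), (z.2 : Amb n)⟫ := by fun_prop
  exact h.rpow_const fun _ => Or.inr he.le

lemma continuous_rieszKer_right {e : ℝ} (he : 0 < e) (x : Sph n) : Continuous (rieszKer e x) := by
  have h : Continuous fun z : Sph n => 1 - ⟪(x : Amb n), (z : Amb n)⟫ := by fun_prop
  exact h.rpow_const fun _ => Or.inr he.le

/-- The function `y ↦ rieszKer e x y`. -/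
def rieszKerC (e : ℝ) (he : 0 < e) (x : Sph n) : C(Sph n, ℝ) := ⟨_, continuous_rieszKer_right he x⟩

@[simp] lemma rieszKerC_apply (e : ℝ) (he : 0 < e) (x y : Sph n) :
    rieszKerC e he x y = rieszKer e x y := rfl

lemma rieszKer_sphBoost (e : ℝ) (w : Amb n) (x y : Sph n) :
    rieszKer e (sphBoost w x) (sphBoost w y) =
      rieszKer e x y * stretch w x ^ (-e) * stretch w y ^ (-e) := by
  have hx := stretch_coe_pos w x
  have hy := stretch_coe_pos w y
  rw [rieszKer, one_sub_inner_sphBoost, Real.div_rpow (one_sub_inner_nonneg x y) (by positivity),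
    Real.mul_rpow hx.le hy.le, Real.rpow_neg hx.le, Real.rpow_neg hy.le, rieszKer]
  field_simp

lemma continuous_integral_surf {G : Sph n → Sph n → ℝ} (hG : Continuous (Function.uncurry G)) :
    Continuous fun x => ∫ y, G x y ∂(surf n) := by
  have := continuous_parametric_integral_of_continuous (μ := surf n) hG isCompact_univ
  simpa using this

/-- The integral operator with kernel `rieszKer e`. -/
def riesz (e : ℝ) (he : 0 < e) : C(Sph n, ℝ) →ₗ[ℝ] C(Sph n, ℝ) where
  toFun f :=
    { toFun := fun x => ∫ y, rieszKer e x y * f y ∂(surf n)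
      continuous_toFun := by
        refine continuous_integral_surf (G := fun x y => rieszKer e x y * f y) ?_
        exact (continuous_rieszKer he).mul (f.continuous.comp continuous_snd) }
  map_add' f g := by
    ext x
    have h := integral_add (integrable_surf (rieszKerC e he x * f))
      (integrable_surf (rieszKerC e he x * g))
    refine Eq.trans (integral_congr_ae (.of_forall fun y => ?_)) h
    simp [mul_add]
  map_smul' c f := by
    ext x
    have h := integral_const_mul c (fun y => (rieszKerC e he x * f) y) (μ := surf n)
    refine Eq.trans (integral_congr_ae (.of_forall fun y => ?_)) h
    simp [mul_left_comm]

lemma riesz_apply (e : ℝ) (he : 0 < e) (f : C(Sph n, ℝ)) (x : Sph n) :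
    riesz e he f x = ∫ y, rieszKer e x y * f y ∂(surf n) := rfl

lemma integral_riesz_mul (e : ℝ) (he : 0 < e) (f g : C(Sph n, ℝ)) :
    ∫ x, riesz e he f x * g x ∂(surf n) = ∫ x, f x * riesz e he g x ∂(surf n) := by
  simp only [riesz_apply, ← integral_mul_const, ← integral_const_mul]
  rw [integral_integral_swap_of_hasCompactSupport
    (f := fun x y => rieszKer e x y * f y * g x) _ (HasCompactSupport.of_compactSpace _)]
  · refine integral_congr_ae (.of_forall fun y => integral_congr_ae (.of_forall fun x => ?_))
    simp only
    rw [rieszKer_comm]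
    ring
  · exact ((continuous_rieszKer he).mul (f.continuous.comp continuous_snd)).mul
      (g.continuous.comp continuous_fst)

/-- Conformal covariance of the Riesz kernel operator. -/
lemma riesz_twist (e : ℝ) (he : 0 < e) (w : Amb n) (f : C(Sph n, ℝ)) :
    riesz e he (twist (-(n + e)) w f) = twist e w (riesz e he f) := by
  ext x
  have hx := stretch_coe_pos w x
  rw [twist_apply, riesz_apply, riesz_apply]
  have h := integral_comp_sphBoost w (rieszKerC e he (sphBoost w x) * f)
  simp only [ContinuousMap.mul_apply, rieszKerC_apply] at h
  rw [← h, ← integral_mul_const]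
  refine integral_congr_ae (.of_forall fun y => ?_)
  have hy := stretch_coe_pos w y
  have h2 : stretch w y ^ (-((n : ℝ) + e)) = (stretch w y)⁻¹ ^ n * stretch w y ^ (-e) := by
    rw [neg_add, Real.rpow_add hy, Real.rpow_neg hy.le, Real.rpow_natCast, inv_pow]
  have h3 : stretch w x ^ (-e) * stretch w x ^ e = 1 := by
    rw [← Real.rpow_add hx]; simp
  simp only [twist_apply, smul_eq_mul, rieszKer_sphBoost, h2]
  linear_combination -(rieszKer e x y * f (sphBoost w y) * (stretch w y)⁻¹ ^ n * stretch w y ^ (-e)) * h3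

lemma exists_riesz_one (e : ℝ) (he : 0 < e) : ∃ c : ℝ, ∀ x : Sph n, riesz e he 1 x = c := by
  have x₀ : Sph n := ⟨EuclideanSpace.single 0 1, by simp⟩
  refine ⟨riesz e he 1 x₀, fun x => ?_⟩
  simpa [riesz_apply, rieszKer] using
    integral_inner_coe_comp_congr (fun t => (1 - t) ^ e) x x₀

end Operators

/-! ### Differentiation along boosts -/

section Derivative

variable {n : ℕ}

/-- Taking G on the ambient space allows ordinary differentials. Compactness of [-1,1] × 𝕊^n bounds
the t-derivative, which justifies differentiation under the integral. -/
lemma hasDerivAt_integral_surf {G : ℝ → Amb n → ℝ}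
    (hG : ∀ t : ℝ, ∀ x : Sph n, ContDiffAt ℝ 1 (Function.uncurry G) (t, (x : Amb n)))
    (h : C(Sph n, ℝ)) {G' : Sph n → ℝ} (hG' : ∀ x : Sph n, HasDerivAt (fun t => G t x) (G' x) 0) :
    HasDerivAt (fun t => ∫ x : Sph n, G t x * h x ∂(surf n)) (∫ x, G' x * h x ∂(surf n)) 0 := by
  set D : ℝ → Sph n → ℝ := fun t x => fderiv ℝ (Function.uncurry G) (t, (x : Amb n)) (1, 0) with hD
  have hGc : Continuous fun z : ℝ × Sph n => G z.1 z.2 := by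
    refine continuous_iff_continuousAt.2 fun z => ?_
    exact ContinuousAt.comp (f := fun z : ℝ × Sph n => (z.1, (z.2 : Amb n))) (hG z.1 z.2).continuousAt
      (by fun_prop)
  have hDc : Continuous (Function.uncurry D) := by
    refine continuous_iff_continuousAt.2 fun z => ?_
    have h1 : ContinuousAt (fderiv ℝ (Function.uncurry G)) (z.1, (z.2 : Amb n)) :=
      ((hG z.1 z.2).fderiv_right (m := 0) (by simp)).continuousAt
    have h2 := ContinuousAt.comp (f := fun z : ℝ × Sph n => (z.1, (z.2 : Amb n))) (x := z) h1 (by fun_prop)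
    exact h2.clm_apply continuousAt_const
  have hd : ∀ t x, HasDerivAt (fun t => G t (x : Sph n)) (D t x) t := by
    intro t x
    have h1 := ((hG t x).differentiableAt one_ne_zero).hasFDerivAt
    have h2 : HasDerivAt (fun t : ℝ => (t, (x : Amb n))) ((1 : ℝ), (0 : Amb n)) t :=
      (hasDerivAt_id t).prodMk (hasDerivAt_const t _)
    exact h1.comp_hasDerivAt t h2
  have hGD : G' = D 0 := funext fun x => (hG' x).unique (hd 0 x)
  obtain ⟨M, hM⟩ := ((isCompact_Icc (a := (-1 : ℝ)) (b := 1)).prod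
    (isCompact_univ (X := Sph n))).exists_bound_of_continuousOn hDc.continuousOn
  obtain ⟨B, hB⟩ := (isCompact_univ (X := Sph n)).exists_bound_of_continuousOn h.continuous.continuousOn
  rw [hGD]
  refine (hasDerivAt_integral_of_dominated_loc_of_deriv_le (s := Set.Icc (-1) 1)
    (F := fun t x => G t (x : Sph n) * h x) (F' := fun t x => D t x * h x)
    (bound := fun _ => M * B) (Icc_mem_nhds (by norm_num) (by norm_num)) ?_ ?_ ?_ ?_ ?_ ?_).2
  · refine .of_forall fun t => ?_
    exact ((hGc.comp (Continuous.prodMk_right t)).mul h.continuous).aestronglyMeasurable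
  · exact integrable_surf ⟨_, (hGc.comp (Continuous.prodMk_right 0)).mul h.continuous⟩
  · exact ((hDc.comp (Continuous.prodMk_right 0)).mul h.continuous).aestronglyMeasurable
  · refine .of_forall fun x t ht => ?_
    rw [norm_mul]
    have h1 := hM (t, x) ⟨ht, trivial⟩
    exact mul_le_mul h1 (hB x trivial) (norm_nonneg _) ((norm_nonneg _).trans h1)
  · exact integrable_const _
  · exact .of_forall fun x t _ => (hd t x).mul_const _

lemma contDiff_lorentz {m : ℕ∞ω} : ContDiff ℝ m (lorentz : Amb n → ℝ) := by
  unfold lorentz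
  refine ContDiff.sqrt (contDiff_const.add (contDiff_norm_sq ℝ)) fun w => ?_
  positivity

lemma contDiff_uncurry_stretch {m : ℕ∞ω} (w v : Amb n) :
    ContDiff ℝ m (fun z : ℝ × Amb n => stretch (w + z.1 • v) z.2) := by
  unfold stretch
  refine ContDiff.add (contDiff_lorentz.comp (by fun_prop)) (ContDiff.inner ℝ ?_ ?_) <;> fun_prop

lemma contDiffAt_uncurry_boost {m : ℕ∞ω} (w v : Amb n) {z : ℝ × Amb n} (hz : z.2 ≠ 0) :
    ContDiffAt ℝ m (fun z : ℝ × Amb n => boost (w + z.1 • v) z.2) z := by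
  have h1 : ContDiffAt ℝ m (fun z : ℝ × Amb n => w + z.1 • v) z := by fun_prop
  have h2 : ContDiffAt ℝ m (fun z : ℝ × Amb n => z.2) z := by fun_prop
  have h3 : ContDiffAt ℝ m (fun z : ℝ × Amb n => 1 + lorentz (w + z.1 • v)) z :=
    contDiffAt_const.add (contDiff_lorentz.contDiffAt.comp z h1)
  unfold boost
  refine h2.add (ContDiffAt.smul (ContDiffAt.add ((h1.inner ℝ h2).div h3 ?_) (h2.norm ℝ hz)) h1)
  have := lorentz_pos (w + z.1 • v)
  positivity

lemma hasDerivAt_lorentz_line (w v : Amb n) :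
    HasDerivAt (fun t : ℝ => lorentz (w + t • v)) (⟪w, v⟫ / lorentz w) 0 := by
  have h1 : HasDerivAt (fun t : ℝ => w + t • v) v 0 := by
    simpa using ((hasDerivAt_id (0 : ℝ)).smul_const v).const_add w
  have h2 := (h1.norm_sq.const_add 1).sqrt (by positivity)
  refine h2.congr_deriv ?_
  simp [lorentz]
  field_simp

lemma hasDerivAt_stretch_line (w v : Amb n) (x : Amb n) :
    HasDerivAt (fun t : ℝ => stretch (w + t • v) x) (⟪w, v⟫ / lorentz w + ⟪v, x⟫) 0 := by
  have h1 : HasDerivAt (fun t : ℝ => ⟪w + t • v, x⟫) ⟪v, x⟫ 0 := by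
    simp only [inner_add_left, real_inner_smul_left]
    simpa using ((hasDerivAt_id (0 : ℝ)).mul_const ⟪v, x⟫).const_add ⟪w, x⟫
  exact (hasDerivAt_lorentz_line w v).add h1

lemma hasDerivAt_boost_line_zero (v : Amb n) (x : Sph n) :
    HasDerivAt (fun t : ℝ => boost (t • v) x) v 0 := by
  have h0 : HasDerivAt (fun t : ℝ => t • v) v 0 := by
    simpa using (hasDerivAt_id (0 : ℝ)).smul_const v
  have h1 : HasDerivAt (fun t : ℝ => ⟪t • v, (x : Amb n)⟫) ⟪v, (x : Amb n)⟫ 0 := by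
    simp only [real_inner_smul_left]
    simpa using (hasDerivAt_id (0 : ℝ)).mul_const ⟪v, (x : Amb n)⟫
  have h2 : HasDerivAt (fun t : ℝ => lorentz (t • v)) 0 0 := by
    simpa using hasDerivAt_lorentz_line 0 v
  have h3 := ((h1.div (h2.const_add 1) (by simp)).add_const (1 : ℝ)).smul h0
  have h4 := h3.const_add (x : Amb n)
  simp at h4
  simpa [boost] using h4

/-- The infinitesimal boost is the tangential projection of v, i.e. the gradient on the sphere of x
↦ ⟪v, x⟫. -/
lemma hasDerivAt_sphBoost_line_zero (v : Amb n) (x : Sph n) :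
    HasDerivAt (fun t : ℝ => (stretch (t • v) x)⁻¹ • boost (t • v) x)
      (v - ⟪v, (x : Amb n)⟫ • (x : Amb n)) 0 := by
  have h1 : HasDerivAt (fun t : ℝ => stretch (t • v) (x : Amb n)) ⟪v, (x : Amb n)⟫ 0 := by
    simpa using hasDerivAt_stretch_line 0 v (x : Amb n)
  have h2 := (h1.fun_inv (by simp [stretch])).fun_smul (hasDerivAt_boost_line_zero v x)
  refine h2.congr_deriv ?_
  simp [stretch]
  abel

lemma hasDerivAt_eval {c : ℝ → Amb n} {c' : Amb n} {t : ℝ} (hc : HasDerivAt c c' t)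
    (p : MvPolynomial (Fin (n + 1)) ℝ) :
    HasDerivAt (fun t => MvPolynomial.eval (fun i => c t i) p)
      (∑ i, c' i * MvPolynomial.eval (fun i => c t i) (MvPolynomial.pderiv i p)) t := by
  have hci : ∀ i, HasDerivAt (fun t => c t i) (c' i) t := fun i => by
    exact (EuclideanSpace.proj (𝕜 := ℝ) i).hasFDerivAt.comp_hasDerivAt t hc
  induction p using MvPolynomial.induction_on with
  | C a => simpa using hasDerivAt_const t a
  | add p q hp hq =>
    simp only [map_add, mul_add, Finset.sum_add_distrib]
    exact hp.add hq
  | mul_X p j hp =>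
    simp only [map_mul, MvPolynomial.eval_X]
    refine (hp.mul (hci j)).congr_deriv ?_
    simp only [MvPolynomial.pderiv_mul, map_add, map_mul, MvPolynomial.eval_X, mul_add,
      Finset.sum_add_distrib, Finset.sum_mul]
    congr 1
    · exact Finset.sum_congr rfl fun i _ => by ring
    · rw [Finset.sum_eq_single j]
      · simp [mul_comm]
      · intro b _ hb
        simp [MvPolynomial.pderiv_X_of_ne hb.symm]
      · simp

lemma contDiff_eval {m : ℕ∞ω} (p : MvPolynomial (Fin (n + 1)) ℝ) :
    ContDiff ℝ m fun X : Amb n => MvPolynomial.eval (fun i => X i) p := by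
  induction p using MvPolynomial.induction_on with
  | C a => simpa using contDiff_const
  | add p q hp hq => simpa using hp.add hq
  | mul_X p j hp =>
    simp only [map_mul, MvPolynomial.eval_X]
    exact hp.mul (by fun_prop)

lemma polyRestrict_apply (p : MvPolynomial (Fin (n + 1)) ℝ) (x : Sph n) :
    polyRestrict n p x = MvPolynomial.eval (fun i => (x : Amb n) i) p := rfl

/-- The derivative at `t = 0` of `twist e (t • e_j)` on a homogeneous polynomial. -/
lemma hasDerivAt_twist_polyRestrict (e : ℝ) (j : Fin (n + 1)) {l : ℕ}
    {p : MvPolynomial (Fin (n + 1)) ℝ} (hp : p.IsHomogeneous l) (x : Sph n) :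
    HasDerivAt (fun t : ℝ => MvPolynomial.eval
        (fun i => ((stretch (t • EuclideanSpace.single j 1) x)⁻¹ •
          boost (t • EuclideanSpace.single j 1) (x : Amb n)) i) p *
        stretch (t • EuclideanSpace.single j 1) x ^ e)
      (polyRestrict n (MvPolynomial.pderiv j p + MvPolynomial.C (e - l) * (MvPolynomial.X j * p)) x) 0 := by
  set v : Amb n := EuclideanSpace.single j 1
  have hv : ⟪v, (x : Amb n)⟫ = (x : Amb n) j := by simp [v, EuclideanSpace.inner_single_left]
  have h1 : HasDerivAt (fun t : ℝ => stretch (t • v) (x : Amb n)) ((x : Amb n) j) 0 := by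
    simpa [hv] using hasDerivAt_stretch_line 0 v (x : Amb n)
  have h2 := h1.rpow_const (p := e) (Or.inl (by simp [stretch]))
  have h3 := hasDerivAt_eval (hasDerivAt_sphBoost_line_zero v x) p
  have h4 := h3.fun_mul h2
  refine h4.congr_deriv ?_
  -- Euler's identity: the radial part of the vector field multiplies p by its degree l.
  have h5 := congrArg (MvPolynomial.eval fun i => (x : Amb n) i) hp.sum_X_mul_pderiv
  simp only [map_sum, map_mul, MvPolynomial.eval_X, nsmul_eq_mul, map_natCast] at h5
  have h6 : ∑ i, (v - ⟪v, (x : Amb n)⟫ • (x : Amb n)) i *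
      MvPolynomial.eval (fun i => (x : Amb n) i) (MvPolynomial.pderiv i p) =
      MvPolynomial.eval (fun i => (x : Amb n) i) (MvPolynomial.pderiv j p) -
        (x : Amb n) j * (l * MvPolynomial.eval (fun i => (x : Amb n) i) p) := by
    rw [← h5, Finset.mul_sum]
    simp only [PiLp.sub_apply, PiLp.smul_apply, smul_eq_mul, hv, sub_mul, Finset.sum_sub_distrib, mul_assoc]
    congr 1
    rw [Finset.sum_eq_single j] <;> simp +contextual [v]
  simp only [zero_smul, boost_zero_left, stretch, lorentz_zero, inner_zero_left, add_zero, inv_one,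
    one_smul, Real.one_rpow, mul_one, h6, polyRestrict_apply, RingHom.map_add, RingHom.map_mul,
    MvPolynomial.eval_C, MvPolynomial.eval_X]
  ring

/-- The infinitesimal form of the conformal covariance of the Riesz kernel operator. -/
lemma riesz_infinitesimal (e : ℝ) (he : 0 < e) (j : Fin (n + 1)) {l : ℕ}
    {p : MvPolynomial (Fin (n + 1)) ℝ} (hp : p.IsHomogeneous l) {c : ℝ}
    (hc : riesz e he (polyRestrict n p) = c • polyRestrict n p) :
    riesz e he (polyRestrict n (MvPolynomial.pderiv j p +
        MvPolynomial.C (-(n + e) - l) * (MvPolynomial.X j * p))) =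
      c • polyRestrict n (MvPolynomial.pderiv j p +
        MvPolynomial.C (e - l) * (MvPolynomial.X j * p)) := by
  ext x
  set v : Amb n := EuclideanSpace.single j 1
  set G : ℝ → Amb n → ℝ := fun t X => MvPolynomial.eval
    (fun i => ((stretch (t • v) X)⁻¹ • boost (t • v) X) i) p * stretch (t • v) X ^ (-((n : ℝ) + e))
  have hGc : ∀ t : ℝ, ∀ y : Sph n, ContDiffAt ℝ 1 (Function.uncurry G) (t, (y : Amb n)) := by
    intro t y
    have hs : ContDiffAt ℝ 1 (fun z : ℝ × Amb n => stretch (z.1 • v) z.2) (t, (y : Amb n)) := by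
      simpa using (contDiff_uncurry_stretch 0 v).contDiffAt
    have hb : ContDiffAt ℝ 1 (fun z : ℝ × Amb n => boost (z.1 • v) z.2) (t, (y : Amb n)) := by
      simpa using contDiffAt_uncurry_boost 0 v (z := (t, (y : Amb n))) (coe_sph_ne_zero y)
    have hne : stretch (t • v) (y : Amb n) ≠ 0 := (stretch_coe_pos _ y).ne'
    exact ((contDiff_eval p).contDiffAt.comp (t, (y : Amb n)) ((hs.inv hne).smul hb)).mul
      (hs.rpow_const_of_ne hne)
  have d1 := hasDerivAt_integral_surf hGc (rieszKerC e he x)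
    (fun y => hasDerivAt_twist_polyRestrict (-((n : ℝ) + e)) j hp y)
  have d2 := (hasDerivAt_twist_polyRestrict e j hp x).const_mul c
  -- Covariance holds for every t, so the derivatives of its two sides at t = 0 agree.
  have heq : (fun t : ℝ => ∫ y : Sph n, G t y * rieszKerC e he x y ∂(surf n)) = fun t : ℝ =>
      c * (MvPolynomial.eval
        (fun i => ((stretch (t • v) x)⁻¹ • boost (t • v) (x : Amb n)) i) p * stretch (t • v) x ^ e) := by
    funext t
    have h1 := congrArg (fun f : C(Sph n, ℝ) => f x) (riesz_twist e he (t • v) (polyRestrict n p))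
    simp only [hc, twist_apply, ContinuousMap.smul_apply, smul_eq_mul, riesz_apply] at h1
    refine Eq.trans (integral_congr_ae (.of_forall fun y => ?_)) (h1.trans ?_)
    · exact mul_comm _ _
    · rw [mul_assoc]; rfl
  rw [heq] at d1
  have h := d1.unique d2
  rw [riesz_apply, ContinuousMap.smul_apply, smul_eq_mul, ← h]
  exact integral_congr_ae (.of_forall fun y => mul_comm _ _)

end Derivative

/-! ### Harmonic polynomials -/

section Harmonic

open MvPolynomial

variable {n : ℕ}

/-- The Laplacian of a polynomial. -/
def polyLaplacian (p : MvPolynomial (Fin (n + 1)) ℝ) : MvPolynomial (Fin (n + 1)) ℝ :=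
  ∑ i, pderiv i (pderiv i p)

/-- The polynomial `∑ x_i²`. -/
def normSqPoly (n : ℕ) : MvPolynomial (Fin (n + 1)) ℝ := ∑ i, X i ^ 2

lemma mem_harmonicPoly {l : ℕ} {p : MvPolynomial (Fin (n + 1)) ℝ} :
    p ∈ harmonicPoly n l ↔ p.IsHomogeneous l ∧ polyLaplacian p = 0 := by
  simp [harmonicPoly, polyLaplacian, LinearMap.sum_apply]

lemma pderiv_pderiv_comm (i j : Fin (n + 1)) (p : MvPolynomial (Fin (n + 1)) ℝ) :
    pderiv i (pderiv j p) = pderiv j (pderiv i p) := by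
  let D : Derivation ℝ (MvPolynomial (Fin (n + 1)) ℝ) (MvPolynomial (Fin (n + 1)) ℝ) := pderiv i
  let D' : Derivation ℝ (MvPolynomial (Fin (n + 1)) ℝ) (MvPolynomial (Fin (n + 1)) ℝ) := pderiv j
  have h : ⁅D, D'⁆ = 0 := by
    refine MvPolynomial.derivation_ext fun k => ?_
    rw [Derivation.commutator_apply]
    simp [D, D', pderiv_X, Pi.single_apply, apply_ite]
  have h2 := congrArg (fun D => D p) h
  simp only [Derivation.commutator_apply, Derivation.coe_zero, Pi.zero_apply] at h2
  exact sub_eq_zero.1 h2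

lemma pderiv_mem_harmonicPoly {l : ℕ} {p : MvPolynomial (Fin (n + 1)) ℝ} (j : Fin (n + 1))
    (hp : p ∈ harmonicPoly n (l + 1)) : pderiv j p ∈ harmonicPoly n l := by
  rw [mem_harmonicPoly] at hp ⊢
  refine ⟨by simpa using hp.1.pderiv (i := j), ?_⟩
  have : polyLaplacian (pderiv j p) = pderiv j (polyLaplacian p) := by
    simp only [polyLaplacian, map_sum]
    refine Finset.sum_congr rfl fun i _ => ?_
    rw [pderiv_pderiv_comm i j, pderiv_pderiv_comm i j]
  rw [this, hp.2, map_zero]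

lemma polyLaplacian_X_mul (j : Fin (n + 1)) (p : MvPolynomial (Fin (n + 1)) ℝ) :
    polyLaplacian (X j * p) = 2 * pderiv j p + X j * polyLaplacian p := by
  have h : ∀ i, pderiv i (pderiv i (X j * p)) =
      2 * (pderiv i (X j) * pderiv i p) + X j * pderiv i (pderiv i p) := by
    intro i
    have h0 : pderiv i (pderiv i (X j : MvPolynomial (Fin (n + 1)) ℝ)) = 0 := by
      by_cases hij : j = i <;> simp [pderiv_X, hij]
    simp only [pderiv_mul, map_add, h0]
    ring
  simp only [polyLaplacian, h, Finset.sum_add_distrib, ← Finset.mul_sum]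
  congr 2
  rw [Finset.sum_eq_single j]
  · simp
  · intro i _ hi
    simp [pderiv_X_of_ne hi.symm]
  · simp

lemma pderiv_normSqPoly (i : Fin (n + 1)) : pderiv i (normSqPoly n) = 2 * X i := by
  simp only [normSqPoly, map_sum, pderiv_pow]
  rw [Finset.sum_eq_single i]
  · simp
  · intro k _ hk
    simp [pderiv_X_of_ne hk]
  · simp

lemma polyLaplacian_normSqPoly_mul {m : ℕ} {q : MvPolynomial (Fin (n + 1)) ℝ}
    (hq : q.IsHomogeneous m) :
    polyLaplacian (normSqPoly n * q) =
      C (2 * (n + 1) + 4 * (m : ℝ)) * q + normSqPoly n * polyLaplacian q := by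
  have h : ∀ i, pderiv i (pderiv i (normSqPoly n * q)) =
      2 * q + 4 * (X i * pderiv i q) + normSqPoly n * pderiv i (pderiv i q) := by
    intro i
    have h2 : pderiv i (2 : MvPolynomial (Fin (n + 1)) ℝ) = 0 := by
      have := (pderiv i : Derivation ℝ (MvPolynomial (Fin (n + 1)) ℝ) _).map_natCast 2
      simpa using this
    simp only [pderiv_mul, map_add, pderiv_normSqPoly, pderiv_X_self, h2]
    ring
  simp only [polyLaplacian, h, Finset.sum_add_distrib, ← Finset.mul_sum, hq.sum_X_mul_pderiv]
  have h2 : (C (2 * ((n : ℝ) + 1) + 4 * m) : MvPolynomial (Fin (n + 1)) ℝ) =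
      2 * (n + 1) + 4 * m := by
    simp only [map_add, map_mul, map_natCast, map_ofNat, map_one]
  rw [h2]
  simp
  ring

lemma isHomogeneous_normSqPoly : (normSqPoly n).IsHomogeneous 2 :=
  IsHomogeneous.sum _ _ _ fun i _ => by simpa using (isHomogeneous_X ℝ i).pow 2

lemma polyRestrict_mul (p q : MvPolynomial (Fin (n + 1)) ℝ) :
    polyRestrict n (p * q) = polyRestrict n p * polyRestrict n q := by
  ext x; simp [polyRestrict_apply]

lemma polyRestrict_C (c : ℝ) : polyRestrict n (C c) = c • 1 := by
  ext x; simp [polyRestrict_apply]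

lemma polyRestrict_C_mul (c : ℝ) (p : MvPolynomial (Fin (n + 1)) ℝ) :
    polyRestrict n (C c * p) = c • polyRestrict n p := by
  ext x; simp [polyRestrict_apply]

lemma polyRestrict_normSqPoly : polyRestrict n (normSqPoly n) = 1 := by
  ext x
  have h := EuclideanSpace.norm_sq_eq (x : Amb n)
  simp only [norm_coe_sph, one_pow, Real.norm_eq_abs, sq_abs] at h
  simp [polyRestrict_apply, normSqPoly, ← h]

/-- The harmonic projection of `X j * p`, for `p` harmonic of degree `l`. -/
def raise (l : ℕ) (j : Fin (n + 1)) (p : MvPolynomial (Fin (n + 1)) ℝ) :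
    MvPolynomial (Fin (n + 1)) ℝ :=
  X j * p - normSqPoly n * (C ((2 * l + n - 1 : ℝ)⁻¹) * pderiv j p)

/-- On the sphere |x|² = 1, so for p harmonic of degree l multiplication by a coordinate splits into
harmonics of degrees l + 1 and l - 1. -/
lemma polyRestrict_X_mul (l : ℕ) (j : Fin (n + 1)) (p : MvPolynomial (Fin (n + 1)) ℝ) :
    polyRestrict n (X j * p) = polyRestrict n (raise l j p) +
      (2 * l + n - 1 : ℝ)⁻¹ • polyRestrict n (pderiv j p) := by
  rw [raise, map_sub, polyRestrict_mul (normSqPoly n), polyRestrict_normSqPoly, one_mul,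
    polyRestrict_C_mul, sub_add_cancel]

lemma eq_C_of_isHomogeneous_zero {p : MvPolynomial (Fin (n + 1)) ℝ} (hp : p.IsHomogeneous 0) :
    p = C (coeff 0 p) :=
  totalDegree_eq_zero_iff_eq_C.1 (Nat.le_zero.1 hp.totalDegree_le)

lemma pderiv_eq_zero_of_isHomogeneous_zero {p : MvPolynomial (Fin (n + 1)) ℝ}
    (hp : p.IsHomogeneous 0) (j : Fin (n + 1)) : pderiv j p = 0 := by
  rw [eq_C_of_isHomogeneous_zero hp]
  simp

/-- Δ(x_j p) = 2 ∂_j p, while Δ(|x|² q) = (2(n+1) + 4(l-1)) q for q harmonic of degree l - 1; the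
quotient of the two constants is 1/(2l + n - 1). In degree 0 the correction is absent because ∂_j p
= 0. -/
lemma raise_mem_harmonicPoly (hn : 2 ≤ n) {l : ℕ} {p : MvPolynomial (Fin (n + 1)) ℝ}
    (j : Fin (n + 1)) (hp : p ∈ harmonicPoly n l) : raise l j p ∈ harmonicPoly n (l + 1) := by
  have hn' : (2 : ℝ) ≤ n := by exact_mod_cast hn
  have hX : (X j * p).IsHomogeneous (l + 1) := by
    simpa [add_comm] using (isHomogeneous_X ℝ j).mul (mem_harmonicPoly.1 hp).1
  have hL : polyLaplacian (X j * p) = 2 * pderiv j p := by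
    rw [polyLaplacian_X_mul, (mem_harmonicPoly.1 hp).2, mul_zero, add_zero]
  have hsub : ∀ p q : MvPolynomial (Fin (n + 1)) ℝ,
      polyLaplacian (p - q) = polyLaplacian p - polyLaplacian q := fun p q => by
    simp [polyLaplacian, Finset.sum_sub_distrib]
  cases l with
  | zero =>
    have h0 := pderiv_eq_zero_of_isHomogeneous_zero (mem_harmonicPoly.1 hp).1 j
    rw [mem_harmonicPoly]
    simp only [raise, h0, mul_zero, sub_zero]
    exact ⟨hX, by rw [hL, h0, mul_zero]⟩
  | succ m =>
    have hd := mem_harmonicPoly.1 (pderiv_mem_harmonicPoly j hp)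
    set c : ℝ := (2 * ((m + 1 : ℕ) : ℝ) + n - 1)⁻¹ with hc
    have hq : (C c * pderiv j p).IsHomogeneous m := by
      simpa using (isHomogeneous_C _ c).mul hd.1
    have hqL : polyLaplacian (C c * pderiv j p) = 0 := by
      have : polyLaplacian (C c * pderiv j p) = C c * polyLaplacian (pderiv j p) := by
        simp only [polyLaplacian, pderiv_C_mul, Finset.mul_sum]
      rw [this, hd.2, mul_zero]
    rw [mem_harmonicPoly]
    refine ⟨hX.sub ?_, ?_⟩
    · have := (isHomogeneous_normSqPoly (n := n)).mul hq
      rwa [show 2 + m = m + 1 + 1 by ring] at this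
    · rw [raise, hsub, hL, polyLaplacian_normSqPoly_mul hq, hqL, mul_zero, add_zero, ← mul_assoc,
        ← C_mul]
      have h1 : (2 * ((n : ℝ) + 1) + 4 * m) * c = 2 := by
        rw [hc]
        push_cast
        have : (2 * ((m : ℝ) + 1) + n - 1) ≠ 0 := by
          have : (0 : ℝ) ≤ m := m.cast_nonneg
          linarith
        field_simp
        ring
      rw [h1, map_ofNat, sub_self]

/-- By Euler's identity and harmonicity, every harmonic polynomial of degree l + 1 is a combination
of raised ones. This lets the eigenvalue computation proceed by induction on the degree. -/
lemma sum_raise_pderiv {l : ℕ} {p : MvPolynomial (Fin (n + 1)) ℝ}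
    (hp : p ∈ harmonicPoly n (l + 1)) : ∑ i, raise l i (pderiv i p) = C ((l : ℝ) + 1) * p := by
  rw [mem_harmonicPoly] at hp
  simp only [raise, Finset.sum_sub_distrib, ← Finset.mul_sum, hp.1.sum_X_mul_pderiv]
  have := hp.2
  rw [polyLaplacian] at this
  rw [this]
  simp

/-- The eigenvalues of the Riesz kernel operator. -/
def rieszEig (n : ℕ) (e c : ℝ) : ℕ → ℝ
  | 0 => c
  | l + 1 => rieszEig n e c l * (l - e) / (l + n + e)

/-- A substitute for the Funk–Hecke formula. The infinitesimal covariance for p of degree l is split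
by `polyRestrict_X_mul`: the degree l - 1 part cancels by the recursion already known, and the
degree l + 1 part forces the eigenvalue ratio (l - e)/(l + n + e). -/
lemma riesz_polyRestrict (hn : 2 ≤ n) (e : ℝ) (he : 0 < e) {c : ℝ}
    (hc : ∀ x : Sph n, riesz e he 1 x = c) (l : ℕ) :
    ∀ p ∈ harmonicPoly n l,
      riesz e he (polyRestrict n p) = rieszEig n e c l • polyRestrict n p := by
  have hn' : (2 : ℝ) ≤ n := by exact_mod_cast hn
  induction l using Nat.strong_induction_on with
  | _ l ih =>
  cases l with
  | zero =>
    intro p hp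
    rw [eq_C_of_isHomogeneous_zero (mem_harmonicPoly.1 hp).1, polyRestrict_C, map_smul]
    ext x
    simp [hc, rieszEig, mul_comm]
  | succ l =>
    have hl : (0 : ℝ) ≤ l := l.cast_nonneg
    have key : ∀ j, ∀ p ∈ harmonicPoly n l, riesz e he (polyRestrict n (raise l j p)) =
        rieszEig n e c (l + 1) • polyRestrict n (raise l j p) := by
      intro j p hp
      have hi := riesz_infinitesimal e he j (mem_harmonicPoly.1 hp).1 (ih l (by omega) p hp)
      set m : ℝ := 2 * l + n - 1 with hm
      have hm0 : m ≠ 0 := by have : 0 < m := by rw [hm]; linarith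
                             exact this.ne'
      -- k is the eigenvalue in degree l - 1. For l = 0 the derivative vanishes and any k would do.
      have hD : ∃ k : ℝ, riesz e he (polyRestrict n (pderiv j p)) = k • polyRestrict n (pderiv j p) ∧
          (k * (1 - (l + n + e) / m) - rieszEig n e c l * (1 + (e - l) / m)) •
            polyRestrict n (pderiv j p) = 0 := by
        cases l with
        | zero =>
          refine ⟨0, ?_⟩
          simp [pderiv_eq_zero_of_isHomogeneous_zero (mem_harmonicPoly.1 hp).1 j]
        | succ l' =>
          refine ⟨_, ih l' (by omega) _ (pderiv_mem_harmonicPoly j hp), ?_⟩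
          convert zero_smul ℝ _ using 2
          simp only [rieszEig]
          have : (l' : ℝ) + n + e ≠ 0 := by positivity
          field_simp
          rw [hm]
          push_cast
          ring
      obtain ⟨k, hk, hk0⟩ := hD
      have hpos : (l : ℝ) + n + e ≠ 0 := by positivity
      simp only [map_add, polyRestrict_C_mul, polyRestrict_X_mul l j p, map_smul, hk, smul_add] at hi
      rw [← hm] at hi
      have e1 : ((l : ℝ) + n + e) • riesz e he (polyRestrict n (raise l j p)) =
          (rieszEig n e c l * (l - e)) • polyRestrict n (raise l j p) := by
        ext x
        have h1 := congrArg (fun f : C(Sph n, ℝ) => f x) hi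
        have h2 := congrArg (fun f : C(Sph n, ℝ) => f x) hk0
        simp only [ContinuousMap.add_apply, ContinuousMap.smul_apply, smul_eq_mul,
          ContinuousMap.zero_apply] at h1 h2 ⊢
        field_simp at h1 h2
        have : m * ((l + n + e) * (riesz e he (polyRestrict n (raise l j p)) x) -
            (rieszEig n e c l * (l - e)) * polyRestrict n (raise l j p) x) = 0 := by
          linear_combination h2 - h1
        have := (mul_eq_zero.1 this).resolve_left hm0
        linarith
      have e2 := congrArg (fun f => ((l : ℝ) + n + e)⁻¹ • f) e1
      simp only [smul_smul, inv_mul_cancel₀ hpos, one_smul] at e2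
      rw [e2, rieszEig]
      congr 1
      field_simp
    intro p hp
    have hsum := sum_raise_pderiv hp
    have h1 : (riesz e he (polyRestrict n (C ((l : ℝ) + 1) * p))) =
        rieszEig n e c (l + 1) • polyRestrict n (C ((l : ℝ) + 1) * p) := by
      rw [← hsum]
      simp only [map_sum, Finset.smul_sum]
      exact Finset.sum_congr rfl fun j _ => key j _ (pderiv_mem_harmonicPoly j hp)
    rw [polyRestrict_C_mul, map_smul, smul_comm] at h1
    exact smul_right_injective _ (by positivity : (l : ℝ) + 1 ≠ 0) h1

end Harmonic

/-! ### Spherical harmonics decomposition of `L²` -/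

section Decomposition

variable {n : ℕ}

lemma inner_toL2 (f g : C(Sph n, ℝ)) :
    ⟪toL2 n f, toL2 n g⟫ = ∫ x, f x * g x ∂(surf n) := by
  have h := ContinuousMap.inner_toLp (𝕜 := ℝ) (surf n) f g
  refine h.trans (integral_congr_ae (.of_forall fun x => ?_))
  simp [mul_comm]

lemma norm_toL2_sq (f : C(Sph n, ℝ)) : ‖toL2 n f‖ ^ 2 = ∫ x, f x ^ 2 ∂(surf n) := by
  rw [← real_inner_self_eq_norm_sq, inner_toL2]
  simp only [sq]

lemma mem_sphHarm {l : ℕ} {f : L2 n} :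
    f ∈ sphHarm n l ↔ ∃ p ∈ harmonicPoly n l, toL2 n (polyRestrict n p) = f := by
  simp [sphHarm]

lemma toL2_polyRestrict_mem {l : ℕ} {p : MvPolynomial (Fin (n + 1)) ℝ} (hp : p ∈ harmonicPoly n l) :
    toL2 n (polyRestrict n p) ∈ sphHarm n l := mem_sphHarm.2 ⟨p, hp, rfl⟩

lemma rieszEig_one_neg (hn : 2 ≤ n) {e c : ℝ} (he : e ∈ Set.Ioo (0 : ℝ) 1) (hc : 0 < c) (l : ℕ) :
    rieszEig n e c (l + 1) < 0 := by
  obtain ⟨he0, he1⟩ := he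
  induction l with
  | zero =>
    simp only [rieszEig, Nat.cast_zero, zero_sub, zero_add]
    refine div_neg_of_neg_of_pos (mul_neg_of_pos_of_neg hc (by linarith)) (by positivity)
  | succ l ih =>
    rw [rieszEig]
    refine div_neg_of_neg_of_pos (mul_neg_of_neg_of_pos ih ?_) (by positivity)
    push_cast
    have : (0 : ℝ) ≤ l := l.cast_nonneg
    linarith

lemma rieszEig_ne_zero (hn : 2 ≤ n) {e c : ℝ} (he : e ∈ Set.Ioo (0 : ℝ) 1) (hc : 0 < c) (l : ℕ) :
    rieszEig n e c l ≠ 0 := by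
  cases l with
  | zero => exact hc.ne'
  | succ l => exact (rieszEig_one_neg hn he hc l).ne

/-- The eigenvalue is positive in degree 0; from degree 1 on the eigenvalues are negative and
strictly increasing, since each ratio lies in (0,1). -/
lemma rieszEig_injective (hn : 2 ≤ n) {e c : ℝ} (he : e ∈ Set.Ioo (0 : ℝ) 1) (hc : 0 < c) :
    Function.Injective (rieszEig n e c) := by
  have hmono : StrictMono fun l => rieszEig n e c (l + 1) := by
    refine strictMono_nat_of_lt_succ fun l => ?_
    have h := rieszEig_one_neg hn he hc l
    obtain ⟨he0, he1⟩ := he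
    have hn' : (2 : ℝ) ≤ n := by exact_mod_cast hn
    have hl : (0 : ℝ) ≤ l := l.cast_nonneg
    simp only [rieszEig.eq_2 n e c (l + 1)]
    rw [lt_div_iff₀ (by positivity)]
    push_cast
    nlinarith
  intro l m hlm
  rcases l with _ | l <;> rcases m with _ | m
  · rfl
  · have := rieszEig_one_neg hn he hc m
    rw [← hlm] at this
    exact absurd hc this.not_gt
  · have := rieszEig_one_neg hn he hc l
    rw [hlm] at this
    exact absurd hc this.not_gt
  · rw [hmono.injective hlm]

/-- The Riesz kernel operator acts on constants by a positive constant. -/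
lemma exists_riesz_one_pos (e : ℝ) (he : 0 < e) :
    ∃ c : ℝ, 0 < c ∧ ∀ x : Sph n, riesz e he 1 x = c := by
  obtain ⟨c, hc⟩ := exists_riesz_one (n := n) e he
  refine ⟨c, ?_, hc⟩
  have x₀ : Sph n := ⟨EuclideanSpace.single 0 1, by simp⟩
  rw [← hc x₀, riesz_apply]
  simp only [ContinuousMap.one_apply, mul_one]
  refine (continuous_rieszKer_right he x₀).integral_pos_of_hasCompactSupport_nonneg_nonzero
    (HasCompactSupport.of_compactSpace _) (fun y => rieszKer_nonneg e x₀ y) (x := -x₀) ?_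
  rw [rieszKer]
  simp
  norm_num
  positivity

/-- Eigenvectors of a symmetric operator with distinct eigenvalues are orthogonal. The kernel
exponent 1/2 is an arbitrary choice in (0,1). -/
lemma inner_sphHarm_of_ne (hn : 2 ≤ n) {l m : ℕ} (hlm : l ≠ m) {f g : L2 n} (hf : f ∈ sphHarm n l)
    (hg : g ∈ sphHarm n m) : ⟪f, g⟫ = 0 := by
  obtain ⟨p, hp, rfl⟩ := mem_sphHarm.1 hf
  obtain ⟨q, hq, rfl⟩ := mem_sphHarm.1 hg
  have he : (1 / 2 : ℝ) ∈ Set.Ioo (0 : ℝ) 1 := by norm_num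
  obtain ⟨c, hc, hc1⟩ := exists_riesz_one_pos (n := n) (1 / 2) he.1
  have h := integral_riesz_mul (1 / 2) he.1 (polyRestrict n p) (polyRestrict n q)
  rw [riesz_polyRestrict hn _ he.1 hc1 l p hp, riesz_polyRestrict hn _ he.1 hc1 m q hq] at h
  simp only [ContinuousMap.smul_apply, smul_eq_mul, mul_assoc, mul_left_comm _ (rieszEig _ _ _ _),
    integral_const_mul] at h
  rw [inner_toL2]
  have hne : rieszEig n (1 / 2) c l - rieszEig n (1 / 2) c m ≠ 0 :=
    sub_ne_zero.2 fun h => hlm (rieszEig_injective hn he hc h)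
  refine (mul_eq_zero.1 ?_).resolve_left hne
  rw [sub_mul, sub_eq_zero]
  exact h

lemma X_mul_mem_iSup (hn : 2 ≤ n) (j : Fin (n + 1)) {f : C(Sph n, ℝ)}
    (hf : f ∈ ⨆ l, (harmonicPoly n l).map (polyRestrict n)) :
    polyRestrict n (MvPolynomial.X j) * f ∈ ⨆ l, (harmonicPoly n l).map (polyRestrict n) := by
  induction hf using Submodule.iSup_induction' with
  | mem l f hf =>
    obtain ⟨p, hp, rfl⟩ := hf
    rw [← polyRestrict_mul, polyRestrict_X_mul l]
    refine add_mem (Submodule.mem_iSup_of_mem (l + 1) ⟨_, raise_mem_harmonicPoly hn j hp, rfl⟩)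
      (Submodule.smul_mem _ _ ?_)
    cases l with
    | zero =>
      rw [pderiv_eq_zero_of_isHomogeneous_zero (mem_harmonicPoly.1 hp).1, map_zero]
      exact zero_mem _
    | succ l => exact Submodule.mem_iSup_of_mem l ⟨_, pderiv_mem_harmonicPoly j hp, rfl⟩
  | zero => simp
  | add f g _ _ hf hg => rw [mul_add]; exact add_mem hf hg

/-- The span of the harmonics contains the constants and is stable under multiplication by
coordinates, so it contains every polynomial. -/
lemma polyRestrict_mem_iSup (hn : 2 ≤ n) (p : MvPolynomial (Fin (n + 1)) ℝ) :
    polyRestrict n p ∈ ⨆ l, (harmonicPoly n l).map (polyRestrict n) := by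
  induction p using MvPolynomial.induction_on with
  | C a =>
    refine Submodule.mem_iSup_of_mem 0 ⟨_, ?_, rfl⟩
    change _ ∈ harmonicPoly n 0
    rw [mem_harmonicPoly]
    exact ⟨MvPolynomial.isHomogeneous_C _ _, by simp [polyLaplacian]⟩
  | add p q hp hq => rw [map_add]; exact add_mem hp hq
  | mul_X p j hp =>
    rw [mul_comm, polyRestrict_mul]
    exact X_mul_mem_iSup hn j hp

/-- Restrictions of polynomials, as a subalgebra. -/
def polySubalgebra (n : ℕ) : Subalgebra ℝ C(Sph n, ℝ) where
  carrier := Set.range (polyRestrict n)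
  mul_mem' := by
    rintro _ _ ⟨p, rfl⟩ ⟨q, rfl⟩
    exact ⟨p * q, polyRestrict_mul p q⟩
  add_mem' := by
    rintro _ _ ⟨p, rfl⟩ ⟨q, rfl⟩
    exact ⟨p + q, map_add _ _ _⟩
  algebraMap_mem' r := ⟨MvPolynomial.C r, by
    rw [polyRestrict_C, Algebra.algebraMap_eq_smul_one]⟩

lemma polySubalgebra_topologicalClosure : (polySubalgebra n).topologicalClosure = ⊤ := by
  refine ContinuousMap.subalgebra_topologicalClosure_eq_top_of_separatesPoints _ fun x y hxy => ?_
  obtain ⟨i, hi⟩ : ∃ i, (x : Amb n) i ≠ (y : Amb n) i := by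
    by_contra! h
    exact hxy (Subtype.ext (PiLp.ext h))
  refine ⟨_, ⟨polyRestrict n (MvPolynomial.X i), ⟨_, rfl⟩, rfl⟩, ?_⟩
  simpa [polyRestrict_apply] using hi

/-- Completeness: polynomials are uniformly dense in the continuous functions by Stone–Weierstrass,
and continuous functions are dense in L². -/
lemma top_le_closure_iSup_sphHarm (hn : 2 ≤ n) : ⊤ ≤ (⨆ l, sphHarm n l).topologicalClosure := by
  have h1 : ∀ f : C(Sph n, ℝ), toL2 n f ∈ (⨆ l, sphHarm n l).topologicalClosure := by
    intro f
    have hf : f ∈ closure (Set.range (polyRestrict n)) := by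
      have h : f ∈ (polySubalgebra n).topologicalClosure := by
        rw [polySubalgebra_topologicalClosure]; trivial
      exact h
    have h2 := image_closure_subset_closure_image (toL2 n).continuous ⟨f, hf, rfl⟩
    refine closure_mono ?_ h2
    rintro _ ⟨_, ⟨p, rfl⟩, rfl⟩
    have h3 := Submodule.mem_map_of_mem (f := (toL2 n).toLinearMap) (polyRestrict_mem_iSup hn p)
    rw [Submodule.map_iSup] at h3
    have h4 : ⨆ l, sphHarm n l =
        ⨆ l, ((harmonicPoly n l).map (polyRestrict n)).map (toL2 n).toLinearMap := by
      simp only [sphHarm, Submodule.map_comp]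
    rw [h4]
    exact h3
  intro f _
  have hd : DenseRange (toL2 n) :=
    ContinuousMap.toLp_denseRange ℝ (surf n) ℝ (by simp)
  have := hd f
  refine closure_minimal ?_ (Submodule.isClosed_topologicalClosure _) this
  rintro _ ⟨g, rfl⟩
  exact h1 g

lemma isHilbertSum_sphHarm (hn : 2 ≤ n) :
    IsHilbertSum ℝ (fun l => sphHarm n l) fun l => (sphHarm n l).subtypeₗᵢ := by
  refine IsHilbertSum.mkInternal _ (fun l m hlm f g => ?_) (top_le_closure_iSup_sphHarm hn)
  exact inner_sphHarm_of_ne hn hlm f.2 g.2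

lemma proj_mem (l : ℕ) (f : L2 n) : proj n l f ∈ sphHarm n l :=
  Submodule.starProjection_apply_mem _ _

lemma proj_eq_self {l : ℕ} {f : L2 n} (hf : f ∈ sphHarm n l) : proj n l f = f :=
  Submodule.starProjection_eq_self_iff.2 hf

lemma inner_proj_left (l : ℕ) (f g : L2 n) : ⟪proj n l f, g⟫ = ⟪f, proj n l g⟫ :=
  Submodule.inner_starProjection_left_eq_right _ _ _

lemma proj_proj (l : ℕ) (f : L2 n) : proj n l (proj n l f) = proj n l f :=
  proj_eq_self (proj_mem l f)

lemma inner_proj_proj (l : ℕ) (f g : L2 n) : ⟪proj n l f, proj n l g⟫ = ⟪proj n l f, g⟫ := by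
  rw [← inner_proj_left, proj_proj]

lemma proj_eq_zero (hn : 2 ≤ n) {l m : ℕ} (hlm : l ≠ m) {f : L2 n} (hf : f ∈ sphHarm n m) :
    proj n l f = 0 := by
  rw [← inner_self_eq_zero (𝕜 := ℝ), inner_proj_proj]
  exact inner_sphHarm_of_ne hn hlm (proj_mem l f) hf

lemma hasSum_proj (hn : 2 ≤ n) (f : L2 n) : HasSum (fun l => proj n l f) f := by
  have H := isHilbertSum_sphHarm hn
  set w := H.linearIsometryEquiv f with hw
  have h1 := H.hasSum_linearIsometryEquiv_symm w
  rw [hw, LinearIsometryEquiv.symm_apply_apply] at h1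
  have h2 : ∀ l, proj n l f = w l := by
    intro l
    have h3 := h1.mapL (proj n l)
    have h4 : HasSum (fun m => proj n l ((sphHarm n m).subtypeₗᵢ (w m))) (w l : L2 n) := by
      have h5 := hasSum_single (f := fun m => proj n l ((sphHarm n m).subtypeₗᵢ (w m))) l
        fun m hm => proj_eq_zero hn hm.symm (w m).2
      rwa [show proj n l ((sphHarm n l).subtypeₗᵢ (w l)) = (w l : L2 n) from proj_eq_self (w l).2] at h5
    exact h3.unique h4
  exact h1.congr_fun h2

lemma hasSum_inner_proj (hn : 2 ≤ n) (f g : L2 n) :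
    HasSum (fun l => ⟪proj n l f, proj n l g⟫) ⟪f, g⟫ := by
  have h := (hasSum_proj hn f).mapL (innerSL ℝ g)
  simp only [innerSL_apply_apply] at h
  rw [real_inner_comm]
  refine h.congr_fun fun l => ?_
  rw [inner_proj_proj, real_inner_comm]

lemma hasSum_norm_proj_sq (hn : 2 ≤ n) (f : L2 n) :
    HasSum (fun l => ‖proj n l f‖ ^ 2) (‖f‖ ^ 2) := by
  simpa only [real_inner_self_eq_norm_sq] using hasSum_inner_proj hn f f

lemma proj_toL2_riesz (hn : 2 ≤ n) (e : ℝ) (he : 0 < e) {c : ℝ}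
    (hc : ∀ x : Sph n, riesz e he 1 x = c) (l : ℕ) (f : C(Sph n, ℝ)) :
    proj n l (toL2 n (riesz e he f)) = rieszEig n e c l • proj n l (toL2 n f) := by
  refine ext_inner_right ℝ fun g => ?_
  rw [inner_smul_left, inner_proj_left, inner_proj_left]
  obtain ⟨p, hp, hpg⟩ := mem_sphHarm.1 (proj_mem l g)
  rw [← hpg, inner_toL2, inner_toL2, integral_riesz_mul, riesz_polyRestrict hn e he hc l p hp,
    ← integral_const_mul]
  refine integral_congr_ae (.of_forall fun x => ?_)
  simp only [ContinuousMap.smul_apply, smul_eq_mul, conj_trivial]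
  ring

/-- The quadratic form of the Riesz kernel operator in terms of spherical harmonics. -/
lemma hasSum_rieszEig (hn : 2 ≤ n) (e : ℝ) (he : 0 < e) {c : ℝ}
    (hc : ∀ x : Sph n, riesz e he 1 x = c) (f : C(Sph n, ℝ)) :
    HasSum (fun l => rieszEig n e c l * ‖proj n l (toL2 n f)‖ ^ 2)
      (∫ x, f x * riesz e he f x ∂(surf n)) := by
  rw [← inner_toL2]
  refine (hasSum_inner_proj hn _ _).congr_fun fun l => ?_
  rw [proj_toL2_riesz hn e he hc, inner_smul_right, real_inner_self_eq_norm_sq]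

end Decomposition

/-! ### The symbol of the intertwining operator -/

section Alpha

variable {n : ℕ} {s : ℝ}

lemma alpha_eq (l : ℕ) : alpha n s l =
    Real.Gamma (l + n + (s - n / 2)) / Real.Gamma (l - (s - n / 2)) := by
  rw [alpha]
  congr 2 <;> ring

lemma natCast_sub_ne_zero {e : ℝ} (he : e ∈ Set.Ioo (0 : ℝ) 1) (l : ℕ) : (l : ℝ) - e ≠ 0 := by
  rcases l with _ | l
  · simp [he.1.ne']
  · have : (0 : ℝ) ≤ l := l.cast_nonneg
    have := he.2
    push_cast
    intro h
    linarith

lemma Gamma_natCast_sub_ne_zero {e : ℝ} (he : e ∈ Set.Ioo (0 : ℝ) 1) (l : ℕ) :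
    Real.Gamma (l - e) ≠ 0 := by
  have h : 0 < Real.Gamma ((l : ℝ) - e + 1) :=
    Real.Gamma_pos_of_pos (by have := he.2; have : (0 : ℝ) ≤ l := l.cast_nonneg; linarith)
  rw [Real.Gamma_add_one (natCast_sub_ne_zero he l)] at h
  exact right_ne_zero_of_mul h.ne'

lemma alpha_succ (hs : s - (n : ℝ) / 2 ∈ Set.Ioo (0 : ℝ) 1) (l : ℕ) :
    alpha n s (l + 1) * (l - (s - n / 2)) = alpha n s l * (l + n + (s - n / 2)) := by
  have h1 := natCast_sub_ne_zero hs l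
  have h2 := Gamma_natCast_sub_ne_zero hs l
  have h0 := hs.1
  have h3 : (l : ℝ) + n + (s - n / 2) ≠ 0 := by positivity
  have e1 : ((l + 1 : ℕ) : ℝ) + n + (s - n / 2) = (l + n + (s - n / 2)) + 1 := by push_cast; ring
  have e2 : ((l + 1 : ℕ) : ℝ) - (s - n / 2) = (l - (s - n / 2)) + 1 := by push_cast; ring
  rw [alpha_eq, alpha_eq, e1, e2, Real.Gamma_add_one h1, Real.Gamma_add_one h3]
  generalize s - (n : ℝ) / 2 = e at *
  field_simp

lemma alpha_succ_pos (hs : s - (n : ℝ) / 2 ∈ Set.Ioo (0 : ℝ) 1) (l : ℕ) : 0 < alpha n s (l + 1) := by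
  have h0 := hs.1
  rw [alpha_eq]
  refine div_pos (Real.Gamma_pos_of_pos (by positivity)) (Real.Gamma_pos_of_pos ?_)
  have := hs.2
  have : (0 : ℝ) ≤ l := l.cast_nonneg
  push_cast
  linarith

lemma alpha_pos (hs : s - (n : ℝ) / 2 ∈ Set.Ioo (0 : ℝ) 1) {l : ℕ} (hl : l ≠ 0) :
    0 < alpha n s l := by
  obtain ⟨m, rfl⟩ := Nat.exists_eq_succ_of_ne_zero hl
  exact alpha_succ_pos hs m

/-- The recursion at l = 0 reads -σ α(1) = (n + σ) α(0) with α(1) > 0. This one negative eigenvalue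
makes the inequality a reverse one. -/
lemma alpha_zero_neg (hn : 2 ≤ n) (hs : s - (n : ℝ) / 2 ∈ Set.Ioo (0 : ℝ) 1) : alpha n s 0 < 0 := by
  have h := alpha_succ hs 0
  have h1 := alpha_succ_pos hs 0
  have h0 := hs.1
  simp only [Nat.cast_zero, zero_sub, zero_add] at h h1
  by_contra! h2
  have : 0 ≤ alpha n s 0 * (n + (s - n / 2)) := by positivity
  nlinarith

lemma alpha_lt_succ (hn : 2 ≤ n) (hs : s - (n : ℝ) / 2 ∈ Set.Ioo (0 : ℝ) 1) (l : ℕ) :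
    alpha n s (l + 1) < alpha n s (l + 2) := by
  have h := alpha_succ hs (l + 1)
  have h1 := alpha_succ_pos hs l
  have h2 := alpha_succ_pos hs (l + 1)
  obtain ⟨h3, h4⟩ := hs
  push_cast at h
  have hl : (0 : ℝ) ≤ l := l.cast_nonneg
  have hn' : (2 : ℝ) ≤ n := by exact_mod_cast hn
  by_contra! h5
  have : alpha n s (l + 1) * (l + 1 + n + (s - n / 2)) ≤
      alpha n s (l + 1) * (l + 1 - (s - n / 2)) := by
    rw [← h]
    exact mul_le_mul_of_nonneg_right h5 (by linarith)
  have := le_of_mul_le_mul_left this h1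
  linarith

lemma alpha_two_le (hn : 2 ≤ n) (hs : s - (n : ℝ) / 2 ∈ Set.Ioo (0 : ℝ) 1) (l : ℕ) :
    alpha n s 2 ≤ alpha n s (l + 2) :=
  (strictMono_nat_of_lt_succ (f := fun l => alpha n s (l + 2))
    fun l => alpha_lt_succ hn hs (l + 1)).monotone (Nat.zero_le l)

/-- The two recursions are reciprocal, so up to the negative factor α(0)c the Riesz operator inverts
the operator of the form. This is how the conformal covariance of the kernel passes to a_{2s}. -/
lemma alpha_mul_rieszEig (hs : s - (n : ℝ) / 2 ∈ Set.Ioo (0 : ℝ) 1) (c : ℝ) (l : ℕ) :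
    alpha n s l * rieszEig n (s - n / 2) c l = alpha n s 0 * c := by
  induction l with
  | zero => rfl
  | succ l ih =>
    have h0 := hs.1
    have h3 : (l : ℝ) + n + (s - n / 2) ≠ 0 := by positivity
    rw [rieszEig, ← ih, mul_div_assoc', mul_left_comm, alpha_succ hs]
    generalize s - (n : ℝ) / 2 = e at *
    field_simp

lemma Gamma_add_natCast_succ {a : ℝ} (ha : 0 < a) (l : ℕ) :
    Real.Gamma (a + l + 1) = (∏ j ∈ Finset.range (l + 1), (a + j)) * Real.Gamma a := by
  induction l with
  | zero => simp [Real.Gamma_add_one ha.ne']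
  | succ l ih =>
    rw [Finset.prod_range_succ, Nat.cast_add, Nat.cast_one,
      Real.Gamma_add_one (by positivity : a + ((l : ℝ) + 1) ≠ 0), ← add_assoc, ih]
    ring

lemma hsWeight_pos (hn : 2 ≤ n) (l : ℕ) : 0 < hsWeight n s l := by
  have hn' : (2 : ℝ) ≤ n := by exact_mod_cast hn
  have hl : (0 : ℝ) ≤ l := l.cast_nonneg
  refine Real.rpow_pos_of_pos ?_ _
  nlinarith

/-- Written with Euler's sequences for Γ, the Gamma quotient shows its growth l^{2s}: every other
factor tends to 1. -/
lemma alpha_succ_eq_GammaSeq (hs : s - (n : ℝ) / 2 ∈ Set.Ioo (0 : ℝ) 1) {l : ℕ} (hl : l ≠ 0) :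
    alpha n s (l + 1) =
      (Real.Gamma (n + (s - n / 2)) / Real.GammaSeq (n + (s - n / 2)) l) *
      (Real.GammaSeq (1 - (s - n / 2)) l / Real.Gamma (1 - (s - n / 2))) *
      (((l : ℝ) + 1 - (s - n / 2)) / l) * ((l : ℝ) ^ 2) ^ s := by
  set e := s - (n : ℝ) / 2 with he
  obtain ⟨he0, he1⟩ := hs
  have hl0 : (0 : ℝ) < l := by positivity
  have ha : 0 < (n : ℝ) + e := by positivity
  have hb : 0 < 1 - e := by linarith
  have h1 := Gamma_add_natCast_succ ha l
  have h2 := Gamma_add_natCast_succ hb l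
  have hP : ∀ a : ℝ, 0 < a → 0 < ∏ j ∈ Finset.range (l + 1), (a + (j : ℝ)) := fun a ha =>
    Finset.prod_pos fun j _ => by positivity
  have h3 : Real.Gamma (1 - e + l + 1) = (l + 1 - e) * Real.Gamma (l + 1 - e) := by
    rw [show 1 - e + l + 1 = (l + 1 - e) + 1 by ring, Real.Gamma_add_one]
    linarith
  have h4 : ((l : ℝ) ^ 2) ^ s = (l : ℝ) ^ ((n : ℝ) + e) / (l : ℝ) ^ (1 - e) * l := by
    have : (2 : ℝ) * s = (n + e) - (1 - e) + 1 := by rw [he]; ring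
    rw [← Real.rpow_natCast, ← Real.rpow_mul hl0.le, Nat.cast_ofNat, this, Real.rpow_add_one hl0.ne',
      Real.rpow_sub hl0]
  have hle : 0 < (l : ℝ) + 1 - e := by linarith
  have hG : 0 < Real.Gamma ((l : ℝ) + 1 - e) := Real.Gamma_pos_of_pos hle
  have h5 : alpha n s (l + 1) = Real.Gamma (n + e + l + 1) / Real.Gamma (l + 1 - e) := by
    rw [alpha_eq, ← he]
    congr 2 <;> push_cast <;> ring
  have h6 : Real.Gamma ((l : ℝ) + 1 - e) =
      (∏ j ∈ Finset.range (l + 1), (1 - e + (j : ℝ))) * Real.Gamma (1 - e) / (l + 1 - e) := by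
    rw [← h2, h3]
    field_simp
  rw [h5, h1, h6, h4, Real.GammaSeq, Real.GammaSeq]
  have q1 := hP _ ha
  have q2 := hP _ hb
  have q3 := Real.Gamma_pos_of_pos hb
  have q4 : (0 : ℝ) < l.factorial := by positivity
  have q5 := Real.rpow_pos_of_pos hl0 (n + e)
  have q6 := Real.rpow_pos_of_pos hl0 (1 - e)
  field_simp

lemma tendsto_alpha_div_hsWeight (hn : 2 ≤ n) (hs : s - (n : ℝ) / 2 ∈ Set.Ioo (0 : ℝ) 1) :
    Tendsto (fun l : ℕ => alpha n s (l + 1) / hsWeight n s (l + 1)) atTop (𝓝 1) := by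
  have hs0 := hs.1
  have hs1 := hs.2
  set e := s - (n : ℝ) / 2 with he
  have ha : 0 < (n : ℝ) + e := by positivity
  have hb : 0 < 1 - e := by linarith
  have t1 : Tendsto (fun l => Real.Gamma (n + e) / Real.GammaSeq (n + e) l) atTop (𝓝 1) := by
    have h := Real.Gamma_pos_of_pos ha
    have := (tendsto_const_nhds (x := Real.Gamma (n + e))).div (Real.GammaSeq_tendsto_Gamma _) h.ne'
    rwa [div_self h.ne'] at this
  have t2 : Tendsto (fun l => Real.GammaSeq (1 - e) l / Real.Gamma (1 - e)) atTop (𝓝 1) := by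
    have h := Real.Gamma_pos_of_pos hb
    have := (Real.GammaSeq_tendsto_Gamma (1 - e)).div_const (Real.Gamma (1 - e))
    rwa [div_self h.ne'] at this
  have ti : Tendsto (fun l : ℕ => (l : ℝ)⁻¹) atTop (𝓝 0) :=
    tendsto_inv_atTop_zero.comp tendsto_natCast_atTop_atTop
  have t3 : Tendsto (fun l : ℕ => ((l : ℝ) + 1 - e) / l) atTop (𝓝 1) := by
    have : Tendsto (fun l : ℕ => 1 + (1 - e) * (l : ℝ)⁻¹) atTop (𝓝 (1 + (1 - e) * 0)) :=
      tendsto_const_nhds.add (tendsto_const_nhds.mul ti)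
    rw [mul_zero, add_zero] at this
    refine this.congr' ?_
    filter_upwards [eventually_ne_atTop 0] with l hl
    have : (l : ℝ) ≠ 0 := by exact_mod_cast hl
    field_simp
    ring
  have t4 : Tendsto (fun l : ℕ => ((l : ℝ) ^ 2 / (1 + ((l : ℝ) + 1) * (l + n))) ^ s) atTop (𝓝 1) := by
    have : Tendsto (fun l : ℕ => ((l : ℝ)⁻¹ ^ 2 + (1 + (l : ℝ)⁻¹) * (1 + n * (l : ℝ)⁻¹))⁻¹) atTop
        (𝓝 (((0 : ℝ) ^ 2 + (1 + 0) * (1 + n * 0))⁻¹)) := by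
      refine Tendsto.inv₀ ((ti.pow 2).add ((ti.const_add 1).mul ((ti.const_mul _).const_add 1))) ?_
      norm_num
    have h2 := (this.rpow_const (p := s) (Or.inl (by norm_num)))
    norm_num at h2
    refine h2.congr' ?_
    filter_upwards [eventually_ne_atTop 0] with l hl
    have : (l : ℝ) ≠ 0 := by exact_mod_cast hl
    congr 1
    field_simp
  have := ((t1.mul t2).mul t3).mul t4
  simp only [mul_one] at this
  refine this.congr' ?_
  filter_upwards [eventually_ne_atTop 0] with l hl
  have hl0 : (0 : ℝ) < l := by positivity
  have hw : hsWeight n s (l + 1) = (1 + ((l : ℝ) + 1) * (l + n)) ^ s := by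
    rw [hsWeight]
    congr 1
    push_cast
    ring
  rw [alpha_succ_eq_GammaSeq hs hl, ← he, hw, Real.div_rpow (by positivity) (by positivity),
    mul_div_assoc]

lemma exists_bounds_of_tendsto_one {r : ℕ → ℝ} (hr : ∀ l, 0 < r l) (h : Tendsto r atTop (𝓝 1)) :
    ∃ C : ℝ, 0 < C ∧ ∀ l, r l ≤ C := by
  obtain ⟨C, hC⟩ := h.bddAbove_range
  exact ⟨C, (hr 0).trans_le (hC ⟨0, rfl⟩), fun l => hC ⟨l, rfl⟩⟩

lemma exists_alpha_le (hn : 2 ≤ n) (hs : s - (n : ℝ) / 2 ∈ Set.Ioo (0 : ℝ) 1) :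
    ∃ C : ℝ, 0 < C ∧ ∀ l : ℕ, |alpha n s l| ≤ C * hsWeight n s l := by
  obtain ⟨C, hC0, hC⟩ := exists_bounds_of_tendsto_one
    (fun l => div_pos (alpha_succ_pos hs l) (hsWeight_pos hn (l + 1)))
    (tendsto_alpha_div_hsWeight hn hs)
  refine ⟨max C (|alpha n s 0| / hsWeight n s 0), lt_max_of_lt_left hC0, fun l => ?_⟩
  rw [← div_le_iff₀ (hsWeight_pos hn l)]
  rcases l with _ | l
  · exact le_max_right _ _
  · rw [abs_of_pos (alpha_succ_pos hs l)]
    exact (hC l).trans (le_max_left _ _)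

lemma exists_hsWeight_le (hn : 2 ≤ n) (hs : s - (n : ℝ) / 2 ∈ Set.Ioo (0 : ℝ) 1) :
    ∃ C : ℝ, 0 < C ∧ ∀ l : ℕ, hsWeight n s l ≤ C * |alpha n s l| := by
  obtain ⟨C, hC0, hC⟩ := exists_bounds_of_tendsto_one
    (r := fun l => (alpha n s (l + 1) / hsWeight n s (l + 1))⁻¹)
    (fun l => inv_pos.2 (div_pos (alpha_succ_pos hs l) (hsWeight_pos hn (l + 1))))
    (by simpa using (tendsto_alpha_div_hsWeight hn hs).inv₀ one_ne_zero)
  refine ⟨max C (hsWeight n s 0 / |alpha n s 0|), lt_max_of_lt_left hC0, fun l => ?_⟩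
  rcases l with _ | l
  · rw [← div_le_iff₀ (abs_pos.2 (alpha_zero_neg hn hs).ne)]
    exact le_max_right _ _
  · rw [← div_le_iff₀ (abs_pos.2 (alpha_succ_pos hs l).ne'), abs_of_pos (alpha_succ_pos hs l)]
    have := hC l
    rw [inv_div] at this
    exact this.trans (le_max_left _ _)

end Alpha

/-! ### The quadratic form on `H^s` -/

section Form

variable {n : ℕ} {s : ℝ}

lemma summable_of_memHs (hn : 2 ≤ n) (hs : s - (n : ℝ) / 2 ∈ Set.Ioo (0 : ℝ) 1) {f : L2 n}
    (hf : MemHs n s f) : Summable fun l => |alpha n s l| * ‖proj n l f‖ ^ 2 := by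
  obtain ⟨C, hC, h⟩ := exists_alpha_le hn hs
  refine Summable.of_nonneg_of_le (fun l => by positivity) (fun l => ?_) (hf.mul_left C)
  rw [← mul_assoc]
  exact mul_le_mul_of_nonneg_right (h l) (by positivity)

lemma memHs_of_summable (hn : 2 ≤ n) (hs : s - (n : ℝ) / 2 ∈ Set.Ioo (0 : ℝ) 1) {f : L2 n}
    (hf : Summable fun l => alpha n s l * ‖proj n l f‖ ^ 2) : MemHs n s f := by
  obtain ⟨C, hC, h⟩ := exists_hsWeight_le hn hs
  refine Summable.of_nonneg_of_le (fun l => mul_nonneg (hsWeight_pos hn l).le (by positivity))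
    (fun l => ?_) (hf.abs.mul_left C)
  rw [abs_mul, abs_of_nonneg (by positivity : 0 ≤ ‖proj n l f‖ ^ 2), ← mul_assoc]
  exact mul_le_mul_of_nonneg_right (h l) (by positivity)

lemma abs_inner_le_half (f g : L2 n) : |⟪f, g⟫| ≤ (‖f‖ ^ 2 + ‖g‖ ^ 2) / 2 := by
  have := abs_real_inner_le_norm f g
  nlinarith [sq_nonneg (‖f‖ - ‖g‖)]

lemma summable_form (hn : 2 ≤ n) (hs : s - (n : ℝ) / 2 ∈ Set.Ioo (0 : ℝ) 1) {f g : L2 n}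
    (hf : MemHs n s f) (hg : MemHs n s g) :
    Summable fun l => alpha n s l * ⟪proj n l f, proj n l g⟫ := by
  refine Summable.of_norm_bounded (((summable_of_memHs hn hs hf).add
    (summable_of_memHs hn hs hg)).div_const 2) fun l => ?_
  rw [Real.norm_eq_abs, abs_mul, ← mul_add, mul_div_assoc]
  exact mul_le_mul_of_nonneg_left (abs_inner_le_half _ _) (abs_nonneg _)

lemma summable_hsInner (hn : 2 ≤ n) {f g : L2 n} (hf : MemHs n s f) (hg : MemHs n s g) :
    Summable fun l => hsWeight n s l * ⟪proj n l f, proj n l g⟫ := by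
  refine Summable.of_norm_bounded ((Summable.add hf hg).div_const 2) fun l => ?_
  rw [Real.norm_eq_abs, abs_mul, ← mul_add, mul_div_assoc, abs_of_pos (hsWeight_pos hn l)]
  exact mul_le_mul_of_nonneg_left (abs_inner_le_half _ _) (hsWeight_pos hn l).le

lemma MemHs.add (hn : 2 ≤ n) {f g : L2 n} (hf : MemHs n s f) (hg : MemHs n s g) :
    MemHs n s (f + g) := by
  refine Summable.of_nonneg_of_le (fun l => mul_nonneg (hsWeight_pos hn l).le (by positivity))
    (fun l => ?_) ((Summable.add hf hg).mul_left 2)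
  rw [map_add, ← mul_add, mul_left_comm]
  refine mul_le_mul_of_nonneg_left ?_ (hsWeight_pos hn l).le
  have := norm_add_le (proj n l f) (proj n l g)
  nlinarith [norm_nonneg (proj n l f + proj n l g), sq_nonneg (‖proj n l f‖ - ‖proj n l g‖)]

lemma MemHs.smul {f : L2 n} (hf : MemHs n s f) (c : ℝ) : MemHs n s (c • f) := by
  refine (Summable.mul_left (c ^ 2) hf).congr fun l => ?_
  rw [map_smul, norm_smul, mul_pow, Real.norm_eq_abs, sq_abs]
  ring

lemma MemHs.sub (hn : 2 ≤ n) {f g : L2 n} (hf : MemHs n s f) (hg : MemHs n s g) :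
    MemHs n s (f - g) := by
  rw [sub_eq_add_neg, ← neg_one_smul ℝ g]
  exact hf.add hn (hg.smul _)

lemma memHs_of_mem_sphHarm (hn : 2 ≤ n) {l : ℕ} {f : L2 n} (hf : f ∈ sphHarm n l) :
    MemHs n s f := by
  refine summable_of_ne_finset_zero (s := {l}) fun m hm => ?_
  rw [proj_eq_zero hn (by simpa using hm) hf]
  simp

lemma form_add_left (hn : 2 ≤ n) (hs : s - (n : ℝ) / 2 ∈ Set.Ioo (0 : ℝ) 1) {f g h : L2 n}
    (hf : MemHs n s f) (hg : MemHs n s g) (hh : MemHs n s h) :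
    form n s (f + g) h = form n s f h + form n s g h := by
  rw [form, form, form, ← (summable_form hn hs hf hh).tsum_add (summable_form hn hs hg hh)]
  refine tsum_congr fun l => ?_
  rw [map_add, inner_add_left, mul_add]

lemma form_smul_left (c : ℝ) (f g : L2 n) : form n s (c • f) g = c * form n s f g := by
  rw [form, form, ← tsum_mul_left]
  refine tsum_congr fun l => ?_
  rw [map_smul, real_inner_smul_left]
  ring

lemma form_comm (f g : L2 n) : form n s f g = form n s g f :=
  tsum_congr fun l => by rw [real_inner_comm]

lemma form_smul_right (c : ℝ) (f g : L2 n) : form n s f (c • g) = c * form n s f g := by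
  rw [form_comm, form_smul_left, form_comm]

lemma form_add_right (hn : 2 ≤ n) (hs : s - (n : ℝ) / 2 ∈ Set.Ioo (0 : ℝ) 1) {f g h : L2 n}
    (hf : MemHs n s f) (hg : MemHs n s g) (hh : MemHs n s h) :
    form n s f (g + h) = form n s f g + form n s f h := by
  rw [form_comm, form_add_left hn hs hg hh hf, form_comm g, form_comm h]

lemma form_sphHarm_right (hn : 2 ≤ n) {l : ℕ} (f : L2 n) {g : L2 n} (hg : g ∈ sphHarm n l) :
    form n s f g = alpha n s l * ⟪f, g⟫ := by
  rw [form, tsum_eq_single l fun m hm => by rw [proj_eq_zero hn hm hg]; simp, inner_proj_left,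
    proj_eq_self hg, proj_eq_self hg]

lemma form_self (f : L2 n) : form n s f f = ∑' l, alpha n s l * ‖proj n l f‖ ^ 2 :=
  tsum_congr fun l => by rw [real_inner_self_eq_norm_sq]

lemma hasSum_form (hn : 2 ≤ n) (hs : s - (n : ℝ) / 2 ∈ Set.Ioo (0 : ℝ) 1) {f : L2 n}
    (hf : MemHs n s f) : HasSum (fun l => alpha n s l * ‖proj n l f‖ ^ 2) (form n s f f) := by
  rw [form_self]
  refine Summable.hasSum ?_
  simpa only [real_inner_self_eq_norm_sq] using summable_form hn hs hf hf

end Form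

/-! ### Conformal invariance of the quadratic form -/

section Invariance

variable {n : ℕ} {s : ℝ}

lemma abs_le_norm (f : C(Sph n, ℝ)) (x : Sph n) : |f x| ≤ ‖f‖ := f.norm_coe_le_norm x

/-- Duality moves the twist of g² onto the constant 1, whose twist is bounded. The L²-continuity
serves to pass to limits in the invariance proof. -/
lemma exists_norm_twist_le (e : ℝ) (w : Amb n) :
    ∃ C : ℝ, 0 ≤ C ∧ ∀ g : C(Sph n, ℝ), ‖toL2 n (twist e w g)‖ ^ 2 ≤ C * ‖toL2 n g‖ ^ 2 := by
  set k : C(Sph n, ℝ) := twist (-n - 2 * e) (-w) 1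
  refine ⟨‖k‖, norm_nonneg _, fun g => ?_⟩
  have h := integral_twist_mul (e := 2 * e) (e' := -n - 2 * e) (by ring) w (g * g) 1
  rw [norm_toL2_sq, norm_toL2_sq, ← integral_const_mul]
  have h1 : ∀ x, twist e w g x ^ 2 = twist (2 * e) w (g * g) x * (1 : C(Sph n, ℝ)) x := fun x => by
    have := stretch_coe_pos w x
    simp only [twist_apply, ContinuousMap.mul_apply, ContinuousMap.one_apply]
    rw [mul_comm 2 e, Real.rpow_mul this.le, Real.rpow_ofNat]
    ring
  simp only [h1]
  rw [h]
  refine integral_mono (integrable_surf (g * g * k)) ((integrable_surf (g ^ 2)).const_mul ‖k‖)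
    fun x => ?_
  have := (le_abs_self _).trans (abs_le_norm k x)
  simp only [ContinuousMap.mul_apply, sq]
  rw [mul_comm]
  exact mul_le_mul_of_nonneg_right this (mul_self_nonneg _)

/-- On the range of the Riesz operator R the invariance is explicit: a twist of Rf is R of a dual
twist of f, the form at Rg is α(0)c ∫ g Rg, and dual weights preserve this integral. The value does
not depend on w. -/
lemma hasSum_alpha_twist_riesz (hn : 2 ≤ n) (hs : s - (n : ℝ) / 2 ∈ Set.Ioo (0 : ℝ) 1) {c : ℝ}
    (hc : ∀ x : Sph n, riesz (s - n / 2) hs.1 1 x = c) (f : C(Sph n, ℝ)) (w : Amb n) :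
    HasSum (fun l => alpha n s l *
        ‖proj n l (toL2 n (twist (s - n / 2) w (riesz (s - n / 2) hs.1 f)))‖ ^ 2)
      (alpha n s 0 * c * ∫ x, f x * riesz (s - n / 2) hs.1 f x ∂(surf n)) := by
  have h := (hasSum_rieszEig hn _ hs.1 hc (twist (-(n + (s - n / 2))) w f)).mul_left (alpha n s 0 * c)
  have h2 : ∫ x, twist (-(n + (s - n / 2))) w f x *
      riesz (s - n / 2) hs.1 (twist (-(n + (s - n / 2))) w f) x ∂(surf n) =
      ∫ x, f x * riesz (s - n / 2) hs.1 f x ∂(surf n) := by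
    rw [riesz_twist]
    exact integral_twist_mul_twist (by ring) w _ _
  rw [h2] at h
  refine h.congr_fun fun l => ?_
  rw [← riesz_twist, proj_toL2_riesz hn _ hs.1 hc, norm_smul, ← alpha_mul_rieszEig hs c l, mul_pow,
    Real.norm_eq_abs, sq_abs]
  ring

/-- Every `L²` function has harmonic components given by continuous functions in the range of the
Riesz kernel operator. -/
lemma exists_riesz_eq_proj (hn : 2 ≤ n) (hs : s - (n : ℝ) / 2 ∈ Set.Ioo (0 : ℝ) 1) {c : ℝ} (hc0 : 0 < c)
    (hc : ∀ x : Sph n, riesz (s - n / 2) hs.1 1 x = c) (u : L2 n) (N : ℕ) :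
    ∃ f : C(Sph n, ℝ), toL2 n (riesz (s - n / 2) hs.1 f) = ∑ l ∈ Finset.range N, proj n l u := by
  choose p hp hpu using fun l => mem_sphHarm.1 (proj_mem l u)
  refine ⟨∑ l ∈ Finset.range N, (rieszEig n (s - n / 2) c l)⁻¹ • polyRestrict n (p l), ?_⟩
  rw [map_sum, map_sum]
  refine Finset.sum_congr rfl fun l _ => ?_
  rw [map_smul, riesz_polyRestrict hn _ hs.1 hc l _ (hp l), smul_smul,
    inv_mul_cancel₀ (rieszEig_ne_zero hn hs hc0 l), one_smul, hpu]

/-- Truncations of u lie in the range of the Riesz operator, where the invariance is known, and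
converge in L². For M ≥ 1 the omitted degrees have positive symbol, so a partial sum is at most the
whole form; finitely many degrees pass to the limit. -/
lemma sum_alpha_twist_le (hn : 2 ≤ n) (hs : s - (n : ℝ) / 2 ∈ Set.Ioo (0 : ℝ) 1) {u : C(Sph n, ℝ)}
    (hu : MemHs n s (toL2 n u)) (w : Amb n) {M : ℕ} (hM : 1 ≤ M) :
    ∑ l ∈ Finset.range M, alpha n s l * ‖proj n l (toL2 n (twist (s - n / 2) w u))‖ ^ 2 ≤
      form n s (toL2 n u) (toL2 n u) := by
  obtain ⟨c, hc0, hc⟩ := exists_riesz_one_pos (n := n) (s - n / 2) hs.1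
  choose f hf using exists_riesz_eq_proj hn hs hc0 hc (toL2 n u)
  set g : ℕ → C(Sph n, ℝ) := fun N => riesz (s - n / 2) hs.1 (f N) with hg
  have hgu : Tendsto (fun N => toL2 n (g N)) atTop (𝓝 (toL2 n u)) := by
    simp only [hg, hf]
    exact (hasSum_proj hn (toL2 n u)).tendsto_sum_nat
  have hTg : Tendsto (fun N => toL2 n (twist (s - n / 2) w (g N))) atTop
      (𝓝 (toL2 n (twist (s - n / 2) w u))) := by
    obtain ⟨C, hC0, hC⟩ := exists_norm_twist_le (s - n / 2) w
    rw [tendsto_iff_norm_sub_tendsto_zero] at hgu ⊢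
    have h1 : Tendsto (fun N => √(C * ‖toL2 n (g N) - toL2 n u‖ ^ 2)) atTop (𝓝 0) := by
      have := ((hgu.pow 2).const_mul C).sqrt
      simpa using this
    refine squeeze_zero (fun _ => norm_nonneg _) (fun N => ?_) h1
    refine Real.le_sqrt_of_sq_le ?_
    rw [← map_sub, ← map_sub, ← map_sub]
    exact hC _
  have hlim : Tendsto (fun N => ∑ l ∈ Finset.range M, alpha n s l *
      ‖proj n l (toL2 n (twist (s - n / 2) w (g N)))‖ ^ 2) atTop
      (𝓝 (∑ l ∈ Finset.range M, alpha n s l *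
        ‖proj n l (toL2 n (twist (s - n / 2) w u))‖ ^ 2)) := by
    refine tendsto_finsetSum _ fun l _ => ?_
    exact ((((proj n l).continuous.tendsto _).comp hTg).norm.pow 2).const_mul _
  have hform := (hasSum_form hn hs hu).tendsto_sum_nat
  refine le_of_tendsto_of_tendsto' hlim hform fun N => ?_
  have h1 := hasSum_alpha_twist_riesz hn hs hc (f N) w
  -- The trivial boost identifies the common value with the truncated form of u.
  have h2 := hasSum_alpha_twist_riesz hn hs hc (f N) 0
  have h3 : HasSum (fun l => alpha n s l * ‖proj n l (toL2 n (twist (s - n / 2) 0 (g N)))‖ ^ 2)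
      (∑ l ∈ Finset.range N, alpha n s l * ‖proj n l (toL2 n u)‖ ^ 2) := by
    have h4 : ∀ l, proj n l (toL2 n (twist (s - n / 2) 0 (g N))) =
        if l ∈ Finset.range N then proj n l (toL2 n u) else 0 := by
      intro l
      rw [twist_zero, hf, map_sum,
        ← Finset.sum_ite_eq (Finset.range N) l fun _ => proj n l (toL2 n u)]
      refine Finset.sum_congr rfl fun m _ => ?_
      split_ifs with h
      · rw [h, proj_proj]
      · exact proj_eq_zero hn h (proj_mem m _)
    rw [← (Finset.sum_congr rfl fun l hl => by
      rw [h4 l, if_pos hl] : ∑ l ∈ Finset.range N, alpha n s l *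
        ‖proj n l (toL2 n (twist (s - n / 2) 0 (g N)))‖ ^ 2 = _)]
    exact hasSum_sum_of_ne_finset_zero fun l hl => by simp only [h4, if_neg hl]; simp
  rw [h3.unique h2]
  refine sum_le_hasSum _ (fun l hl => ?_) h1
  have : l ≠ 0 := by
    rintro rfl
    exact hl (Finset.mem_range.2 hM)
  exact mul_nonneg (alpha_pos hs this).le (by positivity)

lemma summable_and_tsum_le {a : ℕ → ℝ} {B : ℝ} (ha : ∀ l, 0 ≤ a (l + 1))
    (h : ∀ M, 1 ≤ M → ∑ l ∈ Finset.range M, a l ≤ B) : Summable a ∧ ∑' l, a l ≤ B := by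
  have h1 : Summable fun l => a (l + 1) := by
    refine summable_of_sum_range_le (c := B - a 0) ha fun N => ?_
    have := h (N + 1) (by omega)
    rw [Finset.sum_range_succ'] at this
    linarith
  have h2 : Summable a := (summable_nat_add_iff 1).1 h1
  refine ⟨h2, le_of_tendsto h2.hasSum.tendsto_sum_nat ?_⟩
  filter_upwards [eventually_ge_atTop 1] with M hM using h M hM

lemma memHs_twist_and_form_le (hn : 2 ≤ n) (hs : s - (n : ℝ) / 2 ∈ Set.Ioo (0 : ℝ) 1)
    {u : C(Sph n, ℝ)} (hu : MemHs n s (toL2 n u)) (w : Amb n) :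
    MemHs n s (toL2 n (twist (s - n / 2) w u)) ∧
      form n s (toL2 n (twist (s - n / 2) w u)) (toL2 n (twist (s - n / 2) w u)) ≤
        form n s (toL2 n u) (toL2 n u) := by
  obtain ⟨h1, h2⟩ := summable_and_tsum_le
    (fun l => mul_nonneg (alpha_succ_pos hs l).le (by positivity))
    (fun M hM => sum_alpha_twist_le hn hs hu w hM)
  exact ⟨memHs_of_summable hn hs h1, by rw [form_self]; exact h2⟩

lemma memHs_twist (hn : 2 ≤ n) (hs : s - (n : ℝ) / 2 ∈ Set.Ioo (0 : ℝ) 1)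
    {u : C(Sph n, ℝ)} (hu : MemHs n s (toL2 n u)) (w : Amb n) :
    MemHs n s (toL2 n (twist (s - n / 2) w u)) := (memHs_twist_and_form_le hn hs hu w).1

/-- The one-sided bound applied to w, and then to -w on the twisted function, gives both
inequalities. -/
lemma form_twist_self (hn : 2 ≤ n) (hs : s - (n : ℝ) / 2 ∈ Set.Ioo (0 : ℝ) 1)
    {u : C(Sph n, ℝ)} (hu : MemHs n s (toL2 n u)) (w : Amb n) :
    form n s (toL2 n (twist (s - n / 2) w u)) (toL2 n (twist (s - n / 2) w u)) =
      form n s (toL2 n u) (toL2 n u) := by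
  refine le_antisymm (memHs_twist_and_form_le hn hs hu w).2 ?_
  have := (memHs_twist_and_form_le hn hs (memHs_twist hn hs hu w) (-w)).2
  rwa [twist_neg_twist] at this

/-- Conformal invariance of the bilinear form. -/
lemma form_twist (hn : 2 ≤ n) (hs : s - (n : ℝ) / 2 ∈ Set.Ioo (0 : ℝ) 1)
    {u v : C(Sph n, ℝ)} (hu : MemHs n s (toL2 n u)) (hv : MemHs n s (toL2 n v)) (w : Amb n) :
    form n s (toL2 n (twist (s - n / 2) w u)) (toL2 n (twist (s - n / 2) w v)) =
      form n s (toL2 n u) (toL2 n v) := by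
  have huv : MemHs n s (toL2 n (u + v)) := by
    rw [map_add]
    exact hu.add hn hv
  have h := form_twist_self hn hs huv w
  have hu' := memHs_twist hn hs hu w
  have hv' := memHs_twist hn hs hv w
  simp only [map_add] at h
  rw [form_add_left hn hs hu hv (hu.add hn hv), form_add_right hn hs hu hu hv,
    form_add_right hn hs hv hu hv, form_add_left hn hs hu' hv' (hu'.add hn hv'),
    form_add_right hn hs hu' hu' hv', form_add_right hn hs hv' hu' hv', form_twist_self hn hs hu,
    form_twist_self hn hs hv, form_comm (toL2 n v) (toL2 n u),
    form_comm (toL2 n (twist _ w v)) (toL2 n (twist _ w u))] at h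
  linarith

end Invariance

/-! ### Hölder continuity and compactness -/

section Compactness

variable {n : ℕ} {s : ℝ}

lemma one_mem_sphHarm_zero : toL2 n 1 ∈ sphHarm n 0 := by
  refine mem_sphHarm.2 ⟨1, mem_harmonicPoly.2 ⟨MvPolynomial.isHomogeneous_one _ _, ?_⟩, ?_⟩
  · simp [polyLaplacian]
  · congr 1
    ext x
    simp [polyRestrict_apply]

lemma norm_toL2_one_sq : ‖toL2 n 1‖ ^ 2 = (surf n).real Set.univ := by
  simp [norm_toL2_sq]

lemma proj_zero_toL2 (f : C(Sph n, ℝ)) :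
    proj n 0 (toL2 n f) = ((∫ x, f x ∂(surf n)) / (surf n).real Set.univ) • toL2 n 1 := by
  have hS := (surf_real_univ_pos (n := n)).ne'
  refine Submodule.eq_starProjection_of_mem_of_inner_eq_zero
    (Submodule.smul_mem _ _ one_mem_sphHarm_zero) fun g hg => ?_
  obtain ⟨p, hp, rfl⟩ := mem_sphHarm.1 hg
  rw [eq_C_of_isHomogeneous_zero (mem_harmonicPoly.1 hp).1, polyRestrict_C, map_smul,
    real_inner_smul_right, inner_sub_left, real_inner_smul_left, inner_toL2, real_inner_self_eq_norm_sq,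
    norm_toL2_one_sq, div_mul_cancel₀ _ hS]
  simp

lemma norm_proj_zero_sq (f : C(Sph n, ℝ)) :
    ‖proj n 0 (toL2 n f)‖ ^ 2 = (∫ x, f x ∂(surf n)) ^ 2 / (surf n).real Set.univ := by
  have hS := (surf_real_univ_pos (n := n)).ne'
  rw [proj_zero_toL2, norm_smul, mul_pow, norm_toL2_one_sq, Real.norm_eq_abs, sq_abs]
  field_simp

lemma two_inner_le (f g : L2 n) {r : ℝ} (hr : 0 < r) :
    2 * ⟪f, g⟫ ≤ r * ‖f‖ ^ 2 + r⁻¹ * ‖g‖ ^ 2 := by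
  have h := real_inner_le_norm f g
  have h2 : 0 ≤ r⁻¹ * (r * ‖f‖ - ‖g‖) ^ 2 := by positivity
  have h3 : r⁻¹ * (r * ‖f‖ - ‖g‖) ^ 2 = r * ‖f‖ ^ 2 + r⁻¹ * ‖g‖ ^ 2 - 2 * (‖f‖ * ‖g‖) := by
    field_simp
    ring
  linarith

/-- Duality between the form and the Riesz kernel operator on functions of mean zero. -/
lemma two_integral_mul_le (hn : 2 ≤ n) (hs : s - (n : ℝ) / 2 ∈ Set.Ioo (0 : ℝ) 1) {c : ℝ} (hc0 : 0 < c)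
    (hc : ∀ x : Sph n, riesz (s - n / 2) hs.1 1 x = c) {u f : C(Sph n, ℝ)}
    (hu : MemHs n s (toL2 n u)) (hf : ∫ x, f x ∂(surf n) = 0) {r : ℝ} (hr : 0 < r) :
    2 * ∫ x, u x * f x ∂(surf n) ≤
      r * (form n s (toL2 n u) (toL2 n u) - alpha n s 0 * ‖proj n 0 (toL2 n u)‖ ^ 2) +
        r⁻¹ * ((alpha n s 0 * c)⁻¹ * ∫ x, f x * riesz (s - n / 2) hs.1 f x ∂(surf n)) := by
  have h1 := (hasSum_inner_proj hn (toL2 n u) (toL2 n f)).mul_left 2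
  rw [inner_toL2] at h1
  have h2 := (((hasSum_form hn hs hu).sub
    (hasSum_ite_eq 0 (alpha n s 0 * ‖proj n 0 (toL2 n u)‖ ^ 2))).mul_left r).add
    (((hasSum_rieszEig hn _ hs.1 hc f).mul_left (alpha n s 0 * c)⁻¹).mul_left r⁻¹)
  refine hasSum_le (fun l => ?_) h1 h2
  rcases l with _ | l
  · simp [proj_zero_toL2 f, hf]
  · have ha := alpha_succ_pos hs l
    have hk := alpha_mul_rieszEig hs c (l + 1)
    have hne := (mul_neg_of_neg_of_pos (alpha_zero_neg hn hs) hc0).ne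
    have hk' : (alpha n s 0 * c)⁻¹ * rieszEig n (s - n / 2) c (l + 1) = (alpha n s (l + 1))⁻¹ := by
      rw [← hk] at hne ⊢
      rw [mul_inv, mul_assoc, inv_mul_cancel₀ (right_ne_zero_of_mul hne), mul_one]
    have h := two_inner_le (proj n (l + 1) (toL2 n u)) (proj n (l + 1) (toL2 n f)) (mul_pos hr ha)
    simp only [Nat.add_eq_zero_iff, one_ne_zero, and_false, if_false, sub_zero]
    rw [← mul_assoc, ← mul_assoc (alpha n s 0 * c)⁻¹, hk', ← mul_assoc, ← mul_inv]
    exact h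

/-- Continuous approximate identities on the sphere. -/
lemma exists_bump (x : Sph n) {δ : ℝ} (hδ : 0 < δ) :
    ∃ ψ : C(Sph n, ℝ), (∀ z, 0 ≤ ψ z) ∧ ∫ z, ψ z ∂(surf n) = 1 ∧ ∀ z, ψ z ≠ 0 → dist z x < δ := by
  set φ : C(Sph n, ℝ) := ⟨fun z => max 0 (δ - dist z x), by fun_prop⟩ with hφ
  have hpos : 0 < ∫ z, φ z ∂(surf n) := by
    refine φ.continuous.integral_pos_of_hasCompactSupport_nonneg_nonzero
      (HasCompactSupport.of_compactSpace _) (fun z => le_max_left _ _) (x := x) ?_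
    simp [hφ, hδ.ne', hδ.le]
  refine ⟨(∫ z, φ z ∂(surf n))⁻¹ • φ, fun z => ?_, ?_, fun z hz => ?_⟩
  · exact mul_nonneg (inv_pos.2 hpos).le (le_max_left _ _)
  · simp only [ContinuousMap.smul_apply, smul_eq_mul, integral_const_mul]
    exact inv_mul_cancel₀ hpos.ne'
  · by_contra! h
    refine hz ?_
    simp [hφ, h]

lemma integral_mul_le_of_bump {ψ g : C(Sph n, ℝ)} (h0 : ∀ z, 0 ≤ ψ z) (h1 : ∫ z, ψ z ∂(surf n) = 1)
    {a : ℝ} (h : ∀ z, ψ z ≠ 0 → g z ≤ a) : ∫ z, ψ z * g z ∂(surf n) ≤ a := by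
  have : ∫ z, ψ z * g z ∂(surf n) ≤ ∫ z, ψ z * a ∂(surf n) := by
    refine integral_mono (integrable_surf (ψ * g)) ((integrable_surf ψ).mul_const a) fun z => ?_
    by_cases hz : ψ z = 0
    · simp [hz]
    · exact mul_le_mul_of_nonneg_left (h z hz) (h0 z)
  rwa [integral_mul_const, h1, one_mul] at this

/-- The duality bound is tested with f = ψ - χ approximating δ_x - δ_y. The self-interactions of ψ
and χ are nonnegative and enter with the sign of α(0)c < 0, so they can be dropped; the cross term
tends to the kernel at (x, y). -/
lemma sub_le_of_form (hn : 2 ≤ n) (hs : s - (n : ℝ) / 2 ∈ Set.Ioo (0 : ℝ) 1) {c : ℝ} (hc0 : 0 < c)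
    (hc : ∀ x : Sph n, riesz (s - n / 2) hs.1 1 x = c) {u : C(Sph n, ℝ)}
    (hu : MemHs n s (toL2 n u)) (x y : Sph n) {r : ℝ} (hr : 0 < r) :
    2 * (u x - u y) ≤
      r * (form n s (toL2 n u) (toL2 n u) - alpha n s 0 * ‖proj n 0 (toL2 n u)‖ ^ 2) +
        r⁻¹ * ((-(alpha n s 0 * c))⁻¹ * (2 * rieszKer (s - n / 2) x y)) := by
  have hD : 0 < -(alpha n s 0 * c) :=
    neg_pos.2 (mul_neg_of_neg_of_pos (alpha_zero_neg hn hs) hc0)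
  set D := -(alpha n s 0 * c) with hDdef
  refine le_of_forall_pos_le_add fun ε hε => ?_
  -- 4ε' pays for replacing the averages of u by u x and u y, the other term for the averaged
  -- kernel.
  obtain ⟨ε', hε', hεε⟩ : ∃ ε' : ℝ, 0 < ε' ∧ 4 * ε' + r⁻¹ * (D⁻¹ * (2 * ε')) ≤ ε := by
    have hpos : 0 < 4 + r⁻¹ * (D⁻¹ * 2) := by positivity
    refine ⟨ε / (4 + r⁻¹ * (D⁻¹ * 2)), by positivity, le_of_eq ?_⟩
    field_simp
  obtain ⟨δ₁, hδ₁, h1⟩ := Metric.continuousAt_iff.1 (u.continuous.continuousAt (x := x)) ε' hε'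
  obtain ⟨δ₂, hδ₂, h2⟩ := Metric.continuousAt_iff.1 (u.continuous.continuousAt (x := y)) ε' hε'
  obtain ⟨δ₃, hδ₃, h3⟩ := Metric.continuousAt_iff.1
    ((continuous_rieszKer (n := n) hs.1).continuousAt (x := (x, y))) ε' hε'
  set δ := min δ₁ (min δ₂ δ₃)
  have hδ : 0 < δ := lt_min hδ₁ (lt_min hδ₂ hδ₃)
  obtain ⟨ψ, p0, p1, p2⟩ := exists_bump x hδ
  obtain ⟨χ, q0, q1, q2⟩ := exists_bump y hδ
  have hf : ∫ z, (ψ - χ) z ∂(surf n) = 0 := by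
    simp only [ContinuousMap.sub_apply]
    rw [integral_sub (integrable_surf ψ) (integrable_surf χ), p1, q1, sub_self]
  have key := two_integral_mul_le hn hs hc0 hc hu hf hr
  have e1 : u x - ε' ≤ ∫ z, u z * ψ z ∂(surf n) := by
    have := integral_mul_le_of_bump (g := -u) p0 p1 (a := -(u x - ε')) fun z hz => by
      have := h1 ((p2 z hz).trans_le (min_le_left _ _))
      rw [Real.dist_eq] at this
      have := (abs_lt.1 this).1
      simp only [ContinuousMap.neg_apply]
      linarith
    simp only [ContinuousMap.neg_apply, mul_neg, integral_neg] at this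
    simp only [mul_comm (u _)]
    linarith
  have e2 : ∫ z, u z * χ z ∂(surf n) ≤ u y + ε' := by
    simp only [mul_comm (u _)]
    refine integral_mul_le_of_bump q0 q1 fun z hz => ?_
    have := h2 ((q2 z hz).trans_le ((min_le_right _ _).trans (min_le_left _ _)))
    rw [Real.dist_eq] at this
    have := (abs_lt.1 this).2
    linarith
  have e3 : ∫ z, u z * (ψ - χ) z ∂(surf n) =
      ∫ z, u z * ψ z ∂(surf n) - ∫ z, u z * χ z ∂(surf n) := by
    refine Eq.trans (integral_congr_ae (.of_forall fun z => ?_))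
      (integral_sub (integrable_surf (u * ψ)) (integrable_surf (u * χ)))
    simp only [ContinuousMap.sub_apply, mul_sub]
  have hnn : ∀ f g : C(Sph n, ℝ), (∀ z, 0 ≤ f z) → (∀ z, 0 ≤ g z) →
      0 ≤ ∫ z, f z * riesz (s - n / 2) hs.1 g z ∂(surf n) := fun f g hf hg =>
    integral_nonneg fun z => mul_nonneg (hf z)
      (integral_nonneg fun z' => mul_nonneg (rieszKer_nonneg _ z z') (hg z'))
  have e4 : ∫ z, ψ z * riesz (s - n / 2) hs.1 χ z ∂(surf n) ≤ rieszKer (s - n / 2) x y + ε' := by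
    refine integral_mul_le_of_bump p0 p1 fun z hz => ?_
    rw [riesz_apply]
    have := integral_mul_le_of_bump (g := rieszKerC (s - n / 2) hs.1 z) q0 q1 (a := rieszKer (s - n / 2) x y + ε')
      fun z' hz' => by
        have h4 : dist (z, z') (x, y) < δ₃ := by
          rw [Prod.dist_eq]
          have := (min_le_right δ₁ (min δ₂ δ₃)).trans (min_le_right _ _)
          exact max_lt ((p2 z hz).trans_le this) ((q2 z' hz').trans_le this)
        have := h3 h4
        rw [Real.dist_eq] at this
        have := (abs_lt.1 this).2
        simp only [Function.uncurry_apply_pair] at this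
        rw [rieszKerC_apply]
        linarith
    simpa only [rieszKerC_apply, mul_comm] using this
  have e5 : ∫ z, (ψ - χ) z * riesz (s - n / 2) hs.1 (ψ - χ) z ∂(surf n) =
      ∫ z, ψ z * riesz (s - n / 2) hs.1 ψ z ∂(surf n) + ∫ z, χ z * riesz (s - n / 2) hs.1 χ z ∂(surf n) -
        2 * ∫ z, ψ z * riesz (s - n / 2) hs.1 χ z ∂(surf n) := by
    have hsym : ∫ z, χ z * riesz (s - n / 2) hs.1 ψ z ∂(surf n) = ∫ z, ψ z * riesz (s - n / 2) hs.1 χ z ∂(surf n) := by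
      rw [← integral_riesz_mul]
      simp only [mul_comm]
    have hi := fun f g : C(Sph n, ℝ) => integrable_surf (f * riesz (s - n / 2) hs.1 g)
    have h1 := integral_sub ((hi ψ ψ).add (hi χ χ)) ((hi ψ χ).add (hi χ ψ))
    have h2 := integral_add (hi ψ ψ) (hi χ χ)
    have h3 := integral_add (hi ψ χ) (hi χ ψ)
    simp only [ContinuousMap.mul_apply, Pi.add_apply] at h1 h2 h3
    rw [h2, h3, hsym] at h1
    refine Eq.trans (integral_congr_ae (.of_forall fun z => ?_)) (h1.trans (by ring))
    simp only [map_sub, ContinuousMap.sub_apply]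
    ring
  have e6 : (alpha n s 0 * c)⁻¹ * ∫ z, (ψ - χ) z * riesz (s - n / 2) hs.1 (ψ - χ) z ∂(surf n) ≤
      D⁻¹ * (2 * (rieszKer (s - n / 2) x y + ε')) := by
    have : (alpha n s 0 * c)⁻¹ = -D⁻¹ := by rw [hDdef, inv_neg, neg_neg]
    rw [this, neg_mul, ← mul_neg]
    refine mul_le_mul_of_nonneg_left ?_ (inv_pos.2 hD).le
    rw [e5]
    have := hnn ψ ψ p0 p0
    have := hnn χ χ q0 q0
    linarith
  have e7 := mul_le_mul_of_nonneg_left e6 (inv_pos.2 hr).le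
  rw [e3] at key
  have e8 : r⁻¹ * (D⁻¹ * (2 * (rieszKer (s - n / 2) x y + ε'))) =
      r⁻¹ * (D⁻¹ * (2 * rieszKer (s - n / 2) x y)) + r⁻¹ * (D⁻¹ * (2 * ε')) := by ring
  linarith

lemma rieszKer_le_dist {e : ℝ} (he : 0 < e) (x y : Sph n) :
    rieszKer e x y ≤ dist x y ^ e * dist x y ^ e := by
  have h : 1 - ⟪(x : Amb n), (y : Amb n)⟫ = dist x y ^ 2 / 2 := by
    rw [Subtype.dist_eq, dist_eq_norm, norm_sub_sq_real]
    simp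
    ring
  rw [rieszKer, ← Real.mul_rpow dist_nonneg dist_nonneg]
  refine Real.rpow_le_rpow (one_sub_inner_nonneg x y) ?_ he.le
  rw [h]
  nlinarith [sq_nonneg (dist x y)]

/-- Functions in `H^s` are Hölder continuous. -/
lemma exists_holder (hn : 2 ≤ n) (hs : s - (n : ℝ) / 2 ∈ Set.Ioo (0 : ℝ) 1) :
    ∃ D : ℝ, 0 < D ∧ ∀ u : C(Sph n, ℝ), MemHs n s (toL2 n u) → ∀ x y,
      |u x - u y| ≤ ((form n s (toL2 n u) (toL2 n u) -
        alpha n s 0 * ‖proj n 0 (toL2 n u)‖ ^ 2) + D) * dist x y ^ (s - n / 2) := by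
  obtain ⟨c, hc0, hc⟩ := exists_riesz_one_pos (n := n) (s - n / 2) hs.1
  have hD : 0 < -(alpha n s 0 * c) :=
    neg_pos.2 (mul_neg_of_neg_of_pos (alpha_zero_neg hn hs) hc0)
  refine ⟨(-(alpha n s 0 * c))⁻¹, inv_pos.2 hD, fun u hu => ?_⟩
  set A := form n s (toL2 n u) (toL2 n u) - alpha n s 0 * ‖proj n 0 (toL2 n u)‖ ^ 2 with hA
  have hA0 : 0 ≤ A := by
    have h := (hasSum_form hn hs hu).sub
      (hasSum_ite_eq 0 (alpha n s 0 * ‖proj n 0 (toL2 n u)‖ ^ 2))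
    refine h.nonneg fun l => ?_
    rcases l with _ | l
    · simp
    · have := alpha_succ_pos hs l
      simp only [Nat.add_eq_zero_iff, one_ne_zero, and_false, if_false, sub_zero]
      positivity
  have key : ∀ x y, u x - u y ≤ (A + (-(alpha n s 0 * c))⁻¹) * dist x y ^ (s - (n : ℝ) / 2) := by
    intro x y
    rcases eq_or_ne x y with rfl | hxy
    · simp [Real.zero_rpow hs.1.ne']
    · have hd := Real.rpow_pos_of_pos (dist_pos.2 hxy) (s - (n : ℝ) / 2)
      -- The kernel is at most dist^{2σ}, so r = dist^σ balances the two terms: both become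
      -- multiples of dist^σ.
      have h := sub_le_of_form hn hs hc0 hc hu x y hd
      have hk := rieszKer_le_dist (n := n) hs.1 x y
      set d := dist x y ^ (s - (n : ℝ) / 2)
      have h2 : d⁻¹ * ((-(alpha n s 0 * c))⁻¹ * (2 * rieszKer (s - n / 2) x y)) ≤
          d⁻¹ * ((-(alpha n s 0 * c))⁻¹ * (2 * (d * d))) := by
        have := (inv_pos.2 hD).le
        gcongr
      have h3 : d⁻¹ * ((-(alpha n s 0 * c))⁻¹ * (2 * (d * d))) = 2 * ((-(alpha n s 0 * c))⁻¹ * d) := by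
        field_simp
      rw [← hA] at h
      have h4 : 0 ≤ d * A := by positivity
      rw [add_mul]
      linarith
  intro x y
  rw [abs_le]
  refine ⟨?_, key x y⟩
  have := key y x
  rw [dist_comm] at this
  linarith

/-- Subtracting 2α(0) in degree 0 replaces α by |α|, which is comparable to the Sobolev weight. -/
lemma exists_tsum_hsWeight_le (hn : 2 ≤ n) (hs : s - (n : ℝ) / 2 ∈ Set.Ioo (0 : ℝ) 1) :
    ∃ C : ℝ, 0 < C ∧ ∀ f : L2 n, MemHs n s f → ∑' l, hsWeight n s l * ‖proj n l f‖ ^ 2 ≤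
      C * (form n s f f - 2 * alpha n s 0 * ‖proj n 0 f‖ ^ 2) := by
  obtain ⟨C, hC, h⟩ := exists_hsWeight_le hn hs
  refine ⟨C, hC, fun f hf => ?_⟩
  have h2 := ((hasSum_form hn hs hf).sub
    (hasSum_ite_eq 0 (2 * alpha n s 0 * ‖proj n 0 f‖ ^ 2))).mul_left C
  refine hasSum_le (fun l => ?_) (Summable.hasSum hf) h2
  have h3 := mul_le_mul_of_nonneg_right (h l) (by positivity : 0 ≤ ‖proj n l f‖ ^ 2)
  refine h3.trans_eq ?_
  rcases l with _ | l
  · rw [abs_of_neg (alpha_zero_neg hn hs)]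
    simp
    ring
  · rw [abs_of_pos (alpha_succ_pos hs l)]
    simp
    ring

lemma tendsto_proj_of_tendsto {f : ℕ → L2 n} {g : L2 n} (h : Tendsto f atTop (𝓝 g)) (l : ℕ) :
    Tendsto (fun k => proj n l (f k)) atTop (𝓝 (proj n l g)) :=
  ((proj n l).continuous.tendsto _).comp h

lemma memHs_of_tendsto (hn : 2 ≤ n) {f : ℕ → L2 n} {g : L2 n} (h : Tendsto f atTop (𝓝 g))
    (hf : ∀ k, MemHs n s (f k)) {B : ℝ} (hB : ∀ k, ∑' l, hsWeight n s l * ‖proj n l (f k)‖ ^ 2 ≤ B) :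
    MemHs n s g ∧ ∑' l, hsWeight n s l * ‖proj n l g‖ ^ 2 ≤ B := by
  refine summable_and_tsum_le (fun l => mul_nonneg (hsWeight_pos hn _).le (by positivity))
    fun M _ => ?_
  have hlim : Tendsto (fun k => ∑ l ∈ Finset.range M, hsWeight n s l * ‖proj n l (f k)‖ ^ 2) atTop
      (𝓝 (∑ l ∈ Finset.range M, hsWeight n s l * ‖proj n l g‖ ^ 2)) :=
    tendsto_finsetSum _ fun l _ => ((tendsto_proj_of_tendsto h l).norm.pow 2).const_mul _
  refine le_of_tendsto' hlim fun k => le_trans ?_ (hB k)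
  exact Summable.sum_le_tsum _ (fun l _ => mul_nonneg (hsWeight_pos hn _).le (by positivity)) (hf k)

lemma abs_tsum_mul_inner_le {a : ℕ → ℝ} (ha : ∀ l, 0 < a l) {F G : ℕ → L2 n}
    (hF : Summable fun l => a l * ‖F l‖ ^ 2) (hG : Summable fun l => a l * ‖G l‖ ^ 2)
    {r : ℝ} (hr : 0 < r) :
    |∑' l, a l * ⟪F l, G l⟫| ≤
      (r * ∑' l, a l * ‖F l‖ ^ 2 + r⁻¹ * ∑' l, a l * ‖G l‖ ^ 2) / 2 := by
  have h := (((hF.hasSum.mul_left r).add (hG.hasSum.mul_left r⁻¹)).div_const 2)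
  rw [← Real.norm_eq_abs]
  refine tsum_of_norm_bounded h fun l => ?_
  rw [Real.norm_eq_abs, abs_mul, abs_of_pos (ha l)]
  have h6 := two_inner_le (F l) (G l) hr
  have h7 := two_inner_le (-(F l)) (G l) hr
  rw [inner_neg_left, norm_neg] at h7
  have h8 : |⟪F l, G l⟫| ≤ (r * ‖F l‖ ^ 2 + r⁻¹ * ‖G l‖ ^ 2) / 2 :=
    abs_le.2 ⟨by linarith, by linarith⟩
  refine (mul_le_mul_of_nonneg_left h8 (ha l).le).trans_eq ?_
  ring

lemma abs_tail_le {a : ℕ → ℝ} (ha : ∀ l, 0 < a l) {F G : ℕ → L2 n}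
    (hF : Summable fun l => a l * ‖F l‖ ^ 2) (hG : Summable fun l => a l * ‖G l‖ ^ 2)
    {r B : ℝ} (hr : 0 < r) (hB : ∑' l, a l * ‖F l‖ ^ 2 ≤ B) (M : ℕ) :
    |∑' l, a (l + M) * ⟪F (l + M), G (l + M)⟫| ≤
      (r * B + r⁻¹ * ∑' l, a (l + M) * ‖G (l + M)‖ ^ 2) / 2 := by
  have h2 : Summable fun l => a (l + M) * ‖F (l + M)‖ ^ 2 :=
    (summable_nat_add_iff (f := fun l => a l * ‖F l‖ ^ 2) M).2 hF
  have h3 : Summable fun l => a (l + M) * ‖G (l + M)‖ ^ 2 :=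
    (summable_nat_add_iff (f := fun l => a l * ‖G l‖ ^ 2) M).2 hG
  refine (abs_tsum_mul_inner_le (a := fun l => a (l + M)) (F := fun l => F (l + M))
    (G := fun l => G (l + M)) (fun l => ha _) h2 h3 hr).trans ?_
  have h4 := hF.sum_add_tsum_nat_add M
  have : 0 ≤ ∑ l ∈ Finset.range M, a l * ‖F l‖ ^ 2 :=
    Finset.sum_nonneg fun l _ => mul_nonneg (ha l).le (by positivity)
  have h5 : ∑' l, a (l + M) * ‖F (l + M)‖ ^ 2 ≤ B := by linarith
  gcongr

/-- Bounded sequences in `H^s` that converge in `L²` converge weakly in `H^s`. -/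
lemma weakConvHs_of_tendsto (hn : 2 ≤ n) {f : ℕ → L2 n} {g : L2 n} (h : Tendsto f atTop (𝓝 g))
    (hf : ∀ k, MemHs n s (f k)) {B : ℝ} (hB : ∀ k, ∑' l, hsWeight n s l * ‖proj n l (f k)‖ ^ 2 ≤ B) :
    WeakConvHs n s f g := by
  obtain ⟨hg, hgB⟩ := memHs_of_tendsto hn h hf hB
  refine ⟨hf, hg, fun φ hφ => ?_⟩
  have hB0 : 0 ≤ B := (tsum_nonneg fun l => mul_nonneg (hsWeight_pos hn l).le (by positivity)).trans hgB
  have hdiff : ∀ k, hsInner n s (f k) φ - hsInner n s g φ =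
      ∑' l, hsWeight n s l * ⟪proj n l (f k) - proj n l g, proj n l φ⟫ := by
    intro k
    rw [hsInner, hsInner, ← (summable_hsInner hn (hf k) hφ).tsum_sub (summable_hsInner hn hg hφ)]
    exact tsum_congr fun l => by rw [inner_sub_left, mul_sub]
  have hsum : ∀ k, Summable fun l => hsWeight n s l * ⟪proj n l (f k) - proj n l g, proj n l φ⟫ :=
    fun k => (summable_hsInner hn ((hf k).sub hn hg) hφ).congr fun l => by rw [map_sub]
  have hdB : ∀ k, ∑' l, hsWeight n s l * ‖proj n l (f k) - proj n l g‖ ^ 2 ≤ 4 * B := by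
    intro k
    have h1 := ((Summable.hasSum (hf k)).add (Summable.hasSum hg)).mul_left 2
    refine (hasSum_le (fun l => ?_) (((hf k).sub hn hg).congr fun l => by rw [map_sub]).hasSum h1).trans ?_
    · rw [← mul_add, mul_left_comm]
      refine mul_le_mul_of_nonneg_left ?_ (hsWeight_pos hn l).le
      have := norm_sub_le (proj n l (f k)) (proj n l g)
      nlinarith [norm_nonneg (proj n l (f k) - proj n l g),
        sq_nonneg (‖proj n l (f k)‖ - ‖proj n l g‖)]
    · have := hB k
      linarith
  rw [Metric.tendsto_atTop]
  intro ε hε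
  -- Young's inequality with this r keeps the tail below ε/2, once the tail of φ is below εr/2.
  set r : ℝ := ε / (16 * B + 16) with hr
  have hr0 : 0 < r := by positivity
  have htail := tendsto_sum_nat_add fun l => hsWeight n s l * ‖proj n l φ‖ ^ 2
  obtain ⟨M, hM⟩ := (htail.eventually_lt_const (by positivity : 0 < ε * r / 2)).exists
  have hfin : Tendsto (fun k => ∑ l ∈ Finset.range M,
      hsWeight n s l * ⟪proj n l (f k) - proj n l g, proj n l φ⟫) atTop (𝓝 0) := by
    have h0 : ∀ l ∈ Finset.range M, Tendsto (fun k => hsWeight n s l *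
        ⟪proj n l (f k) - proj n l g, proj n l φ⟫) atTop (𝓝 0) := fun l _ => by
      have h1 := (((tendsto_proj_of_tendsto h l).sub_const (proj n l g)).inner
        (tendsto_const_nhds (x := proj n l φ))).const_mul (hsWeight n s l)
      rwa [sub_self, inner_zero_left, mul_zero] at h1
    have h2 := tendsto_finsetSum _ h0
    rwa [Finset.sum_const_zero] at h2
  obtain ⟨N, hN⟩ := (Metric.tendsto_atTop.1 hfin) (ε / 2) (by positivity)
  refine ⟨N, fun k hk => ?_⟩
  have h1 := hN k hk
  rw [Real.dist_eq, sub_zero] at h1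
  rw [Real.dist_eq, hdiff, ← (hsum k).sum_add_tsum_nat_add M]
  have hs1 : Summable fun l => hsWeight n s l * ‖proj n l (f k) - proj n l g‖ ^ 2 :=
    Summable.congr ((hf k).sub hn hg) fun l => by rw [map_sub]
  have h2 : |∑' l, hsWeight n s (l + M) *
      ⟪proj n (l + M) (f k) - proj n (l + M) g, proj n (l + M) φ⟫| ≤
      (r * (4 * B) + r⁻¹ * (ε * r / 2)) / 2 := by
    refine (abs_tail_le (a := hsWeight n s) (F := fun l => proj n l (f k) - proj n l g)
      (G := fun l => proj n l φ) (hsWeight_pos hn) hs1 hφ hr0 (hdB k) M).trans ?_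
    have := (inv_pos.2 hr0).le
    gcongr
  have h3 : (r * (4 * B) + r⁻¹ * (ε * r / 2)) / 2 < ε / 2 := by
    have : r⁻¹ * (ε * r / 2) = ε / 2 := by field_simp
    rw [this]
    have : r * (16 * B + 16) = ε := by rw [hr]; field_simp
    nlinarith
  calc _ ≤ _ := abs_add_le _ _
    _ < ε / 2 + ε / 2 := add_lt_add_of_lt_of_le h1 (h2.trans h3.le)
    _ = ε := by ring

/-- Compactness of normalized sequences with bounded energy. -/
lemma exists_subseq_tendsto (hn : 2 ≤ n) (hs : s - (n : ℝ) / 2 ∈ Set.Ioo (0 : ℝ) 1)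
    (v : ℕ → C(Sph n, ℝ)) (hv : ∀ k, MemHs n s (toL2 n (v k)))
    (hm : ∀ k, ∫ x, v k x ∂(surf n) = (surf n).real Set.univ) {B : ℝ}
    (hB : ∀ k, form n s (toL2 n (v k)) (toL2 n (v k)) ≤ B) :
    ∃ (φ : ℕ → ℕ) (w : C(Sph n, ℝ)), StrictMono φ ∧ Tendsto (fun k => v (φ k)) atTop (𝓝 w) ∧
      WeakConvHs n s (fun k => toL2 n (v (φ k))) (toL2 n w) := by
  have hS := surf_real_univ_pos (n := n)
  have hp : ∀ k, ‖proj n 0 (toL2 n (v k))‖ ^ 2 = (surf n).real Set.univ := fun k => by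
    rw [norm_proj_zero_sq, hm, sq, mul_div_assoc, div_self hS.ne', mul_one]
  obtain ⟨D, hD, hH⟩ := exists_holder (n := n) hn hs
  set L := B - alpha n s 0 * (surf n).real Set.univ + D with hL
  have hLip : ∀ k x y, |v k x - v k y| ≤ L * dist x y ^ (s - (n : ℝ) / 2) := by
    intro k x y
    refine (hH (v k) (hv k) x y).trans ?_
    have : 0 ≤ dist x y ^ (s - (n : ℝ) / 2) := Real.rpow_nonneg dist_nonneg _
    rw [hp]
    have := hB k
    gcongr
    linarith
  have hL0 : 0 ≤ L := by
    have x₀ : Sph n := ⟨EuclideanSpace.single 0 1, by simp⟩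
    have h := (abs_nonneg _).trans (hLip 0 x₀ (-x₀))
    have hd : 0 < dist x₀ (-x₀) := dist_pos.2 (ne_neg_of_mem_unit_sphere ℝ x₀)
    exact nonneg_of_mul_nonneg_left h (Real.rpow_pos_of_pos hd _)
  have hdist : ∀ x y : Sph n, dist x y ≤ 2 := fun x y => by
    rw [Subtype.dist_eq, dist_eq_norm]
    refine (norm_sub_le _ _).trans ?_
    simp
    norm_num
  -- Each v k has mean 1 and the sphere has diameter 2, so the Hölder bound on the oscillation
  -- bounds the function itself.
  have hbd : ∀ k x, |v k x| ≤ 1 + L * 2 ^ (s - (n : ℝ) / 2) := by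
    intro k x
    have h1 : |∫ y, (v k x - v k y) ∂(surf n)| ≤
        L * 2 ^ (s - (n : ℝ) / 2) * (surf n).real Set.univ := by
      rw [← Real.norm_eq_abs]
      refine norm_integral_le_of_norm_le_const (.of_forall fun y => (hLip k x y).trans ?_)
      have := hs.1.le
      gcongr
      exact hdist x y
    rw [integral_sub (integrable_const _) (integrable_surf _), hm, integral_const, smul_eq_mul,
      ← mul_sub_one, abs_mul, abs_of_pos hS, mul_comm] at h1
    have h2 := le_of_mul_le_mul_right h1 hS
    have := abs_sub_abs_le_abs_sub (v k x) 1
    rw [abs_one] at this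
    linarith
  set A : Set (BoundedContinuousFunction (Sph n) ℝ) :=
    Set.range fun k => BoundedContinuousFunction.mkOfCompact (v k)
  have hcomp : IsCompact (closure A) := by
    refine BoundedContinuousFunction.arzela_ascoli
      (Set.Icc (-(1 + L * 2 ^ (s - (n : ℝ) / 2))) (1 + L * 2 ^ (s - (n : ℝ) / 2))) isCompact_Icc A ?_ ?_
    · rintro _ x ⟨k, rfl⟩
      exact abs_le.1 (hbd k x)
    · refine Metric.equicontinuous_of_continuity_modulus
        (fun d => L * d ^ (s - (n : ℝ) / 2)) ?_ _ ?_
      · have : Tendsto (fun d : ℝ => L * d ^ (s - (n : ℝ) / 2)) (𝓝 0) (𝓝 (L * 0 ^ (s - (n : ℝ) / 2))) :=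
          ((Real.continuousAt_rpow_const _ _ (Or.inr hs.1.le)).tendsto).const_mul L
        rwa [Real.zero_rpow hs.1.ne', mul_zero] at this
      · rintro x y ⟨_, k, rfl⟩
        exact hLip k x y
  obtain ⟨w', -, φ, hφ, hlim⟩ := hcomp.tendsto_subseq
    (x := fun k => BoundedContinuousFunction.mkOfCompact (v k)) fun k => subset_closure ⟨k, rfl⟩
  have hlim2 : Tendsto (fun k => v (φ k)) atTop (𝓝 w'.toContinuousMap) := by
    rw [ContinuousMap.tendsto_iff_tendstoUniformly]
    exact BoundedContinuousFunction.tendsto_iff_tendstoUniformly.1 hlim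
  refine ⟨φ, w'.toContinuousMap, hφ, hlim2, ?_⟩
  obtain ⟨C, hC, hCb⟩ := exists_tsum_hsWeight_le (n := n) hn hs
  refine weakConvHs_of_tendsto hn (((toL2 n).continuous.tendsto _).comp hlim2) (fun k => hv _)
    (B := C * (B - 2 * alpha n s 0 * (surf n).real Set.univ)) fun k => ?_
  refine (hCb _ (hv _)).trans ?_
  rw [hp]
  have := hB (φ k)
  gcongr

end Compactness

/-! ### Normalization by boosts -/

section Normalization

variable {n : ℕ} {s : ℝ}

/-- The affine function `x ↦ A + ⟪B, x⟫` on the sphere. -/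
def affineC (A : ℝ) (B : Amb n) : C(Sph n, ℝ) := ⟨fun x => A + ⟪B, (x : Amb n)⟫, by fun_prop⟩

@[simp] lemma affineC_apply (A : ℝ) (B : Amb n) (x : Sph n) : affineC A B x = A + ⟪B, (x : Amb n)⟫ := rfl

/-- The function `x ↦ ⟪B, x⟫` on the sphere is a spherical harmonic of degree one. -/
lemma toL2_affineC_zero_mem (B : Amb n) : toL2 n (affineC 0 B) ∈ sphHarm n 1 := by
  refine mem_sphHarm.2 ⟨∑ i, MvPolynomial.C (B i) * MvPolynomial.X i, mem_harmonicPoly.2 ⟨?_, ?_⟩, ?_⟩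
  · refine MvPolynomial.IsHomogeneous.sum _ _ _ fun i _ => ?_
    simpa using (MvPolynomial.isHomogeneous_C _ (B i)).mul (MvPolynomial.isHomogeneous_X ℝ i)
  · have h : ∀ i j : Fin (n + 1), MvPolynomial.pderiv i (MvPolynomial.pderiv i
        (MvPolynomial.X (R := ℝ) j)) = 0 := fun i j => by
      rcases eq_or_ne j i with rfl | hij
      · simp
      · rw [MvPolynomial.pderiv_X_of_ne hij, map_zero]
    simp only [polyLaplacian, map_sum, MvPolynomial.pderiv_C_mul, h,
      Finset.sum_const_zero, mul_zero]
  · congr 1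
    ext x
    simp [polyRestrict_apply, PiLp.inner_apply, mul_comm]

lemma affineC_eq (A : ℝ) (B : Amb n) : affineC A B = A • 1 + affineC 0 B := by
  ext x
  simp

lemma memHs_affineC (hn : 2 ≤ n) (A : ℝ) (B : Amb n) : MemHs n s (toL2 n (affineC A B)) := by
  rw [affineC_eq, map_add, map_smul]
  exact ((memHs_of_mem_sphHarm hn one_mem_sphHarm_zero).smul A).add hn
    (memHs_of_mem_sphHarm hn (toL2_affineC_zero_mem B))

/-- Affine functions live in degrees 0 and 1, so the form tested on them sees only the mass and the
center of mass of f. -/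
lemma form_affineC (hn : 2 ≤ n) (hs : s - (n : ℝ) / 2 ∈ Set.Ioo (0 : ℝ) 1) {f : C(Sph n, ℝ)}
    (hf : MemHs n s (toL2 n f)) (A : ℝ) (B : Amb n) :
    form n s (toL2 n f) (toL2 n (affineC A B)) =
      alpha n s 0 * A * ∫ x, f x ∂(surf n) + alpha n s 1 * ∫ x, f x * ⟪B, (x : Amb n)⟫ ∂(surf n) := by
  have h0 := memHs_of_mem_sphHarm (s := s) hn (one_mem_sphHarm_zero (n := n))
  have h1 := memHs_of_mem_sphHarm (s := s) hn (toL2_affineC_zero_mem B)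
  rw [affineC_eq, map_add, map_smul, form_add_right hn hs hf (h0.smul A) h1, form_smul_right,
    form_sphHarm_right hn _ one_mem_sphHarm_zero, form_sphHarm_right hn _ (toL2_affineC_zero_mem B),
    inner_toL2, inner_toL2]
  simp
  ring

lemma form_one (hn : 2 ≤ n) (f : C(Sph n, ℝ)) :
    form n s (toL2 n f) (toL2 n 1) = alpha n s 0 * ∫ x, f x ∂(surf n) := by
  rw [form_sphHarm_right hn _ one_mem_sphHarm_zero, inner_toL2]
  simp

lemma integral_inner_coe_sq (e : Sph n) :
    ∫ x : Sph n, ⟪(e : Amb n), (x : Amb n)⟫ ^ 2 ∂(surf n) = (surf n).real Set.univ / (n + 1) := by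
  have h1 : ∀ i : Fin (n + 1), ∫ x : Sph n, (x : Amb n) i ^ 2 ∂(surf n) =
      ∫ x : Sph n, ⟪(e : Amb n), (x : Amb n)⟫ ^ 2 ∂(surf n) := fun i => by
    rw [← integral_inner_coe_comp_congr (fun t => t ^ 2) ⟨EuclideanSpace.single i 1, by simp⟩ e]
    simp [EuclideanSpace.inner_single_left]
  have h2 : ∑ i : Fin (n + 1), ∫ x : Sph n, (x : Amb n) i ^ 2 ∂(surf n) = (surf n).real Set.univ := by
    rw [← integral_finsetSum _ fun i _ =>
      integrable_surf (⟨fun x : Sph n => (x : Amb n) i ^ 2, by fun_prop⟩ : C(Sph n, ℝ))]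
    have : ∀ x : Sph n, ∑ i, (x : Amb n) i ^ 2 = 1 := fun x => by
      have h := EuclideanSpace.norm_sq_eq (x : Amb n)
      simp only [norm_coe_sph, one_pow, Real.norm_eq_abs, sq_abs] at h
      exact h.symm
    simp only [this, integral_const, smul_eq_mul, mul_one]
  simp only [h1, Finset.sum_const, Finset.card_univ, Fintype.card_fin, nsmul_eq_mul] at h2
  rw [← h2]
  push_cast
  field_simp

lemma exists_eq_norm_smul_sph (w : Amb n) : ∃ e : Sph n, w = ‖w‖ • (e : Amb n) := by
  rcases eq_or_ne w 0 with rfl | hw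
  · exact ⟨⟨EuclideanSpace.single 0 1, by simp⟩, by simp⟩
  · have h : ‖w‖ ≠ 0 := norm_ne_zero_iff.2 hw
    exact ⟨⟨‖w‖⁻¹ • w, by simp [norm_smul, h]⟩, by simp [smul_smul, h]⟩

lemma integral_comp_neg_sph (f : Sph n → ℝ) : ∫ x, f (-x) ∂(surf n) = ∫ x, f x ∂(surf n) := by
  rw [← integral_comp_sphIsom (LinearIsometryEquiv.neg ℝ) f]
  refine integral_congr_ae (.of_forall fun x => congrArg f (Subtype.ext ?_))
  simp [coe_sphIsom]

/-- With t = a·x, the product of the stretches at x and -x is (1-t²)λ² + t², where λ = `lorentz w`.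
The arithmetic-geometric mean inequality and concavity of the power e/2 give the bound. -/
lemma stretch_rpow_add_ge {e : ℝ} (he : e ∈ Set.Ioo (0 : ℝ) 1) (w : Amb n) {a : Sph n}
    (ha : w = ‖w‖ • (a : Amb n)) (x : Sph n) :
    2 * (lorentz w ^ e - ⟪(a : Amb n), (x : Amb n)⟫ ^ 2 * (lorentz w ^ e - 1)) ≤
      stretch w x ^ e + stretch w (-x : Sph n) ^ e := by
  set t := ⟪(a : Amb n), (x : Amb n)⟫ with ht
  have ht1 : t ^ 2 ≤ 1 := by
    have := abs_real_inner_le_norm (a : Amb n) (x : Amb n)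
    simp only [norm_coe_sph, mul_one] at this
    rw [← sq_abs]
    exact pow_le_one₀ (abs_nonneg _) this
  have hx := stretch_coe_pos w x
  have hx' := stretch_coe_pos w (-x)
  have hg := lorentz_pos w
  have hwx : ⟪w, (x : Amb n)⟫ = ‖w‖ * t := by
    conv_lhs => rw [ha]
    rw [real_inner_smul_left]
  have hprod : stretch w x * stretch w (-x : Sph n) = (1 - t ^ 2) * lorentz w ^ 2 + t ^ 2 * 1 := by
    have h := lorentz_sq w
    simp only [stretch, coe_neg_sphere, inner_neg_right, hwx]
    linear_combination t ^ 2 * h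
  have h1 := (Real.concaveOn_rpow (p := e / 2) (by linarith [he.1]) (by linarith [he.2])).2
    (Set.mem_Ici.2 (sq_nonneg (lorentz w))) (Set.mem_Ici.2 zero_le_one)
    (sub_nonneg.2 ht1) (sq_nonneg t) (by ring)
  simp only [smul_eq_mul] at h1
  have h5 : (lorentz w ^ 2) ^ (e / 2) = lorentz w ^ e := by
    rw [← Real.rpow_natCast, ← Real.rpow_mul hg.le]
    congr 1
    push_cast
    ring
  rw [← hprod, Real.one_rpow, h5, Real.mul_rpow hx.le hx'.le] at h1
  have h2 : ∀ a : ℝ, 0 < a → a ^ e = a ^ (e / 2) * a ^ (e / 2) := fun a ha => by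
    rw [← Real.rpow_add ha]; congr 1; ring
  have h3 := h2 _ hx
  have h4 := h2 _ hx'
  nlinarith [sq_nonneg (stretch w x ^ (e / 2) - stretch w (-x : Sph n) ^ (e / 2))]

/-- Averages the antipodal bound, using that t² has mean 1/(n+1). The growth in `lorentz w` makes
the mass coercive in the boost parameter. -/
lemma integral_stretch_rpow_ge {e : ℝ} (he : e ∈ Set.Ioo (0 : ℝ) 1) (w : Amb n) :
    (surf n).real Set.univ * (1 + n / (n + 1) * (lorentz w ^ e - 1)) ≤
      ∫ x : Sph n, stretch w x ^ e ∂(surf n) := by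
  obtain ⟨a, ha⟩ := exists_eq_norm_smul_sph w
  have h1 := integral_comp_neg_sph fun x : Sph n => stretch w x ^ e
  set f : C(Sph n, ℝ) := ⟨fun x => stretch w x ^ e,
    (stretchC w).continuous.rpow_const fun x => Or.inl (stretch_coe_pos w x).ne'⟩
  have hf := integrable_surf f
  have hf' := integrable_surf (f.comp ⟨fun x => -x, by fun_prop⟩)
  have hg := integrable_surf (⟨fun x : Sph n => ⟪(a : Amb n), (x : Amb n)⟫ ^ 2, by fun_prop⟩ : C(Sph n, ℝ))
  have h2 := integral_mono (((integrable_const (lorentz w ^ e)).sub (hg.mul_const (lorentz w ^ e - 1))).const_mul 2)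
    (hf.add hf') fun x => stretch_rpow_add_ge he w ha x
  have h3 := integral_add hf hf'
  have h4 := integral_sub (integrable_const (lorentz w ^ e)) (hg.mul_const (lorentz w ^ e - 1))
  have h5 := integral_inner_coe_sq a
  simp only [Pi.add_apply, Pi.sub_apply, ContinuousMap.coe_mk] at h2 h3 h4
  rw [h3, integral_const_mul, h4, integral_mul_const, h5, integral_const, smul_eq_mul] at h2
  change _ ≤ _ + ∫ x : Sph n, stretch w (-x : Sph n) ^ e ∂(surf n) at h2
  rw [h1] at h2
  change _ ≤ ∫ x : Sph n, stretch w x ^ e ∂(surf n) + _ at h2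
  have h6 : (surf n).real Set.univ * (1 + n / (n + 1) * (lorentz w ^ e - 1)) =
      (surf n).real Set.univ * lorentz w ^ e -
        (surf n).real Set.univ / (n + 1) * (lorentz w ^ e - 1) := by
    field_simp
    ring
  linarith

end Normalization

/-! ### Minimizing the mass over boosts -/

section Minimization

variable {n : ℕ} {s : ℝ}

/-- The mean of the boosted function `twist e (-w) u`, as a function of the boost parameter. -/
def boostMass (e : ℝ) (u : C(Sph n, ℝ)) (w : Amb n) : ℝ := ∫ x, twist e (-w) u x ∂(surf n)

/-- By duality w enters only through the smooth weight, so the mass can be differentiated in w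
although u is merely continuous. -/
lemma boostMass_eq (e : ℝ) (u : C(Sph n, ℝ)) (w : Amb n) :
    boostMass e u w = ∫ x : Sph n, stretch w x ^ (-((n : ℝ) + e)) * u x ∂(surf n) := by
  have h := integral_twist_mul (e := e) (e' := -((n : ℝ) + e)) (by ring) (-w) u 1
  simp only [neg_neg, twist_apply, ContinuousMap.one_apply, mul_one, one_mul] at h
  rw [boostMass]
  simp only [twist_apply]
  rw [h]
  exact integral_congr_ae (.of_forall fun x => mul_comm _ _)

lemma boostMass_zero (e : ℝ) (u : C(Sph n, ℝ)) : boostMass e u 0 = ∫ x, u x ∂(surf n) := by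
  rw [boostMass, neg_zero, twist_zero]

lemma boostMass_one_ge {e : ℝ} (he : e ∈ Set.Ioo (0 : ℝ) 1) (w : Amb n) :
    (surf n).real Set.univ * (1 + n / (n + 1) * (lorentz w ^ e - 1)) ≤ boostMass e 1 w := by
  have h := integral_stretch_rpow_ge he (-w)
  rw [lorentz_neg] at h
  refine h.trans_eq ?_
  simp [boostMass]

lemma continuous_stretch_pair : Continuous fun z : Amb n × Sph n => stretch z.1 (z.2 : Amb n) := by
  unfold stretch
  exact (contDiff_lorentz (m := 0).continuous.comp continuous_fst).add (by fun_prop)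

lemma continuous_stretch_rpow (e : ℝ) (w : Amb n) : Continuous fun x : Sph n => stretch w x ^ e :=
  (stretchC w).continuous.rpow_const fun x => Or.inl (stretch_coe_pos w x).ne'

lemma continuous_boostMass (e : ℝ) (u : C(Sph n, ℝ)) : Continuous (boostMass e u) := by
  have h : Continuous (Function.uncurry fun (w : Amb n) (x : Sph n) =>
      stretch w x ^ (-((n : ℝ) + e)) * u x) :=
    (continuous_stretch_pair.rpow_const fun z => Or.inl (stretch_coe_pos z.1 z.2).ne').mul
      (u.continuous.comp continuous_snd)
  have := continuous_parametric_integral_of_continuous (μ := surf n) h isCompact_univ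
  simp only [Measure.restrict_univ] at this
  exact this.congr fun w => (boostMass_eq e u w).symm

lemma boostMass_ge {e : ℝ} {u : C(Sph n, ℝ)} {m : ℝ} (hm : ∀ x, m ≤ u x) (w : Amb n) :
    m * boostMass e 1 w ≤ boostMass e u w := by
  rw [boostMass_eq, boostMass_eq, ← integral_const_mul]
  set k : C(Sph n, ℝ) := ⟨_, continuous_stretch_rpow (-((n : ℝ) + e)) w⟩
  refine integral_mono ((integrable_surf (k * 1)).const_mul m) (integrable_surf (k * u)) fun x => ?_
  have := Real.rpow_pos_of_pos (stretch_coe_pos w x) (-((n : ℝ) + e))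
  simp only [ContinuousMap.one_apply, mul_one]
  nlinarith [hm x]

lemma exists_pos_le_of_pos {u : C(Sph n, ℝ)} (hu : ∀ x, 0 < u x) : ∃ m : ℝ, 0 < m ∧ ∀ x, m ≤ u x := by
  have x₀ : Sph n := ⟨EuclideanSpace.single 0 1, by simp⟩
  obtain ⟨x, -, hx⟩ := (isCompact_univ (X := Sph n)).exists_isMinOn ⟨x₀, trivial⟩ u.continuous.continuousOn
  exact ⟨u x, hu x, fun y => hx (Set.mem_univ y)⟩

/-- Since u is bounded below by some m > 0, its mass dominates m times that of the constant 1, which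
grows like ‖w‖^e. -/
lemma exists_forall_boostMass_le (hn : 2 ≤ n) {e : ℝ} (he : e ∈ Set.Ioo (0 : ℝ) 1) {u : C(Sph n, ℝ)}
    (hu : ∀ x, 0 < u x) : ∃ w, ∀ w', boostMass e u w ≤ boostMass e u w' := by
  obtain ⟨m, hm, hmu⟩ := exists_pos_le_of_pos hu
  refine (continuous_boostMass e u).exists_forall_le ?_
  have hS := surf_real_univ_pos (n := n)
  set c : ℝ := m * ((surf n).real Set.univ * (n / (n + 1))) with hc
  have hn0 : (0 : ℝ) < n := by exact_mod_cast (by omega : 0 < n)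
  have hc0 : 0 < c := by positivity
  have h1 : Tendsto (fun w : Amb n => c * ‖w‖ ^ e) (cocompact _) atTop :=
    ((tendsto_rpow_atTop he.1).comp (tendsto_norm_cocompact_atTop (E := Amb n))).const_mul_atTop hc0
  refine tendsto_atTop_mono (fun w => ?_) h1
  refine le_trans ?_ (boostMass_ge hmu w)
  have h2 := mul_le_mul_of_nonneg_left (boostMass_one_ge he w) hm.le
  refine le_trans ?_ h2
  rw [hc, mul_assoc, mul_assoc]
  have h3 := Real.rpow_le_rpow (norm_nonneg w) (norm_lt_lorentz w).le he.1.le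
  have h4 : (0 : ℝ) < n / (n + 1) := by positivity
  have h5 : (n : ℝ) / (n + 1) ≤ 1 := by rw [div_le_one (by positivity)]; linarith
  gcongr
  nlinarith

/-- The right side is the derivative of w ↦ `stretch w x` in the direction v + (⟪v,w⟫/(1+λ)) w, with
λ = `lorentz w`. Varying w in this direction therefore produces the linear function ⟪v, ·⟫ after the
boost. -/
lemma inner_boost_coe (w v : Amb n) (x : Sph n) :
    ⟪v, boost w x⟫ = ⟪w, v + (⟪v, w⟫ / (1 + lorentz w)) • w⟫ / lorentz w +
      ⟪v + (⟪v, w⟫ / (1 + lorentz w)) • w, (x : Amb n)⟫ := by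
  have h := lorentz_sq w
  have h1 := lorentz_pos w
  have h2 : (1 + lorentz w) ≠ 0 := by positivity
  have h3 : ‖w‖ ^ 2 = lorentz w ^ 2 - 1 := by linarith
  simp only [boost, norm_coe_sph, inner_add_right, inner_add_left, real_inner_smul_right,
    real_inner_smul_left, real_inner_self_eq_norm_sq, h3, real_inner_comm v w]
  field_simp
  ring

/-- The first-order condition at a minimum of the mass: the boosted function is centered. -/
lemma integral_twist_mul_inner_eq_zero {e : ℝ} (he : 0 < e) {u : C(Sph n, ℝ)} {w : Amb n}
    (hw : ∀ w', boostMass e u w ≤ boostMass e u w') (v : Amb n) :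
    ∫ x, twist e (-w) u x * ⟪v, (x : Amb n)⟫ ∂(surf n) = 0 := by
  set p : ℝ := -((n : ℝ) + e) with hp
  have hp0 : p ≠ 0 := by
    have : (0 : ℝ) ≤ n := n.cast_nonneg
    rw [hp]; exact (neg_neg_of_pos (by positivity)).ne
  -- The direction from `inner_boost_coe`: the derivative of the mass along it is p times the moment
  -- of the boosted function against v.
  set v' := v + (⟪v, w⟫ / (1 + lorentz w)) • w with hv'
  have hd : ∀ x : Sph n, HasDerivAt (fun t : ℝ => stretch (w + t • v') (x : Amb n) ^ p)
      ((⟪w, v'⟫ / lorentz w + ⟪v', (x : Amb n)⟫) * p * stretch w x ^ (p - 1)) 0 := fun x => by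
    have := (hasDerivAt_stretch_line w v' (x : Amb n)).rpow_const (p := p)
      (Or.inl (by simpa using (stretch_coe_pos w x).ne'))
    simpa using this
  have hD := hasDerivAt_integral_surf (G := fun t X => stretch (w + t • v') X ^ p)
    (fun t x => ((contDiff_uncurry_stretch w v').contDiffAt).rpow_const_of_ne
      (stretch_coe_pos (w + t • v') x).ne') u hd
  have hmin : IsLocalMin (fun t : ℝ => ∫ x : Sph n, stretch (w + t • v') x ^ p * u x ∂(surf n)) 0 := by
    refine .of_forall fun t => ?_
    have := hw (w + t • v')
    rw [boostMass_eq, boostMass_eq, ← hp] at this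
    simpa only [zero_smul, add_zero] using this
  have h0 := hmin.hasDerivAt_eq_zero hD
  have h1 := integral_twist_mul (e := e) (e' := p) (by rw [hp]; ring) (-w) u (affineC 0 v)
  simp only [affineC_apply, zero_add, neg_neg] at h1
  rw [h1]
  have h2 : p * ∫ x, u x * twist p w (affineC 0 v) x ∂(surf n) = 0 := by
    rw [← integral_const_mul]
    refine Eq.trans ?_ h0
    refine integral_congr_ae (.of_forall fun x => ?_)
    have hx := stretch_coe_pos w x
    have h3 := inner_boost_coe w v x
    rw [← stretch_smul_sphBoost, real_inner_smul_right, ← hv'] at h3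
    have h4 : stretch w (x : Amb n) ^ p = stretch w (x : Amb n) * stretch w (x : Amb n) ^ (p - 1) := by
      rw [Real.rpow_sub_one hx.ne']
      field_simp
    simp only [twist_apply, affineC_apply, zero_add]
    rw [← h3, h4]
    ring
  exact (mul_eq_zero.1 h2).resolve_left hp0

end Minimization

/-! ### The manifold of optimizers and the modified distance -/

section Optimizers

variable {n : ℕ} {s : ℝ}

lemma twist_one_apply (e : ℝ) (w : Amb n) (x : Sph n) : twist e w 1 x = stretch w x ^ e := by simp

/-- ζ is minus the velocity of the boost: with the Lorentz factor g = (1-|ζ|²)^{-1/2} and w = -gζ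
one has `lorentz w` = g and stretch = g(1 - ζ·x). -/
lemma exists_bubble_eq (s : ℝ) {c : ℝ} (hc : 0 < c) {ζ : Amb n} (hζ : ‖ζ‖ < 1) :
    ∃ (b : ℝ) (w : Amb n), 0 < b ∧ ∀ x : Sph n, bubble n s c ζ x = b * stretch w x ^ (s - n / 2) := by
  have h1 : 0 < 1 - ‖ζ‖ ^ 2 := by nlinarith [norm_nonneg ζ]
  set g : ℝ := (√(1 - ‖ζ‖ ^ 2))⁻¹ with hg
  have hg0 : 0 < g := inv_pos.2 (Real.sqrt_pos.2 h1)
  have hg2 : g ^ 2 * (1 - ‖ζ‖ ^ 2) = 1 := by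
    rw [hg, inv_pow, Real.sq_sqrt h1.le, inv_mul_cancel₀ h1.ne']
  have hl : lorentz (-(g • ζ)) = g := by
    rw [lorentz, norm_neg, norm_smul, mul_pow, Real.norm_eq_abs, sq_abs,
      show 1 + g ^ 2 * ‖ζ‖ ^ 2 = g ^ 2 by linarith, Real.sqrt_sq hg0.le]
  refine ⟨c * g ^ (-(s - (n : ℝ) / 2)), -(g • ζ), mul_pos hc (Real.rpow_pos_of_pos hg0 _), fun x => ?_⟩
  have h2 : stretch (-(g • ζ)) (x : Amb n) = g * (1 - ⟪ζ, (x : Amb n)⟫) := by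
    rw [stretch, hl, inner_neg_left, real_inner_smul_left]
    ring
  have h3 := stretch_coe_pos (-(g • ζ)) x
  rw [h2] at h3 ⊢
  have h4 := (pos_of_mul_pos_right h3 hg0.le).le
  rw [bubble, Real.mul_rpow hg0.le h4, mul_assoc, ← mul_assoc (g ^ (-(s - (n : ℝ) / 2))),
    ← Real.rpow_add hg0, neg_add_cancel, Real.rpow_zero, one_mul]
  congr 2
  ring

lemma exists_eq_bubble (s : ℝ) {b : ℝ} (hb : 0 < b) (w : Amb n) :
    ∃ (c : ℝ) (ζ : Amb n), 0 < c ∧ ‖ζ‖ < 1 ∧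
      ∀ x : Sph n, b * stretch w x ^ (s - (n : ℝ) / 2) = bubble n s c ζ x := by
  have hl := lorentz_pos w
  refine ⟨b * lorentz w ^ (s - (n : ℝ) / 2), -((lorentz w)⁻¹ • w),
    mul_pos hb (Real.rpow_pos_of_pos hl _), ?_, fun x => ?_⟩
  · rw [norm_neg, norm_smul, Real.norm_of_nonneg (inv_nonneg.2 hl.le), inv_mul_lt_iff₀ hl, mul_one]
    exact norm_lt_lorentz w
  · have h2 : stretch w (x : Amb n) = lorentz w * (1 - ⟪-((lorentz w)⁻¹ • w), (x : Amb n)⟫) := by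
      rw [stretch, inner_neg_left, real_inner_smul_left]
      field_simp
      ring
    have h3 := stretch_coe_pos w x
    rw [h2] at h3 ⊢
    have h4 := (pos_of_mul_pos_right h3 hl.le).le
    rw [bubble, Real.mul_rpow hl.le h4, mul_assoc]
    congr 3
    ring

/-- ℳ is the orbit of the positive constants under boosts, so questions about ℳ reduce to constants.
-/
lemma mem_optimizers {h : C(Sph n, ℝ)} :
    h ∈ optimizers n s ↔ ∃ (b : ℝ) (w : Amb n), 0 < b ∧ h = b • twist (s - n / 2) w 1 := by
  constructor
  · rintro ⟨c, ζ, hc, hζ, hh⟩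
    obtain ⟨b, w, hb, hw⟩ := exists_bubble_eq s hc hζ
    refine ⟨b, w, hb, ?_⟩
    ext x
    rw [hh, hw, ContinuousMap.smul_apply, twist_one_apply, smul_eq_mul]
  · rintro ⟨b, w, hb, rfl⟩
    obtain ⟨c, ζ, hc, hζ, h⟩ := exists_eq_bubble s hb w
    refine ⟨c, ζ, hc, hζ, fun x => ?_⟩
    rw [← h, ContinuousMap.smul_apply, twist_one_apply, smul_eq_mul]

/-- Vary c alone. As a consequence every admissible ρ is orthogonal to h itself. -/
lemma self_mem_tangent {h : C(Sph n, ℝ)} (hh : h ∈ optimizers n s) : h ∈ tangent n s h := by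
  obtain ⟨c, ζ, hc, hζ, H⟩ := hh
  refine ⟨c, ζ, hc, hζ, H, c, 0, fun x => ?_⟩
  rw [H]
  simp only [bubble, smul_zero, add_zero]
  have := (((hasDerivAt_id (0 : ℝ)).mul_const c).const_add c).mul_const
    ((1 - ⟪ζ, (x : Amb n)⟫) ^ ((2 * s - n) / 2))
  simpa using this

lemma one_sub_inner_pos {ζ : Amb n} (hζ : ‖ζ‖ < 1) (x : Sph n) : 0 < 1 - ⟪ζ, (x : Amb n)⟫ := by
  have := real_inner_le_norm ζ (x : Amb n)
  rw [norm_coe_sph, mul_one] at this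
  linarith

lemma hasDerivAt_bubble (s c τ : ℝ) {ζ : Amb n} (hζ : ‖ζ‖ < 1) (η : Amb n) (x : Sph n) :
    HasDerivAt (fun t : ℝ => bubble n s (c + t * τ) (ζ + t • η) x)
      ((1 - ⟪ζ, (x : Amb n)⟫) ^ (s - (n : ℝ) / 2 - 1) *
        (τ * (1 - ⟪ζ, (x : Amb n)⟫) - c * (s - n / 2) * ⟪η, (x : Amb n)⟫)) 0 := by
  have h0 := one_sub_inner_pos hζ x
  have h1 : HasDerivAt (fun t : ℝ => 1 - ⟪ζ + t • η, (x : Amb n)⟫) (-⟪η, (x : Amb n)⟫) 0 := by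
    simp only [inner_add_left, real_inner_smul_left]
    simpa using (((hasDerivAt_id (0 : ℝ)).mul_const ⟪η, (x : Amb n)⟫).const_add
      ⟪ζ, (x : Amb n)⟫).const_sub 1
  have h2 := h1.rpow_const (p := (2 * s - n) / 2) (Or.inl (by simpa using h0.ne'))
  have h3 : HasDerivAt (fun t : ℝ => c + t * τ) τ 0 := by
    simpa using ((hasDerivAt_id (0 : ℝ)).mul_const τ).const_add c
  refine (h3.fun_mul h2).congr_deriv ?_
  simp only [zero_smul, zero_mul, add_zero]
  rw [show (2 * s - n) / 2 = s - (n : ℝ) / 2 by ring, Real.rpow_sub_one h0.ne']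
  field_simp
  ring

/-- A tangent vector is stretch^{σ-1} times an affine function. Twisting back by -w leaves
stretch(-w) times an affine function of the boosted point, and this is affine again. -/
lemma exists_affineC_of_mem_tangent (hs : s - (n : ℝ) / 2 ≠ 0) {b : ℝ} (hb : 0 < b) {w : Amb n} {φ : C(Sph n, ℝ)}
    (hφ : φ ∈ tangent n s (b • twist (s - n / 2) w 1)) :
    ∃ (A : ℝ) (B : Amb n), φ = twist (s - n / 2) w (affineC A B) := by
  obtain ⟨c, ζ, hc, hζ, hh, τ, η, hd⟩ := hφ
  set σ : ℝ := s - n / 2 with hσ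
  -- Equality of the two descriptions of h, c(1-ζ·x)^σ = b·stretch^σ, forces 1 - ζ·x = k·stretch.
  set k : ℝ := (b / c) ^ σ⁻¹ with hk
  have hk0 : 0 < k := Real.rpow_pos_of_pos (div_pos hb hc) _
  have hbase : ∀ x : Sph n, 1 - ⟪ζ, (x : Amb n)⟫ = k * stretch w x := by
    intro x
    have h0 := one_sub_inner_pos hζ x
    have h1 := stretch_coe_pos w x
    have h2 := hh x
    rw [ContinuousMap.smul_apply, twist_one_apply, smul_eq_mul, bubble,
      show (2 * s - n) / 2 = σ by rw [hσ]; ring] at h2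
    have h3 : (1 - ⟪ζ, (x : Amb n)⟫) ^ σ = (k * stretch w x) ^ σ := by
      rw [Real.mul_rpow hk0.le h1.le, hk, ← Real.rpow_mul (div_pos hb hc).le, inv_mul_cancel₀ hs,
        Real.rpow_one, div_mul_eq_mul_div, h2, mul_div_cancel_left₀ _ hc.ne']
    exact Real.rpow_left_injOn hs h0.le (by positivity : 0 ≤ k * stretch w x) h3
  have hφ : ∀ x, φ x = stretch w x ^ (σ - 1) *
      (k ^ (σ - 1) * (τ - ⟪τ • ζ + (c * σ) • η, (x : Amb n)⟫)) := by
    intro x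
    rw [(hd x).unique (hasDerivAt_bubble s c τ hζ η x), ← hσ, hbase x,
      Real.mul_rpow hk0.le (stretch_coe_pos w x).le, ← hbase x, inner_add_left, real_inner_smul_left,
      real_inner_smul_left]
    ring
  set ξ := τ • ζ + (c * σ) • η with hξ
  refine ⟨k ^ (σ - 1) * (τ * lorentz w - ⟪ξ, -w⟫),
    k ^ (σ - 1) • (-(τ • w) - ξ - (⟪ξ, w⟫ / (1 + lorentz w)) • w), ?_⟩
  rw [← twist_twist_neg σ w φ]
  congr 1
  ext x
  have hx := stretch_coe_pos (-w) x
  rw [twist_apply, hφ, stretch_sphBoost_neg, affineC_apply, Real.inv_rpow hx.le, ← Real.rpow_neg hx.le]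
  have h1 : stretch (-w) (x : Amb n) ^ (-(σ - 1)) * stretch (-w) (x : Amb n) ^ σ = stretch (-w) x := by
    rw [← Real.rpow_add hx]
    simp
  have h2 : stretch (-w) (x : Amb n) * ⟪ξ, (sphBoost (-w) x : Amb n)⟫ = ⟪ξ, boost (-w) x⟫ := by
    rw [← stretch_smul_sphBoost, real_inner_smul_right]
  have h4 : (1 + lorentz w) ≠ 0 := by have := lorentz_pos w; positivity
  have h3 : ⟪ξ, boost (-w) (x : Amb n)⟫ = ⟪ξ, (x : Amb n)⟫ + ⟪ξ, -w⟫ +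
      ⟪ξ, w⟫ / (1 + lorentz w) * ⟪w, (x : Amb n)⟫ := by
    simp only [boost, norm_coe_sph, inner_add_right, real_inner_smul_right, inner_neg_left,
      inner_neg_right, lorentz_neg]
    field_simp
    ring
  have h5 : stretch (-w) (x : Amb n) = lorentz w - ⟪w, (x : Amb n)⟫ := by
    rw [stretch, lorentz_neg, inner_neg_left]
    ring
  calc _ = k ^ (σ - 1) * (τ * stretch (-w) x - stretch (-w) x * ⟪ξ, (sphBoost (-w) x : Amb n)⟫) := by
        linear_combination (k ^ (σ - 1) * (τ - ⟪ξ, (sphBoost (-w) x : Amb n)⟫)) * h1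
    _ = _ := by
        rw [h2, h3, h5]
        simp only [real_inner_smul_left, inner_sub_left, inner_neg_left, inner_neg_right]
        ring

end Optimizers

/-! ### Evaluation of the modified distance -/

section Distance

variable {n : ℕ} {s : ℝ}

lemma memHs_one (hn : 2 ≤ n) : MemHs n s (toL2 n 1) := memHs_of_mem_sphHarm hn one_mem_sphHarm_zero

/-- Undoing the boost by invariance leaves the pairing with the constant 1, which is in degree 0. -/
lemma form_twist_one (hn : 2 ≤ n) (hs : s - (n : ℝ) / 2 ∈ Set.Ioo (0 : ℝ) 1) {u : C(Sph n, ℝ)}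
    (hu : MemHs n s (toL2 n u)) (w : Amb n) :
    form n s (toL2 n u) (toL2 n (twist (s - n / 2) w 1)) =
      alpha n s 0 * boostMass (s - n / 2) u w := by
  have h := form_twist hn hs (memHs_twist hn hs hu (-w)) (memHs_one hn) w
  rw [twist_twist_neg] at h
  rw [h, form_one hn, boostMass]

lemma boostMass_twist_one (e : ℝ) (w : Amb n) :
    boostMass e (twist e w 1) w = (surf n).real Set.univ := by
  simp only [boostMass, twist_neg_twist, ContinuousMap.one_apply, integral_const, smul_eq_mul, mul_one]

/-- Pythagoras: orthogonality of ρ to h fixes the coefficient b, so a[ρ] depends on the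
decomposition only through w. -/
lemma form_of_eq_add (hn : 2 ≤ n) (hs : s - (n : ℝ) / 2 ∈ Set.Ioo (0 : ℝ) 1) {u ρ : C(Sph n, ℝ)}
    {b : ℝ} (hb : b ≠ 0) {w : Amb n} (hρ : MemHs n s (toL2 n ρ))
    (h0 : form n s (toL2 n ρ) (toL2 n (b • twist (s - n / 2) w 1)) = 0)
    (hu : u = b • twist (s - n / 2) w 1 + ρ) :
    boostMass (s - n / 2) u w = b * (surf n).real Set.univ ∧
    form n s (toL2 n ρ) (toL2 n ρ) = form n s (toL2 n u) (toL2 n u) -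
      alpha n s 0 * boostMass (s - n / 2) u w ^ 2 / (surf n).real Set.univ := by
  have hS := (surf_real_univ_pos (n := n)).ne'
  set h : C(Sph n, ℝ) := twist (s - n / 2) w 1 with hh
  have hmh : MemHs n s (toL2 n h) := memHs_twist hn hs (memHs_one hn) w
  have ha := (alpha_zero_neg hn hs).ne
  rw [map_smul, form_smul_right] at h0
  replace h0 := (mul_eq_zero.1 h0).resolve_left hb
  have hf : form n s (toL2 n h) (toL2 n h) = alpha n s 0 * (surf n).real Set.univ := by
    rw [hh, form_twist_one hn hs hmh, boostMass_twist_one]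
  have hmb : MemHs n s (b • toL2 n h) := hmh.smul b
  have hmu : MemHs n s (toL2 n u) := by
    rw [hu, map_add, map_smul]
    exact hmb.add hn hρ
  have h1 : form n s (toL2 n u) (toL2 n h) = b * (alpha n s 0 * (surf n).real Set.univ) := by
    rw [hu, map_add, map_smul, form_add_left hn hs hmb hρ hmh, form_smul_left, hf, h0, add_zero]
  have h2 : boostMass (s - n / 2) u w = b * (surf n).real Set.univ := by
    rw [form_twist_one hn hs hmu] at h1
    exact mul_left_cancel₀ ha (h1.trans (by ring))
  have h3 : form n s (toL2 n u) (toL2 n ρ) = form n s (toL2 n ρ) (toL2 n ρ) := by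
    rw [hu, map_add, map_smul, form_add_left hn hs hmb hρ hρ, form_smul_left, form_comm, h0, mul_zero,
      zero_add]
  have h4 : form n s (toL2 n u) (toL2 n u) = b * form n s (toL2 n u) (toL2 n h) +
      form n s (toL2 n u) (toL2 n ρ) := by
    conv_lhs => enter [4]; rw [hu, map_add, map_smul]
    rw [form_add_right hn hs hmu hmb hρ, form_smul_right]
  refine ⟨h2, ?_⟩
  rw [h4, h3, h1, h2]
  field_simp
  ring

/-- By invariance the orthogonality is tested after boosting by -w, where the tangent vectors become
affine functions. -/
lemma mem_tangentPerp (hn : 2 ≤ n) (hs : s - (n : ℝ) / 2 ∈ Set.Ioo (0 : ℝ) 1) {ρ : C(Sph n, ℝ)}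
    (hρ : MemHs n s (toL2 n ρ)) {b : ℝ} (hb : 0 < b) {w : Amb n}
    (h0 : ∫ x, twist (s - n / 2) (-w) ρ x ∂(surf n) = 0)
    (h1 : ∀ B : Amb n, ∫ x, twist (s - n / 2) (-w) ρ x * ⟪B, (x : Amb n)⟫ ∂(surf n) = 0) :
    ρ ∈ tangentPerp n s (b • twist (s - n / 2) w 1) := by
  refine ⟨hρ, fun φ hφ => ?_⟩
  obtain ⟨A, B, rfl⟩ := exists_affineC_of_mem_tangent hs.1.ne' hb hφ
  have hρ' := memHs_twist hn hs hρ (-w)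
  have h := form_twist hn hs hρ' (memHs_affineC hn A B) w
  rw [twist_twist_neg] at h
  rw [h, form_affineC hn hs hρ', h0, h1, mul_zero, mul_zero, add_zero]

/-- The modified distance is attained at the minimum of the mass. -/
lemma dist2_eq (hn : 2 ≤ n) (hs : s - (n : ℝ) / 2 ∈ Set.Ioo (0 : ℝ) 1) {u : C(Sph n, ℝ)}
    (hu : MemHs n s (toL2 n u)) {w : Amb n} (h0 : 0 < boostMass (s - n / 2) u w)
    (hw : ∀ w', boostMass (s - n / 2) u w ≤ boostMass (s - n / 2) u w') :
    dist2 n s u = form n s (toL2 n u) (toL2 n u) -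
      alpha n s 0 * boostMass (s - n / 2) u w ^ 2 / (surf n).real Set.univ := by
  have hS := surf_real_univ_pos (n := n)
  refine IsLeast.csInf_eq ⟨?_, ?_⟩
  -- b is the mean of u boosted by -w, so the boosted remainder has mean zero; its center of mass
  -- vanishes by minimality of w.
  · set b : ℝ := boostMass (s - n / 2) u w / (surf n).real Set.univ with hbdef
    have hb : 0 < b := div_pos h0 hS
    set h : C(Sph n, ℝ) := b • twist (s - n / 2) w 1 with hh
    have hmh : MemHs n s (toL2 n h) := by
      rw [hh, map_smul]
      exact (memHs_twist hn hs (memHs_one hn) w).smul b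
    have hρ : MemHs n s (toL2 n (u - h)) := by
      rw [map_sub]
      exact hu.sub hn hmh
    have ht : ∀ x, twist (s - n / 2) (-w) (u - h) x = twist (s - n / 2) (-w) u x - b := fun x => by
      rw [map_sub, hh, map_smul, twist_neg_twist]
      simp
    have hperp : u - h ∈ tangentPerp n s h := by
      refine mem_tangentPerp hn hs hρ hb ?_ fun B => ?_
      · simp only [ht]
        rw [integral_sub (integrable_surf _) (integrable_const _), integral_const, smul_eq_mul]
        change boostMass _ _ _ - _ = 0
        rw [hbdef, mul_div_cancel₀ _ hS.ne', sub_self]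
      · simp only [ht, sub_mul]
        have h1 := integral_sub (integrable_surf (twist (s - n / 2) (-w) u * affineC 0 B))
          ((integrable_surf (affineC 0 B)).const_mul b)
        simp only [ContinuousMap.mul_apply, affineC_apply, zero_add] at h1
        rw [h1, integral_const_mul, integral_inner_eq_zero, mul_zero, sub_zero]
        exact integral_twist_mul_inner_eq_zero hs.1 hw B
    have hopt : h ∈ optimizers n s := mem_optimizers.2 ⟨b, w, hb, rfl⟩
    refine ⟨h, u - h, hopt, hperp, by abel, ?_⟩
    exact (form_of_eq_add hn hs hb.ne' hρ (hperp.2 h (self_mem_tangent hopt)) (by abel)).2.symm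
  -- Any other decomposition has a larger mass, and α(0) < 0 turns this into a larger a[ρ].
  · rintro d ⟨h, ρ, hh, hρ, hu', rfl⟩
    have h1 := hρ.2 h (self_mem_tangent hh)
    obtain ⟨b, w', hb, rfl⟩ := mem_optimizers.1 hh
    rw [(form_of_eq_add hn hs hb.ne' hρ.1 h1 hu').2]
    have h2 := hw w'
    have ha := alpha_zero_neg hn hs
    have h3 : boostMass (s - n / 2) u w ^ 2 ≤ boostMass (s - n / 2) u w' ^ 2 :=
      pow_le_pow_left₀ h0.le h2 2
    have h4 := mul_le_mul_of_nonpos_left h3 ha.le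
    have h5 := div_le_div_of_nonneg_right h4 hS.le
    linarith

end Distance

/-! ### The stability quotient of normalized functions -/

section Quotient

variable {n : ℕ} {s : ℝ}

/-- The composition of a positive continuous function with a power. -/
def rpowC (u : C(Sph n, ℝ)) (hu : ∀ x, 0 < u x) (q : ℝ) : C(Sph n, ℝ) :=
  ⟨fun x => u x ^ q, u.continuous.rpow_const fun x => Or.inl (hu x).ne'⟩

lemma twist_pos (e : ℝ) (w : Amb n) {u : C(Sph n, ℝ)} (hu : ∀ x, 0 < u x) (x : Sph n) :
    0 < twist e w u x := mul_pos (hu _) (Real.rpow_pos_of_pos (stretch_coe_pos w x) _)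

lemma qNorm_twist {e q : ℝ} (heq : e * q = -n) (w : Amb n) {u : C(Sph n, ℝ)} (hu : ∀ x, 0 < u x) :
    qNorm n q (twist e w u) = qNorm n q u := by
  rw [qNorm, qNorm]
  congr 1
  refine Eq.trans (integral_congr_ae (.of_forall fun x => ?_)) (integral_comp_sphBoost w (rpowC u hu q))
  have h := stretch_coe_pos w x
  simp only [twist_apply, rpowC, ContinuousMap.coe_mk, smul_eq_mul]
  rw [Real.mul_rpow (hu _).le (Real.rpow_nonneg h.le _), ← Real.rpow_mul h.le, heq, Real.rpow_neg h.le,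
    Real.rpow_natCast, inv_pow, mul_comm]

lemma qNorm_smul {q c : ℝ} (hq : q ≠ 0) (hc : 0 < c) {u : C(Sph n, ℝ)} (hu : ∀ x, 0 < u x) :
    qNorm n q (c • u) = c * qNorm n q u := by
  rw [qNorm, qNorm]
  have h : ∀ x, (c • u) x ^ q = c ^ q * u x ^ q := fun x => by
    rw [ContinuousMap.smul_apply, smul_eq_mul, Real.mul_rpow hc.le (hu x).le]
  simp only [h]
  rw [integral_const_mul, Real.mul_rpow (Real.rpow_nonneg hc.le _)
    (integral_nonneg fun x => Real.rpow_nonneg (hu x).le _), ← Real.rpow_mul hc.le,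
    mul_one_div_cancel hq, Real.rpow_one]

lemma qNorm_sq {q : ℝ} {u : C(Sph n, ℝ)} (hu : ∀ x, 0 < u x) :
    qNorm n q u ^ 2 = (∫ x, u x ^ q ∂(surf n)) ^ (2 / q) := by
  rw [qNorm, ← Real.rpow_natCast, ← Real.rpow_mul (integral_nonneg fun x => Real.rpow_nonneg (hu x).le _)]
  congr 1
  push_cast
  ring

/-- The duplication formula brings |𝕊^n| to the form in which it appears in the Sobolev constant. -/
lemma surf_real_univ_eq (hn : n ≠ 0) : (surf n).real Set.univ =
    (4 * Real.pi) ^ ((n : ℝ) / 2) * (Real.Gamma (n / 2) / Real.Gamma n) := by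
  have hn0 : (0 : ℝ) < n := by positivity
  have hG : 0 < Real.Gamma (((n : ℝ) + 1) / 2) := Real.Gamma_pos_of_pos (by positivity)
  have hGn : 0 < Real.Gamma (n : ℝ) := Real.Gamma_pos_of_pos hn0
  have hpi := Real.pi_pos
  have h1 : (surf n).real Set.univ = 2 * √Real.pi ^ (n + 1) / Real.Gamma (((n : ℝ) + 1) / 2) := by
    rw [surf, Measure.toSphere_real_apply_univ, measureReal_def, EuclideanSpace.volume_ball]
    simp only [finrank_euclideanSpace, Fintype.card_fin, ENNReal.ofReal_one, one_pow, one_mul]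
    have h2 : ((n + 1 : ℕ) : ℝ) / 2 ≠ 0 := by positivity
    have h3 : ((n + 1 : ℕ) : ℝ) / 2 = ((n : ℝ) + 1) / 2 := by push_cast; ring
    rw [Real.Gamma_add_one h2, h3, ENNReal.toReal_ofReal (by positivity)]
    field_simp
    push_cast
    ring
  have hdup := Real.Gamma_mul_Gamma_add_half ((n : ℝ) / 2)
  rw [show (n : ℝ) / 2 + 1 / 2 = ((n : ℝ) + 1) / 2 by ring, show 2 * ((n : ℝ) / 2) = n by ring] at hdup
  have h4 : (4 * Real.pi) ^ ((n : ℝ) / 2) = 2 ^ (n : ℝ) * √Real.pi ^ n := by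
    rw [Real.mul_rpow (by norm_num) hpi.le, show (4 : ℝ) = 2 ^ (2 : ℝ) by norm_num,
      ← Real.rpow_mul (by norm_num), show (2 : ℝ) * ((n : ℝ) / 2) = n by ring,
      show (n : ℝ) / 2 = (1 / 2) * n by ring, Real.rpow_mul hpi.le, ← Real.sqrt_eq_rpow, Real.rpow_natCast √Real.pi n]
  have h5 : (2 : ℝ) ^ (1 - (n : ℝ)) * 2 ^ (n : ℝ) = 2 := by
    rw [← Real.rpow_add (by norm_num)]
    simp
  rw [h1, h4, ← mul_div_assoc, div_eq_div_iff hG.ne' hGn.ne', pow_succ]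
  linear_combination (-(√Real.pi ^ n * √Real.pi * Real.Gamma n)) * h5 - 2 ^ (n : ℝ) * √Real.pi ^ n * hdup

/-- Expresses that constants give equality in the reverse Sobolev inequality. -/
lemma sobolevConst_mul (hn : n ≠ 0) :
    sobolevConst n s = alpha n s 0 * (surf n).real Set.univ ^ (2 * s / n) := by
  have hn0 : (0 : ℝ) < n := by positivity
  have hG : 0 < Real.Gamma ((n : ℝ) / 2) := Real.Gamma_pos_of_pos (by positivity)
  have hGn : 0 < Real.Gamma (n : ℝ) := Real.Gamma_pos_of_pos hn0
  have hpi := Real.pi_pos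
  rw [surf_real_univ_eq hn, Real.mul_rpow (by positivity) (by positivity),
    ← Real.rpow_mul (by positivity), sobolevConst, alpha]
  have h1 : (n : ℝ) / 2 * (2 * s / n) = s := by field_simp
  have h2 : ((n : ℝ) + 2 * s) / 2 = ((0 : ℕ) : ℝ) + n / 2 + s := by push_cast; ring
  have h3 : ((n : ℝ) - 2 * s) / 2 = ((0 : ℕ) : ℝ) + n / 2 - s := by push_cast; ring
  rw [h1, h2, h3]
  ring

lemma sobolevConst_mul_qNorm_sq (hn : n ≠ 0) (hs : s - (n : ℝ) / 2 ≠ 0) {u : C(Sph n, ℝ)} (hu : ∀ x, 0 < u x) :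
    sobolevConst n s * qNorm n (2 * n / ((n : ℝ) - 2 * s)) u ^ 2 =
      alpha n s 0 * (surf n).real Set.univ *
        ((∫ x, u x ^ (2 * n / ((n : ℝ) - 2 * s)) ∂(surf n)) / (surf n).real Set.univ) ^
          (2 / (2 * n / ((n : ℝ) - 2 * s))) := by
  have hS := surf_real_univ_pos (n := n)
  have hn0 : (0 : ℝ) < n := by positivity
  have hs' : (n : ℝ) - 2 * s ≠ 0 := fun h => hs (by linarith)
  rw [qNorm_sq hu, sobolevConst_mul hn, Real.div_rpow (integral_nonneg fun x => Real.rpow_nonneg (hu x).le _) hS.le]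
  have h1 : 2 * s / n = 1 - 2 / (2 * n / ((n : ℝ) - 2 * s)) := by field_simp; ring
  rw [h1, Real.rpow_sub hS, Real.rpow_one]
  ring

/-- The defect of a normalized function: the form without its constant component. -/
def gap (n : ℕ) (s : ℝ) (v : C(Sph n, ℝ)) : ℝ :=
  form n s (toL2 n v) (toL2 n v) - alpha n s 0 * (surf n).real Set.univ

/-- The normalization of a function: mean one and vanishing center of mass. -/
structure IsNormalized (v : C(Sph n, ℝ)) : Prop where
  integral_eq : ∫ x, v x ∂(surf n) = (surf n).real Set.univ
  integral_inner_eq : ∀ B : Amb n, ∫ x, v x * ⟪B, (x : Amb n)⟫ ∂(surf n) = 0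

lemma polyRestrict_eq_affineC {p : MvPolynomial (Fin (n + 1)) ℝ} (hp : p.IsHomogeneous 1) :
    ∃ B : Amb n, polyRestrict n p = affineC 0 B := by
  refine ⟨WithLp.toLp 2 fun i => MvPolynomial.coeff 0 (MvPolynomial.pderiv i p), ?_⟩
  have h := hp.sum_X_mul_pderiv
  rw [one_smul] at h
  ext x
  have h1 : ∀ i, MvPolynomial.pderiv i p = MvPolynomial.C (MvPolynomial.coeff 0 (MvPolynomial.pderiv i p)) :=
    fun i => eq_C_of_isHomogeneous_zero (by simpa using hp.pderiv (i := i))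
  have h2 := congrArg (MvPolynomial.eval fun i => (x : Amb n) i) h
  rw [polyRestrict_apply, ← h2]
  simp only [map_sum, map_mul, MvPolynomial.eval_X, affineC_apply, zero_add,
    PiLp.inner_apply, RCLike.inner_apply, conj_trivial]
  refine Finset.sum_congr rfl fun i _ => ?_
  conv_lhs => rw [h1 i, MvPolynomial.eval_C]

lemma IsNormalized.proj_one {v : C(Sph n, ℝ)} (hv : IsNormalized v) : proj n 1 (toL2 n v) = 0 := by
  refine Submodule.eq_starProjection_of_mem_of_inner_eq_zero (zero_mem _) fun g hg => ?_
  obtain ⟨p, hp, rfl⟩ := mem_sphHarm.1 hg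
  obtain ⟨B, hB⟩ := polyRestrict_eq_affineC (mem_harmonicPoly.1 hp).1
  rw [sub_zero, hB, inner_toL2]
  simpa using hv.integral_inner_eq B

lemma IsNormalized.norm_proj_zero_sq {v : C(Sph n, ℝ)} (hv : IsNormalized v) :
    ‖proj n 0 (toL2 n v)‖ ^ 2 = (surf n).real Set.univ := by
  have hS := (surf_real_univ_pos (n := n)).ne'
  rw [RevSobolev.norm_proj_zero_sq, hv.integral_eq]
  field_simp

/-- The degree 0 term is the subtracted constant and degree 1 vanishes with the center of mass. What
remains is positive, with spectrum bounded below by α(2). -/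
lemma IsNormalized.hasSum_gap (hn : 2 ≤ n) (hs : s - (n : ℝ) / 2 ∈ Set.Ioo (0 : ℝ) 1) {v : C(Sph n, ℝ)}
    (hv : IsNormalized v) (hm : MemHs n s (toL2 n v)) :
    HasSum (fun l => alpha n s (l + 2) * ‖proj n (l + 2) (toL2 n v)‖ ^ 2) (gap n s v) := by
  have h := hasSum_form hn hs hm
  have h1 := (hasSum_nat_add_iff' 2).2 h
  simpa [Finset.sum_range_succ, hv.norm_proj_zero_sq, hv.proj_one, gap] using h1

lemma IsNormalized.hasSum_norm_proj (hn : 2 ≤ n) {v : C(Sph n, ℝ)} (hv : IsNormalized v) :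
    HasSum (fun l => ‖proj n (l + 2) (toL2 n v)‖ ^ 2) (∫ x, (v x - 1) ^ 2 ∂(surf n)) := by
  have h1 := (hasSum_nat_add_iff' 2).2 (hasSum_norm_proj_sq hn (toL2 n v))
  have h2 : ∫ x, (v x - 1) ^ 2 ∂(surf n) = ‖toL2 n v‖ ^ 2 - (surf n).real Set.univ := by
    have h3 := integral_sub (integrable_surf (v * v)) ((integrable_surf v).const_mul 2)
    have h4 := integral_add ((integrable_surf (v * v)).sub ((integrable_surf v).const_mul 2))
      (integrable_const (1 : ℝ))
    simp only [ContinuousMap.mul_apply, Pi.sub_apply] at h3 h4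
    rw [h3, integral_const_mul, hv.integral_eq, integral_const, smul_eq_mul, mul_one] at h4
    rw [norm_toL2_sq]
    simp only [sq]
    refine Eq.trans (integral_congr_ae (.of_forall fun x => ?_)) (h4.trans ?_) <;> ring
  rw [h2]
  simpa [Finset.sum_range_succ, hv.norm_proj_zero_sq, hv.proj_one] using h1

lemma IsNormalized.alpha_two_mul_le_gap (hn : 2 ≤ n) (hs : s - (n : ℝ) / 2 ∈ Set.Ioo (0 : ℝ) 1)
    {v : C(Sph n, ℝ)} (hv : IsNormalized v) (hm : MemHs n s (toL2 n v)) :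
    alpha n s 2 * ∫ x, (v x - 1) ^ 2 ∂(surf n) ≤ gap n s v :=
  hasSum_le (fun l => mul_le_mul_of_nonneg_right (alpha_two_le hn hs l) (by positivity))
    ((hv.hasSum_norm_proj hn).mul_left _) (hv.hasSum_gap hn hs hm)

lemma integral_sq_pos {f : C(Sph n, ℝ)} (hf : f ≠ 0) : 0 < ∫ x, f x ^ 2 ∂(surf n) := by
  obtain ⟨x, hx⟩ : ∃ x, f x ≠ 0 := by
    by_contra! h
    exact hf (ContinuousMap.ext h)
  exact (f ^ 2).continuous.integral_pos_of_hasCompactSupport_nonneg_nonzero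
    (HasCompactSupport.of_compactSpace _) (fun z => sq_nonneg (f z)) (x := x) (by simpa using hx)

lemma IsNormalized.gap_pos (hn : 2 ≤ n) (hs : s - (n : ℝ) / 2 ∈ Set.Ioo (0 : ℝ) 1)
    {v : C(Sph n, ℝ)} (hv : IsNormalized v) (hm : MemHs n s (toL2 n v)) (h1 : v ≠ 1) :
    0 < gap n s v := by
  refine lt_of_lt_of_le ?_ (hv.alpha_two_mul_le_gap hn hs hm)
  exact mul_pos (alpha_succ_pos hs 1) (integral_sq_pos (f := v - 1) (sub_ne_zero.2 h1))

/-- The stability quotient of a function whose mass is minimal without boost. -/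
lemma quotient_eq_of_boost (hn : 2 ≤ n) (hs : s - (n : ℝ) / 2 ∈ Set.Ioo (0 : ℝ) 1) {u : C(Sph n, ℝ)}
    (hu0 : ∀ x, 0 < u x) (hu : MemHs n s (toL2 n u)) {w : Amb n} (h0 : 0 < boostMass (s - n / 2) u w)
    (hw : ∀ w', boostMass (s - n / 2) u w ≤ boostMass (s - n / 2) u w')
    {v : C(Sph n, ℝ)}
    (hv : v = ((surf n).real Set.univ / boostMass (s - n / 2) u w) • twist (s - n / 2) (-w) u) :
    IsNormalized v ∧ MemHs n s (toL2 n v) ∧ (∀ x, 0 < v x) ∧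
      quotient n s u = (gap n s v + alpha n s 0 * (surf n).real Set.univ * (1 -
        ((∫ x, v x ^ (2 * n / ((n : ℝ) - 2 * s)) ∂(surf n)) / (surf n).real Set.univ) ^
          (2 / (2 * n / ((n : ℝ) - 2 * s))))) / gap n s v := by
  have hS := surf_real_univ_pos (n := n)
  have hn0 : n ≠ 0 := by omega
  have hn1 : (0 : ℝ) < n := by positivity
  have hs' : (n : ℝ) - 2 * s ≠ 0 := fun h => hs.1.ne' (by linarith)
  set m := boostMass (s - n / 2) u w with hm
  have hc : 0 < (surf n).real Set.univ / m := div_pos hS h0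
  set c := (surf n).real Set.univ / m with hcdef
  have ht0 := twist_pos (s - n / 2) (-w) hu0
  have htm := memHs_twist hn hs hu (-w)
  have hv0 : ∀ x, 0 < v x := fun x => by rw [hv]; exact mul_pos hc (ht0 x)
  have hvx : ∀ x, v x = c * twist (s - n / 2) (-w) u x := fun x => by rw [hv]; rfl
  have hform : form n s (toL2 n v) (toL2 n v) = c ^ 2 * form n s (toL2 n u) (toL2 n u) := by
    rw [hv, map_smul, form_smul_left, form_smul_right, form_twist_self hn hs hu]
    ring
  have hnorm : IsNormalized v := by
    refine ⟨?_, fun B => ?_⟩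
    · simp only [hvx]
      rw [integral_const_mul]
      exact div_mul_cancel₀ _ h0.ne'
    · simp only [hvx, mul_assoc]
      rw [integral_const_mul, integral_twist_mul_inner_eq_zero hs.1 hw B, mul_zero]
  refine ⟨hnorm, ?_, hv0, ?_⟩
  · rw [hv, map_smul]
    exact htm.smul c
  · have h1 := sobolevConst_mul_qNorm_sq hn0 hs.1.ne' hv0
    have hq : 2 * n / ((n : ℝ) - 2 * s) ≠ 0 := div_ne_zero (by positivity) hs'
    have h2 : qNorm n (2 * n / ((n : ℝ) - 2 * s)) v = c * qNorm n (2 * n / ((n : ℝ) - 2 * s)) u := by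
      rw [hv, qNorm_smul hq hc ht0, qNorm_twist _ _ hu0]
      rw [mul_div_assoc', div_eq_iff hs']
      ring
    -- c times the minimal mass is |S|, so the subtracted constants α(0)|S| and α(0)·mass²/|S|
    -- differ exactly by the factor c².
    have h3 : gap n s v = c ^ 2 * dist2 n s u := by
      rw [dist2_eq hn hs hu h0 hw, gap, hform, ← hm, hcdef]
      field_simp
    rw [quotient, h3, mul_sub, ← h1, mul_one, h2,
      ← mul_div_mul_left _ (dist2 n s u) (pow_pos hc 2).ne', ← h3, gap, hform]
    congr 1
    ring

end Quotient

/-! ### Taylor bounds for real powers -/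

section Taylor

/-- Bernoulli's inequality for nonpositive exponents, from 1 + y ≤ e^y and log(1+t) ≤ t. -/
lemma one_add_mul_le_rpow {p t : ℝ} (hp : p ≤ 0) (ht : -1 < t) : 1 + p * t ≤ (1 + t) ^ p := by
  have h0 : 0 < 1 + t := by linarith
  rw [Real.rpow_def_of_pos h0]
  have h1 := Real.add_one_le_exp (Real.log (1 + t) * p)
  have h2 := Real.log_le_sub_one_of_pos h0
  nlinarith

/-- Applying the mean value theorem to θ ↦ g(θt) on [0,1] treats both signs of t at once. -/
lemma exists_mean_value {g g' : ℝ → ℝ} {a b : ℝ} (ha : a < 0) (hb : 0 < b)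
    (hg : ∀ t ∈ Set.Ioo a b, HasDerivAt g (g' t) t) (h0 : g 0 = 0) {t : ℝ} (ht : t ∈ Set.Ioo a b) :
    ∃ θ ∈ Set.Icc (0 : ℝ) 1, θ * t ∈ Set.Ioo a b ∧ g t = g' (θ * t) * t := by
  have hmem : ∀ θ ∈ Set.Icc (0 : ℝ) 1, θ * t ∈ Set.Ioo a b :=
    fun θ hθ => (convex_Ioo a b).smul_mem_of_zero_mem ⟨ha, hb⟩ ht hθ
  have hd : ∀ θ ∈ Set.Icc (0 : ℝ) 1, HasDerivAt (fun θ => g (θ * t)) (g' (θ * t) * t) θ := by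
    intro θ hθ
    exact ((hg _ (hmem θ hθ)).comp θ ((hasDerivAt_id θ).mul_const t)).congr_deriv (by simp)
  obtain ⟨c, hc, h⟩ := exists_hasDerivAt_eq_slope (fun θ => g (θ * t)) (fun θ => g' (θ * t) * t)
    zero_lt_one (fun θ hθ => (hd θ hθ).continuousAt.continuousWithinAt)
    (fun θ hθ => hd θ (Set.Ioo_subset_Icc_self hθ))
  refine ⟨c, Set.Ioo_subset_Icc_self hc, hmem c (Set.Ioo_subset_Icc_self hc), ?_⟩
  simpa [h0] using h.symm

lemma hasDerivAt_one_add_rpow (p : ℝ) {t : ℝ} (ht : -1 < t) :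
    HasDerivAt (fun t : ℝ => (1 + t) ^ p) (p * (1 + t) ^ (p - 1)) t := by
  have := ((hasDerivAt_id t).const_add 1).rpow_const (p := p) (Or.inl (by simp; linarith))
  simpa using this

lemma nonneg_of_hasDerivAt {g g' g'' : ℝ → ℝ} {a b : ℝ} (ha : a < 0) (hb : 0 < b)
    (hg : ∀ t ∈ Set.Ioo a b, HasDerivAt g (g' t) t) (hg' : ∀ t ∈ Set.Ioo a b, HasDerivAt g' (g'' t) t)
    (h0 : g 0 = 0) (h0' : g' 0 = 0) (h : ∀ t ∈ Set.Ioo a b, 0 ≤ g'' t) {t : ℝ} (ht : t ∈ Set.Ioo a b) :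
    0 ≤ g t := by
  obtain ⟨θ, hθ, hm, h1⟩ := exists_mean_value ha hb hg h0 ht
  obtain ⟨θ', hθ', hm', h2⟩ := exists_mean_value ha hb hg' h0' hm
  rw [h1, h2]
  have := h _ hm'
  have h3 : g'' (θ' * (θ * t)) * (θ * t) * t = g'' (θ' * (θ * t)) * θ * t ^ 2 := by ring
  rw [h3]
  have := hθ.1
  positivity

/-- A quadratic upper bound for a negative power near one. -/
lemma exists_one_add_rpow_le {q δ : ℝ} (hq : q < 0) (hδ : 0 < δ) :
    ∃ η : ℝ, 0 < η ∧ η < 1 ∧ ∀ t, |t| < η → (1 + t) ^ q ≤ 1 + q * t + q * (q - 1) / 2 * (1 + δ) * t ^ 2 := by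
  have hc : ContinuousAt (fun t : ℝ => (1 + t) ^ (q - 2)) 0 :=
    (continuousAt_const.add continuousAt_id).rpow_const (Or.inl (by simp))
  have h1 : ∀ᶠ t in 𝓝 (0 : ℝ), (1 + t) ^ (q - 2) < 1 + δ :=
    hc.eventually_lt_const (by simpa using hδ)
  obtain ⟨η, hη, h⟩ := Metric.eventually_nhds_iff.1 h1
  refine ⟨min η (1 / 2), by positivity, (min_le_right _ _).trans_lt (by norm_num), fun t ht => ?_⟩
  have hη0 : 0 < min η (1 / 2) := by positivity
  have hlt : ∀ t ∈ Set.Ioo (-min η (1 / 2)) (min η (1 / 2)), -1 < t := fun t ht => by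
    have := min_le_right η (1 / 2)
    linarith [ht.1]
  have := nonneg_of_hasDerivAt (a := -min η (1 / 2)) (b := min η (1 / 2))
    (g := fun t => 1 + q * t + q * (q - 1) / 2 * (1 + δ) * t ^ 2 - (1 + t) ^ q)
    (g' := fun t => q + q * (q - 1) * (1 + δ) * t - q * (1 + t) ^ (q - 1))
    (g'' := fun t => q * (q - 1) * (1 + δ) - q * ((q - 1) * (1 + t) ^ (q - 1 - 1)))
    (by linarith) hη0 (fun t ht => ?_) (fun t ht => ?_) (by simp) (by simp) (fun t ht => ?_) (abs_lt.1 ht)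
  · linarith
  · have h2 := ((((hasDerivAt_id t).const_mul q).const_add 1).add
      (((hasDerivAt_id t).pow 2).const_mul (q * (q - 1) / 2 * (1 + δ)))).sub (hasDerivAt_one_add_rpow q (hlt t ht))
    refine h2.congr_deriv ?_
    simp
    ring
  · have h2 := (((hasDerivAt_id t).const_mul (q * (q - 1) * (1 + δ))).const_add q).sub
      ((hasDerivAt_one_add_rpow (q - 1) (hlt t ht)).const_mul q)
    refine h2.congr_deriv ?_
    simp
  · have h2 : |t| < min η (1 / 2) := abs_lt.2 ht
    have h3 := h (y := t) (by rw [Real.dist_eq, sub_zero]; exact h2.trans_le (min_le_left _ _))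
    rw [show q - 1 - 1 = q - 2 by ring]
    have h4 : 0 < q * (q - 1) := mul_pos_of_neg_of_neg hq (by linarith)
    nlinarith

/-- The cubic Taylor polynomial is a lower bound for a negative power. -/
lemma cubic_le_one_add_rpow {q t : ℝ} (hq : q < 0) (ht : -1 < t) :
    1 + q * t + q * (q - 1) / 2 * t ^ 2 + q * (q - 1) * (q - 2) / 6 * t ^ 3 ≤ (1 + t) ^ q := by
  have := nonneg_of_hasDerivAt (a := -1) (b := |t| + 1)
    (g := fun t => (1 + t) ^ q -
      (1 + q * t + q * (q - 1) / 2 * t ^ 2 + q * (q - 1) * (q - 2) / 6 * t ^ 3))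
    (g' := fun t => q * (1 + t) ^ (q - 1) -
      (q + q * (q - 1) * t + q * (q - 1) * (q - 2) / 2 * t ^ 2))
    (g'' := fun t => q * ((q - 1) * (1 + t) ^ (q - 1 - 1)) -
      (q * (q - 1) + q * (q - 1) * (q - 2) * t))
    (by norm_num) (by positivity) (fun t ht => ?_) (fun t ht => ?_) (by simp) (by simp) (fun t ht => ?_)
    (t := t) ⟨ht, by linarith [le_abs_self t]⟩
  · linarith
  · have h2 := (hasDerivAt_one_add_rpow q ht.1).sub
      (((((hasDerivAt_id t).const_mul q).const_add 1).add
      (((hasDerivAt_id t).pow 2).const_mul (q * (q - 1) / 2))).add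
      (((hasDerivAt_id t).pow 3).const_mul (q * (q - 1) * (q - 2) / 6)))
    refine h2.congr_deriv ?_
    simp
    ring
  · have h2 := ((hasDerivAt_one_add_rpow (q - 1) ht.1).const_mul q).sub
      ((((hasDerivAt_id t).const_mul (q * (q - 1))).const_add q).add
      (((hasDerivAt_id t).pow 2).const_mul (q * (q - 1) * (q - 2) / 2)))
    refine h2.congr_deriv ?_
    simp
    ring
  · have h3 := one_add_mul_le_rpow (p := q - 2) (by linarith) ht.1
    rw [show q - 1 - 1 = q - 2 by ring]
    have h4 : 0 < q * (q - 1) := mul_pos_of_neg_of_neg hq (by linarith)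
    nlinarith

/-- The quadratic Taylor polynomial is an upper bound for a negative power on `[1, ∞)`. -/
lemma one_add_rpow_le_quadratic {r z : ℝ} (hr : r < 0) (hz : 0 ≤ z) :
    (1 + z) ^ r ≤ 1 + r * z + r * (r - 1) / 2 * z ^ 2 := by
  obtain ⟨θ, hθ, hm, h⟩ := exists_mean_value (a := -1) (b := z + 1) (t := z)
    (g := fun z => 1 + r * z + r * (r - 1) / 2 * z ^ 2 - (1 + z) ^ r)
    (g' := fun z => r + r * (r - 1) * z - r * (1 + z) ^ (r - 1))
    (by norm_num) (by positivity) (fun t ht => by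
      have h2 := ((((hasDerivAt_id t).const_mul r).const_add 1).add
        (((hasDerivAt_id t).pow 2).const_mul (r * (r - 1) / 2))).sub (hasDerivAt_one_add_rpow r ht.1)
      refine h2.congr_deriv ?_
      simp
      ring) (by simp) ⟨by linarith, by linarith⟩
  have h3 := one_add_mul_le_rpow (p := r - 1) (by linarith) hm.1
  have h4 : 0 ≤ r + r * (r - 1) * (θ * z) - r * (1 + θ * z) ^ (r - 1) := by nlinarith
  have h5 := mul_nonneg h4 hz
  linarith

end Taylor

/-! ### The quotient near the constant function and rigidity of normalized optimizers -/

section Deficit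

variable {n : ℕ} {s : ℝ}

/-- The numerator of the stability quotient of a normalized function, with exponent `q`. -/
def deficit (n : ℕ) (s q : ℝ) (v : C(Sph n, ℝ)) : ℝ :=
  gap n s v + alpha n s 0 * (surf n).real Set.univ *
    (1 - ((∫ x, v x ^ q ∂(surf n)) / (surf n).real Set.univ) ^ (2 / q))

lemma critExponent_neg (hn : 2 ≤ n) (hs : s - (n : ℝ) / 2 ∈ Set.Ioo (0 : ℝ) 1) :
    2 * n / ((n : ℝ) - 2 * s) < 0 := by
  have hn0 : (0 : ℝ) < n := by positivity
  have := hs.1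
  exact div_neg_of_pos_of_neg (by positivity) (by linarith)

/-- The factor q - 1 from the second variation of the q-norm thus turns α(0) into α(1). -/
lemma alpha_one_eq (hs : s - (n : ℝ) / 2 ∈ Set.Ioo (0 : ℝ) 1) :
    alpha n s 1 = alpha n s 0 * (2 * n / ((n : ℝ) - 2 * s) - 1) := by
  have h := alpha_succ hs 0
  have h0 := hs.1
  have h1 : (n : ℝ) - 2 * s ≠ 0 := by intro h; linarith
  simp only [Nat.cast_zero, zero_sub, zero_add] at h
  have h2 : alpha n s 1 * ((n : ℝ) - 2 * s) = alpha n s 0 * (n + 2 * s) := by linarith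
  rw [div_sub_one h1, mul_div_assoc', eq_div_iff h1, h2]
  ring

lemma integral_rpow_pos {v : C(Sph n, ℝ)} (hv : ∀ x, 0 < v x) (q : ℝ) :
    0 < ∫ x, v x ^ q ∂(surf n) := by
  have x₀ : Sph n := ⟨EuclideanSpace.single 0 1, by simp⟩
  exact (rpowC v hv q).continuous.integral_pos_of_hasCompactSupport_nonneg_nonzero
    (HasCompactSupport.of_compactSpace _) (fun z => (Real.rpow_pos_of_pos (hv z) q).le) (x := x₀)
    (Real.rpow_pos_of_pos (hv x₀) q).ne'

lemma IsNormalized.integral_sub_one {v : C(Sph n, ℝ)} (hv : IsNormalized v) :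
    ∫ x, (v x - 1) ∂(surf n) = 0 := by
  rw [integral_sub (integrable_surf v) (integrable_const _), hv.integral_eq]
  simp [-Measure.toSphere_real_apply_univ]

/-- Expand v^q around 1: the linear term integrates to zero and the quadratic one contributes
-(1+δ)α(1)‖v-1‖₂², which the spectral gap α(2) compares with `gap`. -/
lemma exists_le_deficit (hn : 2 ≤ n) (hs : s - (n : ℝ) / 2 ∈ Set.Ioo (0 : ℝ) 1) {q : ℝ} (hq : q < 0)
    (hq1 : alpha n s 1 = alpha n s 0 * (q - 1)) {δ : ℝ} (hδ : 0 < δ) :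
    ∃ η : ℝ, 0 < η ∧ ∀ v : C(Sph n, ℝ), IsNormalized v → MemHs n s (toL2 n v) → (∀ x, 0 < v x) →
      (∀ x, |v x - 1| < η) →
      (1 - (1 + δ) * (alpha n s 1 / alpha n s 2)) * gap n s v ≤ deficit n s q v := by
  obtain ⟨η, hη, -, hT⟩ := exists_one_add_rpow_le hq hδ
  refine ⟨η, hη, fun v hv hm hv0 hvη => ?_⟩
  have hS := surf_real_univ_pos (n := n)
  set S := (surf n).real Set.univ with hSdef
  set A := q * (q - 1) / 2 * (1 + δ) with hA
  set J := ∫ x, (v x - 1) ^ 2 ∂(surf n) with hJ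
  have hi1 := integrable_surf (v - 1)
  have hi2 := integrable_surf ((v - 1) ^ 2)
  have h1 : ∫ x, v x ^ q ∂(surf n) ≤ S + A * J := by
    have h2 : ∫ x, v x ^ q ∂(surf n) ≤ ∫ x, (1 + q * (v - 1) x + A * ((v - 1) ^ 2 : C(Sph n, ℝ)) x) ∂(surf n) := by
      refine integral_mono (integrable_surf (rpowC v hv0 q))
        (((integrable_const 1).add (hi1.const_mul q)).add (hi2.const_mul A)) fun x => ?_
      have := hT _ (hvη x)
      rw [add_sub_cancel] at this
      simpa using this
    have h3 := integral_add ((integrable_const (1 : ℝ)).add (hi1.const_mul q)) (hi2.const_mul A)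
    have h4 := integral_add (integrable_const (1 : ℝ)) (hi1.const_mul q)
    simp only [Pi.add_apply] at h3 h4
    rw [h4, integral_const_mul, integral_const_mul] at h3
    refine h2.trans_eq (h3.trans ?_)
    have h5 := hv.integral_sub_one
    simp only [ContinuousMap.sub_apply, ContinuousMap.one_apply, ContinuousMap.pow_apply, h5,
      integral_const, smul_eq_mul]
    ring
  have hM0 : 0 < (∫ x, v x ^ q ∂(surf n)) / S := div_pos (integral_rpow_pos hv0 q) hS
  have hM : (∫ x, v x ^ q ∂(surf n)) / S - 1 ≤ A * J / S := by
    rw [sub_le_iff_le_add, div_le_iff₀ hS]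
    refine h1.trans_eq ?_
    field_simp
    ring
  have h2 := one_add_mul_le_rpow (p := 2 / q) (t := (∫ x, v x ^ q ∂(surf n)) / S - 1)
    (div_nonpos_of_nonneg_of_nonpos (by norm_num) hq.le) (by linarith)
  rw [add_sub_cancel] at h2
  have h3 : 2 / q * (A * J / S) ≤ 2 / q * ((∫ x, v x ^ q ∂(surf n)) / S - 1) :=
    mul_le_mul_of_nonpos_left hM (div_nonpos_of_nonneg_of_nonpos (by norm_num) hq.le)
  have h4 : 2 / q * (A * J / S) = (q - 1) * (1 + δ) * J / S := by
    have hq' := hq.ne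
    rw [hA]
    field_simp
  have ha := alpha_zero_neg hn hs
  have h5 : 1 - ((∫ x, v x ^ q ∂(surf n)) / S) ^ (2 / q) ≤ -((q - 1) * (1 + δ) * J / S) := by linarith
  have h6 := mul_le_mul_of_nonpos_left h5 (mul_neg_of_neg_of_pos ha hS).le
  have h7 : alpha n s 0 * S * -((q - 1) * (1 + δ) * J / S) = -(alpha n s 1 * (1 + δ) * J) := by
    rw [hq1]
    field_simp
  have h8 := hv.alpha_two_mul_le_gap hn hs hm
  have ha1 := alpha_succ_pos hs 0
  have ha2 := alpha_succ_pos hs 1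
  simp only [zero_add, Nat.reduceAdd] at ha1 ha2
  have h9 : alpha n s 1 * (1 + δ) * J ≤ (1 + δ) * (alpha n s 1 / alpha n s 2) * gap n s v := by
    have : alpha n s 1 * (1 + δ) * J = (1 + δ) * (alpha n s 1 / alpha n s 2) * (alpha n s 2 * J) := by
      field_simp
    rw [this]
    exact mul_le_mul_of_nonneg_left h8 (by positivity)
  rw [deficit]
  linarith

/-- A normalized optimizer is constant. -/
lemma IsNormalized.eq_one_of_mem_optimizers (hs : 0 < s - (n : ℝ) / 2) {v : C(Sph n, ℝ)}
    (hv : IsNormalized v) (h : v ∈ optimizers n s) : v = 1 := by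
  obtain ⟨b, w, hb, rfl⟩ := mem_optimizers.1 h
  have hS := surf_real_univ_pos (n := n)
  have hw : w = 0 := by
    by_contra hw
    obtain ⟨a, ha⟩ := exists_eq_norm_smul_sph w
    have hw0 : 0 < ‖w‖ := norm_pos_iff.2 hw
    set σ := s - (n : ℝ) / 2 with hσ
    -- As ⟪w,x⟫ = stretch - λ with λ = `lorentz w`, both factors have the same sign by monotonicity
    -- of the power σ; so f ≥ 0, and f > 0 at w/|w|. A vanishing center of mass would give ∫ f = 0.
    set f : C(Sph n, ℝ) := (twist σ w 1 - lorentz w ^ σ • 1) * affineC 0 w with hf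
    have hfx : ∀ x, f x = (stretch w x ^ σ - lorentz w ^ σ) * (stretch w x - lorentz w) := fun x => by
      simp [hf, stretch]
    have h1 : ∫ x, f x ∂(surf n) = 0 := by
      have h2 := hv.integral_inner_eq w
      simp only [ContinuousMap.smul_apply, smul_eq_mul, mul_assoc] at h2
      rw [integral_const_mul] at h2
      have h3 := (mul_eq_zero.1 h2).resolve_left hb.ne'
      have h4 := integral_sub (integrable_surf (twist σ w 1 * affineC 0 w))
        ((integrable_surf (affineC 0 w)).const_mul (lorentz w ^ σ))
      simp only [ContinuousMap.mul_apply, affineC_apply, zero_add] at h4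
      rw [h3, integral_const_mul, integral_inner_eq_zero, mul_zero, sub_zero] at h4
      refine Eq.trans (integral_congr_ae (.of_forall fun x => ?_)) h4
      simp [hf]
      ring
    have hnn : ∀ x, 0 ≤ f x := fun x => by
      rw [hfx]
      have hx := (stretch_coe_pos w x).le
      have hl := (lorentz_pos w).le
      rcases le_total (stretch w (x : Amb n)) (lorentz w) with h | h
      · exact mul_nonneg_of_nonpos_of_nonpos (sub_nonpos.2 (Real.rpow_le_rpow hx h hs.le)) (sub_nonpos.2 h)
      · exact mul_nonneg (sub_nonneg.2 (Real.rpow_le_rpow hl h hs.le)) (sub_nonneg.2 h)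
    have hpos : 0 < f a := by
      have h2 : lorentz w < stretch w a := by
        rw [stretch, lt_add_iff_pos_right]
        conv_rhs => rw [ha]
        rw [real_inner_smul_left]
        simpa using hw
      rw [hfx]
      exact mul_pos (sub_pos.2 (Real.rpow_lt_rpow (lorentz_pos w).le h2 hs)) (sub_pos.2 h2)
    have := f.continuous.integral_pos_of_hasCompactSupport_nonneg_nonzero (μ := surf n)
      (HasCompactSupport.of_compactSpace _) hnn hpos.ne'
    exact this.ne' h1
  subst hw
  have h1 := hv.integral_eq
  rw [twist_zero] at h1 ⊢
  simp only [ContinuousMap.smul_apply, ContinuousMap.one_apply, smul_eq_mul, mul_one, integral_const] at h1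
  have : b = 1 := mul_left_cancel₀ hS.ne' (by rw [h1, mul_one])
  rw [this, one_smul]

end Deficit

/-! ### The strict bound for the best constant -/

section StrictBound

variable {n : ℕ} {s : ℝ}

lemma boostMass_add (e : ℝ) (u v : C(Sph n, ℝ)) (w : Amb n) :
    boostMass e (u + v) w = boostMass e u w + boostMass e v w := by
  simp only [boostMass, map_add, ContinuousMap.add_apply]
  exact integral_add (integrable_surf _) (integrable_surf _)

/-- A centered f does not see affine functions, so the weight stretch^p may be replaced by its
excess k over the tangent line at λ = `lorentz w`. By convexity k ≥ 0, and the integral of k is the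
bracket on the right. -/
lemma abs_boostMass_le {e : ℝ} (he : 0 < e) {f : C(Sph n, ℝ)} (h0 : ∫ x, f x ∂(surf n) = 0)
    (h1 : ∀ B : Amb n, ∫ x, f x * ⟪B, (x : Amb n)⟫ ∂(surf n) = 0) (w : Amb n) :
    |boostMass e f w| ≤
      ‖f‖ * (boostMass e 1 w - lorentz w ^ (-((n : ℝ) + e)) * (surf n).real Set.univ) := by
  set p : ℝ := -((n : ℝ) + e) with hp
  have hp0 : p ≤ 0 := by
    have : (0 : ℝ) ≤ n := n.cast_nonneg
    rw [hp]; linarith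
  set g := lorentz w with hg
  have hg0 : 0 < g := lorentz_pos w
  set a : C(Sph n, ℝ) := ⟨_, continuous_stretch_rpow p w⟩ with ha
  set k : C(Sph n, ℝ) := a - g ^ p • 1 - (p * g ^ (p - 1)) • affineC 0 w with hk
  have hkx : ∀ x, k x = stretch w x ^ p - g ^ p - p * g ^ (p - 1) * ⟪w, (x : Amb n)⟫ := fun x => by
    simp [hk, ha]
  have hk0 : ∀ x, 0 ≤ k x := fun x => by
    have hx := stretch_coe_pos w x
    have h2 : stretch w (x : Amb n) = g * (1 + ⟪w, (x : Amb n)⟫ / g) := by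
      rw [stretch, ← hg]
      field_simp
    rw [hkx, h2, Real.rpow_sub_one hg0.ne']
    rw [h2] at hx
    have h3 := pos_of_mul_pos_right hx hg0.le
    have h4 := one_add_mul_le_rpow hp0 (t := ⟪w, (x : Amb n)⟫ / g) (by linarith)
    rw [Real.mul_rpow hg0.le h3.le]
    have h5 := mul_le_mul_of_nonneg_left h4 (Real.rpow_pos_of_pos hg0 p).le
    have h6 : g ^ p * (1 + p * (⟪w, (x : Amb n)⟫ / g)) =
        g ^ p + p * (g ^ p / g) * ⟪w, (x : Amb n)⟫ := by ring
    linarith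
  have hint : ∀ u : C(Sph n, ℝ), ∫ x, k x * u x ∂(surf n) = boostMass e u w -
      g ^ p * ∫ x, u x ∂(surf n) - p * g ^ (p - 1) * ∫ x, u x * ⟪w, (x : Amb n)⟫ ∂(surf n) := fun u => by
    have i1 := integral_sub ((integrable_surf (a * u)).sub ((integrable_surf u).const_mul (g ^ p)))
      ((integrable_surf (u * affineC 0 w)).const_mul (p * g ^ (p - 1)))
    have i2 := integral_sub (integrable_surf (a * u)) ((integrable_surf u).const_mul (g ^ p))
    simp only [Pi.sub_apply] at i1 i2
    rw [i2, integral_const_mul, integral_const_mul] at i1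
    simp only [ContinuousMap.mul_apply, affineC_apply, zero_add] at i1
    rw [boostMass_eq, ← hp]
    refine Eq.trans (integral_congr_ae (.of_forall fun x => ?_)) i1
    simp only [hkx, ha, ContinuousMap.coe_mk]
    ring
  have hf := hint f
  rw [h0, h1, mul_zero, mul_zero, sub_zero, sub_zero] at hf
  have h2 := hint 1
  simp only [ContinuousMap.one_apply, mul_one, one_mul, integral_inner_eq_zero, integral_const,
    smul_eq_mul, mul_zero, sub_zero] at h2
  rw [← hf, ← h2, ← integral_const_mul, ← Real.norm_eq_abs]
  refine norm_integral_le_of_norm_le ((integrable_surf k).const_mul _) (.of_forall fun x => ?_)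
  rw [Real.norm_eq_abs, abs_mul, abs_of_nonneg (hk0 x), mul_comm]
  exact mul_le_mul_of_nonneg_right (abs_le_norm f x) (hk0 x)

/-- With λ = `lorentz w`, Bernoulli bounds 1 - λ^{-(n+e)} by a multiple of λ^e - 1, and the latter
is controlled by the growth of the mass of the constant 1. -/
lemma boostMass_one_sub_le (hn : n ≠ 0) {e : ℝ} (he : e ∈ Set.Ioo (0 : ℝ) 1) (w : Amb n) :
    boostMass e 1 w - lorentz w ^ (-((n : ℝ) + e)) * (surf n).real Set.univ ≤
      (1 + (n + e) / e * ((n + 1) / n)) * (boostMass e 1 w - (surf n).real Set.univ) := by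
  have hn0 : (0 : ℝ) < n := by positivity
  have he0 := he.1
  have hS := surf_real_univ_pos (n := n)
  set S := (surf n).real Set.univ
  have hg0 := lorentz_pos w
  have h1 := boostMass_one_ge he w
  set G := lorentz w ^ e with hG
  have hG1 : 1 ≤ G := Real.one_le_rpow (one_le_lorentz w) he0.le
  have h2 := one_add_mul_le_rpow (p := -((n : ℝ) + e) / e) (t := G - 1)
    (div_nonpos_of_nonpos_of_nonneg (by linarith) he0.le) (by linarith)
  rw [add_sub_cancel, hG, ← Real.rpow_mul hg0.le, mul_div_cancel₀ _ he0.ne', ← hG] at h2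
  have h3 := mul_le_mul_of_nonneg_right h2 hS.le
  have h4 : S * (n / (n + 1) * (G - 1)) ≤ boostMass e 1 w - S := by linarith
  have h5 := mul_le_mul_of_nonneg_left h4 (by positivity : 0 ≤ ((n : ℝ) + e) / e * ((n + 1) / n))
  have h6 : ((n : ℝ) + e) / e * ((n + 1) / n) * (S * (n / (n + 1) * (G - 1))) =
      (n + e) / e * S * (G - 1) := by field_simp
  have h7 : (1 + -((n : ℝ) + e) / e * (G - 1)) * S = S - (n + e) / e * S * (G - 1) := by ring
  linarith

/-- Small centered perturbations of the constant function have minimal mass without boost. -/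
lemma boostMass_zero_le (hn : n ≠ 0) {e : ℝ} (he : e ∈ Set.Ioo (0 : ℝ) 1) {f : C(Sph n, ℝ)}
    (h0 : ∫ x, f x ∂(surf n) = 0)
    (h1 : ∀ B : Amb n, ∫ x, f x * ⟪B, (x : Amb n)⟫ ∂(surf n) = 0)
    (hf : ‖f‖ * (1 + (n + e) / e * ((n + 1) / n)) ≤ 1) (w : Amb n) :
    boostMass e (1 + f) 0 ≤ boostMass e (1 + f) w := by
  rw [boostMass_add, boostMass_add, boostMass_zero, boostMass_zero, h0, add_zero]
  have h2 := (abs_le.1 (abs_boostMass_le he.1 h0 h1 w)).1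
  have h3 := mul_le_mul_of_nonneg_left (boostMass_one_sub_le hn he w) (norm_nonneg f)
  have h4 : 0 ≤ boostMass e 1 w - (surf n).real Set.univ := by
    have h5 := boostMass_one_ge he w
    have hG1 : 1 ≤ lorentz w ^ e := Real.one_le_rpow (one_le_lorentz w) he.1.le
    have h6 : 0 ≤ (surf n).real Set.univ * (n / (n + 1) * (lorentz w ^ e - 1)) :=
      mul_nonneg surf_real_univ_pos.le (mul_nonneg (by positivity) (by linarith))
    linarith
  have h5 := mul_le_mul_of_nonneg_right hf h4
  rw [← mul_assoc] at h3
  simp only [ContinuousMap.one_apply, integral_const, smul_eq_mul, mul_one]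
  linarith

/-- The quadratic harmonic polynomial `X₀X₁ + X₁X₂ + X₂X₀`. -/
def cyclicPoly (i j k : Fin (n + 1)) : MvPolynomial (Fin (n + 1)) ℝ :=
  MvPolynomial.X i * MvPolynomial.X j + MvPolynomial.X j * MvPolynomial.X k +
    MvPolynomial.X k * MvPolynomial.X i

lemma X_mul_X_mem_harmonicPoly {i j : Fin (n + 1)} (hij : i ≠ j) :
    (MvPolynomial.X i * MvPolynomial.X j : MvPolynomial (Fin (n + 1)) ℝ) ∈ harmonicPoly n 2 := by
  refine mem_harmonicPoly.2 ⟨(MvPolynomial.isHomogeneous_X ℝ i).mul (MvPolynomial.isHomogeneous_X ℝ j), ?_⟩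
  rw [polyLaplacian_X_mul, MvPolynomial.pderiv_X_of_ne hij.symm, mul_zero, zero_add]
  have h : polyLaplacian (MvPolynomial.X j : MvPolynomial (Fin (n + 1)) ℝ) = 0 := by
    refine Finset.sum_eq_zero fun k _ => ?_
    rcases eq_or_ne j k with rfl | hjk
    · simp
    · rw [MvPolynomial.pderiv_X_of_ne hjk, map_zero]
  rw [h, mul_zero]

lemma cyclicPoly_mem {i j k : Fin (n + 1)} (hij : i ≠ j) (hjk : j ≠ k) (hki : k ≠ i) :
    cyclicPoly i j k ∈ harmonicPoly n 2 :=
  add_mem (add_mem (X_mul_X_mem_harmonicPoly hij) (X_mul_X_mem_harmonicPoly hjk)) (X_mul_X_mem_harmonicPoly hki)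

/-- The reflection in the `i`-th coordinate hyperplane. -/
def coordReflection (i : Fin (n + 1)) : Amb n ≃ₗᵢ[ℝ] Amb n :=
  (Submodule.span ℝ {(EuclideanSpace.single i 1 : Amb n)})ᗮ.reflection

lemma coordReflection_apply (i j : Fin (n + 1)) (x : Amb n) :
    coordReflection i x j = if j = i then -(x j) else x j := by
  rw [coordReflection, Submodule.reflection_orthogonal_apply, Submodule.reflection_singleton_apply]
  by_cases h : j = i
  · subst h
    simp [EuclideanSpace.inner_single_left]
    ring
  · simp [h, EuclideanSpace.inner_single_left]

/-- The cube and its images under the three coordinate reflections, which have equal integrals, add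
up to 24 (x_i x_j x_k)². -/
lemma integral_cyclicPoly_cube_pos {i j k : Fin (n + 1)} (hij : i ≠ j) (hjk : j ≠ k) (hki : k ≠ i) :
    0 < ∫ x, polyRestrict n (cyclicPoly i j k) x ^ 3 ∂(surf n) := by
  set r := polyRestrict n (cyclicPoly i j k) with hr
  have hrx : ∀ x, r x = (x : Amb n) i * (x : Amb n) j + (x : Amb n) j * (x : Amb n) k +
      (x : Amb n) k * (x : Amb n) i := fun x => by
    simp [hr, polyRestrict_apply, cyclicPoly]
  have hflip : ∀ l, ∫ x, r (sphIsom (coordReflection l) x) ^ 3 ∂(surf n) = ∫ x, r x ^ 3 ∂(surf n) :=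
    fun l => integral_comp_sphIsom (coordReflection l) fun x => r x ^ 3
  set t : C(Sph n, ℝ) := ⟨fun x => (x : Amb n) i * (x : Amb n) j * (x : Amb n) k, by fun_prop⟩ with ht
  have hr3 : Integrable (fun x => r x ^ 3) (surf n) := integrable_surf (r ^ 3)
  have hc : ∀ l, Integrable (fun x => r (sphIsom (coordReflection l) x) ^ 3) (surf n) := fun l =>
    (measurePreserving_sphIsom (coordReflection l)).integrable_comp_of_integrable hr3
  have i1 := integral_add ((hr3.add (hc i)).add (hc j)) (hc k)
  have i2 := integral_add (hr3.add (hc i)) (hc j)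
  have i3 := integral_add hr3 (hc i)
  simp only [Pi.add_apply] at i1 i2 i3
  rw [i2, i3, hflip, hflip, hflip] at i1
  have h24 : ∀ x, r x ^ 3 + r (sphIsom (coordReflection i) x) ^ 3 + r (sphIsom (coordReflection j) x) ^ 3 +
      r (sphIsom (coordReflection k) x) ^ 3 = 24 * t x ^ 2 := fun x => by
    simp only [hrx, coe_sphIsom, coordReflection_apply, hij, hjk, hki, hij.symm, hjk.symm, hki.symm,
      if_true, if_false, ht, ContinuousMap.coe_mk]
    ring
  simp only [h24] at i1
  rw [integral_const_mul] at i1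
  have ht0 : t ≠ 0 := by
    intro h
    set y : Amb n := EuclideanSpace.single i 1 + EuclideanSpace.single j 1 + EuclideanSpace.single k 1
    have hy : ∀ l, y l = (if l = i then 1 else 0) + (if l = j then 1 else 0) + (if l = k then 1 else 0) := by
      intro l
      simp [y]
    have hyi : y i = 1 := by simp [hy, hij, hki.symm]
    have hyj : y j = 1 := by simp [hy, hij.symm, hjk]
    have hyk : y k = 1 := by simp [hy, hki, hjk.symm]
    have hy0 : ‖y‖ ≠ 0 := norm_ne_zero_iff.2 fun h => by
      rw [h] at hyi
      simp at hyi
    have h2 := congrArg (fun f : C(Sph n, ℝ) => f ⟨‖y‖⁻¹ • y, by simp [norm_smul, hy0]⟩) h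
    simp [ht, hyi, hyj, hyk] at h2
    exact hy0 (by simpa using h2)
  have := integral_sq_pos ht0
  linarith

/-- The quotient of `1 - τ f` for a quadratic harmonic `f` with positive cubic moment. -/
lemma deficit_lt {q : ℝ} (hn : 2 ≤ n) (hs : s - (n : ℝ) / 2 ∈ Set.Ioo (0 : ℝ) 1) (hq : q < 0)
    (hq1 : alpha n s 1 = alpha n s 0 * (q - 1)) {f : C(Sph n, ℝ)}
    (h0 : ∫ x, f x ∂(surf n) = 0) (h3 : 0 < ∫ x, f x ^ 3 ∂(surf n)) :
    ∃ τ₀ : ℝ, 0 < τ₀ ∧ ∀ τ : ℝ, 0 < τ → τ < τ₀ → τ * ‖f‖ < 1 →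
      gap n s (1 + (-τ) • f) = alpha n s 2 * τ ^ 2 * ∫ x, f x ^ 2 ∂(surf n) →
      deficit n s q (1 + (-τ) • f) <
        (1 - alpha n s 1 / alpha n s 2) * gap n s (1 + (-τ) • f) := by
  have hS := surf_real_univ_pos (n := n)
  set S := (surf n).real Set.univ with hSdef
  set m₂ := ∫ x, f x ^ 2 ∂(surf n) with hm₂
  set m₃ := ∫ x, f x ^ 3 ∂(surf n) with hm₃
  have hm₂0 : 0 ≤ m₂ := integral_nonneg fun x => sq_nonneg _
  have hqq : 0 < q * (q - 1) := mul_pos_of_neg_of_neg hq (by linarith)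
  have hqqq : 0 < -(q * (q - 1) * (q - 2)) := by
    rw [← mul_neg]
    exact mul_pos hqq (by linarith)
  set A := q * (q - 1) / 2 * m₂ / S with hA
  -- The cubic Taylor coefficient is negative and so is the perturbation -τf; hence m₃ > 0 raises ∫
  -- v^q above its second-order value.
  set B := -(q * (q - 1) * (q - 2)) / 6 * m₃ / S with hB
  have hA0 : 0 ≤ A := by positivity
  have hB0 : 0 < B := by positivity
  set K := 2 / q * (2 / q - 1) / 2 with hK
  have hr : 2 / q < 0 := div_neg_of_pos_of_neg (by norm_num) hq
  have hK0 : 0 < K := by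
    have := mul_pos_of_neg_of_neg hr (by linarith : 2 / q - 1 < 0)
    rw [hK]; linarith
  have hD : 0 < -(2 / q) * B := mul_pos (by linarith) hB0
  -- τ < 1 gives z ≤ (A+B)τ². The second bound makes the quadratic error K z², of order τ⁴, smaller
  -- than the cubic gain (2/|q|)Bτ³.
  refine ⟨min 1 (-(2 / q) * B / (K * (A + B) ^ 2)), by positivity, fun τ hτ hτ1 hτf hgap => ?_⟩
  have hτ2 : τ < 1 := hτ1.trans_le (min_le_left _ _)
  have hτ3 : τ * (K * (A + B) ^ 2) < -(2 / q) * B := by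
    have := hτ1.trans_le (min_le_right _ _)
    rwa [lt_div_iff₀ (by positivity)] at this
  have hpos : ∀ x, 0 < (1 + (-τ) • f) x := fun x => by
    have h := (abs_le.1 (abs_le_norm f x)).2
    simp only [ContinuousMap.add_apply, ContinuousMap.one_apply, ContinuousMap.smul_apply, smul_eq_mul]
    nlinarith
  set z := A * τ ^ 2 + B * τ ^ 3 with hz
  have hz0 : 0 ≤ z := by positivity
  have hM : 1 + z ≤ (∫ x, (1 + (-τ) • f) x ^ q ∂(surf n)) / S := by
    rw [le_div_iff₀ hS]
    have i1 := integral_add (((integrable_const (1 : ℝ)).add ((integrable_surf f).const_mul (-(q * τ)))).add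
      ((integrable_surf (f ^ 2)).const_mul (q * (q - 1) / 2 * τ ^ 2)))
      ((integrable_surf (f ^ 3)).const_mul (-(q * (q - 1) * (q - 2)) / 6 * τ ^ 3))
    have i2 := integral_add ((integrable_const (1 : ℝ)).add ((integrable_surf f).const_mul (-(q * τ))))
      ((integrable_surf (f ^ 2)).const_mul (q * (q - 1) / 2 * τ ^ 2))
    have i3 := integral_add (integrable_const (1 : ℝ)) ((integrable_surf f).const_mul (-(q * τ)))
    simp only [Pi.add_apply] at i1 i2 i3
    rw [i2, i3, integral_const_mul, integral_const_mul, integral_const_mul, h0, integral_const] at i1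
    have h2 : (1 + z) * S = S • (1 : ℝ) + -(q * τ) * 0 + q * (q - 1) / 2 * τ ^ 2 * m₂ +
        -(q * (q - 1) * (q - 2)) / 6 * τ ^ 3 * m₃ := by
      rw [hz, hA, hB, smul_eq_mul]
      field_simp
      ring
    rw [h2]
    refine i1.symm.le.trans (integral_mono ?_ (integrable_surf (rpowC _ hpos q)) fun x => ?_)
    · exact (((integrable_const (1 : ℝ)).add ((integrable_surf f).const_mul (-(q * τ)))).add
        ((integrable_surf (f ^ 2)).const_mul (q * (q - 1) / 2 * τ ^ 2))).add
        ((integrable_surf (f ^ 3)).const_mul (-(q * (q - 1) * (q - 2)) / 6 * τ ^ 3))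
    · have h4 := hpos x
      simp only [ContinuousMap.add_apply, ContinuousMap.one_apply, ContinuousMap.smul_apply, smul_eq_mul] at h4
      have h5 := cubic_le_one_add_rpow hq (t := -τ * f x) (by linarith)
      simp only [ContinuousMap.add_apply, ContinuousMap.one_apply,
        ContinuousMap.smul_apply, smul_eq_mul, ContinuousMap.pow_apply]
      refine le_trans (le_of_eq ?_) h5
      ring
  have h4 : ((∫ x, (1 + (-τ) • f) x ^ q ∂(surf n)) / S) ^ (2 / q) ≤ 1 + 2 / q * z + K * z ^ 2 :=
    (Real.rpow_le_rpow_of_nonpos (by positivity) hM hr.le).trans (one_add_rpow_le_quadratic hr hz0)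
  have ha := alpha_zero_neg hn hs
  have ha2 := alpha_succ_pos hs 1
  simp only [Nat.reduceAdd] at ha2
  have h5 : 2 / q * z + K * z ^ 2 < 2 / q * A * τ ^ 2 := by
    have h6 : z ≤ (A + B) * τ ^ 2 := by
      have : B * τ ^ 3 ≤ B * τ ^ 2 :=
        mul_le_mul_of_nonneg_left (pow_le_pow_of_le_one hτ.le hτ2.le (by norm_num)) hB0.le
      rw [hz]
      linarith
    have h7 : K * z ^ 2 ≤ K * ((A + B) * τ ^ 2) ^ 2 :=
      mul_le_mul_of_nonneg_left (pow_le_pow_left₀ hz0 h6 2) hK0.le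
    have h8 := mul_lt_mul_of_pos_right hτ3 (pow_pos hτ 3)
    rw [hz]
    rw [hz] at h7
    linarith
  have h6 : 2 / q * A * τ ^ 2 = (q - 1) * τ ^ 2 * m₂ / S := by
    have := hq.ne
    rw [hA]
    field_simp
  have h7 : -(2 / q * A * τ ^ 2) <
      1 - ((∫ x, (1 + (-τ) • f) x ^ q ∂(surf n)) / S) ^ (2 / q) := by linarith
  have h8 := mul_lt_mul_of_neg_left h7 (mul_neg_of_neg_of_pos ha hS)
  have h9 : alpha n s 0 * S * -(2 / q * A * τ ^ 2) = -(alpha n s 1 / alpha n s 2 *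
      gap n s (1 + (-τ) • f)) := by
    rw [h6, hgap, hq1]
    field_simp
  rw [deficit]
  linarith

/-- The strict upper bound for the best stability constant. -/
lemma cBE_lt (hn : 2 ≤ n) (hs : s - (n : ℝ) / 2 ∈ Set.Ioo (0 : ℝ) 1) :
    cBE n s < 1 - alpha n s 1 / alpha n s 2 := by
  have ha2 := alpha_succ_pos hs 1
  simp only [Nat.reduceAdd] at ha2
  -- Without a lower bound the real infimum is 0 by convention, and the claim reduces to α(1) <
  -- α(2).
  by_cases hbdd : BddBelow (quotient n s '' admissible n s)
  swap
  · rw [cBE, Real.sInf_of_not_bddBelow hbdd, sub_pos, div_lt_one ha2]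
    exact alpha_lt_succ hn hs 0
  have hS := surf_real_univ_pos (n := n)
  have hn0 : n ≠ 0 := by omega
  have hn1 : (0 : ℝ) < n := by positivity
  have he0 := hs.1
  obtain ⟨i, j, k, hij, hjk, hki⟩ : ∃ i j k : Fin (n + 1), i ≠ j ∧ j ≠ k ∧ k ≠ i :=
    ⟨⟨0, by omega⟩, ⟨1, by omega⟩, ⟨2, by omega⟩, by simp, by simp, by simp⟩
  set f := polyRestrict n (cyclicPoly i j k) with hf
  have hfm : toL2 n f ∈ sphHarm n 2 := toL2_polyRestrict_mem (cyclicPoly_mem hij hjk hki)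
  have hf3 := integral_cyclicPoly_cube_pos hij hjk hki
  rw [← hf] at hf3
  have h0 : ∫ x, f x ∂(surf n) = 0 := by
    have := inner_sphHarm_of_ne hn (by norm_num) hfm (one_mem_sphHarm_zero (n := n))
    rw [inner_toL2] at this
    simpa using this
  have h1 : ∀ B : Amb n, ∫ x, f x * ⟪B, (x : Amb n)⟫ ∂(surf n) = 0 := fun B => by
    have := inner_sphHarm_of_ne hn (by norm_num) hfm (toL2_affineC_zero_mem B)
    rw [inner_toL2] at this
    simpa using this
  have hf0 : f ≠ 0 := by
    rintro h
    rw [h] at hf3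
    simp at hf3
  obtain ⟨τ₀, hτ₀, H⟩ := deficit_lt hn hs (critExponent_neg hn hs) (alpha_one_eq hs) h0 hf3
  set C : ℝ := 1 + (n + (s - n / 2)) / (s - n / 2) * ((n + 1) / n) with hC
  have hC1 : 1 < C := by
    have : 0 < (n + (s - (n : ℝ) / 2)) / (s - n / 2) * ((n + 1) / n) := by positivity
    linarith
  have hnf : 0 < ‖f‖ := norm_pos_iff.2 hf0
  -- The last condition makes w = 0 minimize the mass, so 1 - τf is its own normalized
  -- representative.
  obtain ⟨τ, hτ, hτ1, hτ2⟩ : ∃ τ : ℝ, 0 < τ ∧ τ < τ₀ ∧ τ * ‖f‖ * C ≤ 1 := by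
    refine ⟨min (τ₀ / 2) (1 / (‖f‖ * C)), by positivity, (min_le_left _ _).trans_lt (by linarith), ?_⟩
    rw [mul_assoc, ← le_div_iff₀ (by positivity)]
    exact min_le_right _ _
  have hτ3 : τ * ‖f‖ < 1 := by
    have : 0 < τ * ‖f‖ := by positivity
    nlinarith
  set u : C(Sph n, ℝ) := 1 + (-τ) • f with hu
  have hfmem := memHs_of_mem_sphHarm (s := s) hn hfm
  have hmem : MemHs n s (toL2 n u) := by
    rw [hu, map_add, map_smul]
    exact (memHs_one hn).add hn (hfmem.smul _)
  have hpos : ∀ x, 0 < u x := fun x => by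
    have h := (abs_le.1 (abs_le_norm f x)).2
    simp only [hu, ContinuousMap.add_apply, ContinuousMap.one_apply, ContinuousMap.smul_apply, smul_eq_mul]
    nlinarith
  have hint : ∫ x, u x ∂(surf n) = (surf n).real Set.univ := by
    have := integral_add (integrable_const (1 : ℝ)) ((integrable_surf f).const_mul (-τ))
    rw [integral_const_mul, h0, mul_zero, add_zero, integral_const, smul_eq_mul, mul_one] at this
    exact this
  have hgap : gap n s u = alpha n s 2 * τ ^ 2 * ∫ x, f x ^ 2 ∂(surf n) := by
    have h2 : toL2 n u = toL2 n 1 + (-τ) • toL2 n f := by rw [hu, map_add, map_smul]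
    have h4 : ⟪toL2 n u, toL2 n f⟫ = -τ * ∫ x, f x ^ 2 ∂(surf n) := by
      rw [h2, inner_add_left, inner_sphHarm_of_ne hn (by norm_num) one_mem_sphHarm_zero hfm,
        real_inner_smul_left, inner_toL2, zero_add]
      simp only [sq]
    have h5 : form n s (toL2 n u) (toL2 n u) = form n s (toL2 n u) (toL2 n 1) +
        -τ * form n s (toL2 n u) (toL2 n f) := by
      conv_lhs => enter [4]; rw [h2]
      rw [form_add_right hn hs hmem (memHs_one hn) (hfmem.smul _), form_smul_right]
    rw [gap, h5, form_one hn, hint, form_sphHarm_right hn _ hfm, h4]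
    ring
  have hb0 : boostMass (s - n / 2) u 0 = (surf n).real Set.univ := by rw [boostMass_zero, hint]
  have hmin := boostMass_zero_le hn0 hs (f := (-τ) • f) (e := s - n / 2)
    (by simp only [ContinuousMap.smul_apply, smul_eq_mul, integral_const_mul, h0, mul_zero])
    (fun B => by
      simp only [ContinuousMap.smul_apply, smul_eq_mul, mul_assoc, integral_const_mul, h1, mul_zero])
    (by rwa [norm_smul, Real.norm_eq_abs, abs_neg, abs_of_pos hτ])
  obtain ⟨hnorm, -, -, hquot⟩ := quotient_eq_of_boost hn hs hpos hmem (w := 0) (by rw [hb0]; exact hS) hmin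
    (v := u) (by rw [hb0, div_self hS.ne', one_smul, neg_zero, twist_zero])
  have hu1 : u ≠ 1 := by
    intro h
    have h2 : (-τ) • f = 0 := by simpa [hu] using h
    exact hf0 ((smul_eq_zero.1 h2).resolve_left (neg_ne_zero.2 hτ.ne'))
  have hadm : u ∈ admissible n s :=
    ⟨hpos, hmem, fun h => hu1 (hnorm.eq_one_of_mem_optimizers hs.1 h)⟩
  refine (csInf_le hbdd ⟨u, hadm, rfl⟩).trans_lt ?_
  rw [hquot, div_lt_iff₀ (hnorm.gap_pos hn hs hmem hu1)]
  exact H τ hτ hτ1 hτ3 hgap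

end StrictBound

/-! ### Minimizing sequences -/

section MinimizingSequences

variable {n : ℕ} {s : ℝ}

lemma boostMass_pos (e : ℝ) {u : C(Sph n, ℝ)} (hu : ∀ x, 0 < u x) (w : Amb n) : 0 < boostMass e u w := by
  have x₀ : Sph n := ⟨EuclideanSpace.single 0 1, by simp⟩
  exact (twist e (-w) u).continuous.integral_pos_of_hasCompactSupport_nonneg_nonzero
    (HasCompactSupport.of_compactSpace _) (fun x => (twist_pos e (-w) hu x).le) (x := x₀)
    (twist_pos e (-w) hu x₀).ne'

/-- Every admissible function has a normalized conformal representative. -/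
lemma exists_normalization (hn : 2 ≤ n) (hs : s - (n : ℝ) / 2 ∈ Set.Ioo (0 : ℝ) 1) {u : C(Sph n, ℝ)}
    (hu : u ∈ admissible n s) :
    ∃ (c : ℝ) (w : Amb n) (v : C(Sph n, ℝ)), 0 < c ∧ v = c • twist (s - n / 2) w u ∧
      IsNormalized v ∧ MemHs n s (toL2 n v) ∧ (∀ x, 0 < v x) ∧ v ≠ 1 ∧
      quotient n s u = deficit n s (2 * n / ((n : ℝ) - 2 * s)) v / gap n s v := by
  obtain ⟨hpos, hmem, hopt⟩ := hu
  obtain ⟨w, hw⟩ := exists_forall_boostMass_le hn hs hpos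
  have hm := boostMass_pos (s - n / 2) hpos w
  have hc := div_pos (surf_real_univ_pos (n := n)) hm
  obtain ⟨h1, h2, h3, h4⟩ := quotient_eq_of_boost hn hs hpos hmem hm hw rfl
  refine ⟨_, -w, _, hc, rfl, h1, h2, h3, fun h => hopt ?_, h4⟩
  refine mem_optimizers.2 ⟨_, w, inv_pos.2 hc, ?_⟩
  rw [← h, map_smul, twist_twist_neg, inv_smul_smul₀ hc.ne']

/-- As α(0) < 0, the q-norm term is nonnegative and can be dropped. A quotient staying below 1 then
bounds `gap`. -/
lemma gap_add_le_deficit (hn : 2 ≤ n) (hs : s - (n : ℝ) / 2 ∈ Set.Ioo (0 : ℝ) 1) (q : ℝ) {v : C(Sph n, ℝ)}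
    (hv : ∀ x, 0 < v x) :
    gap n s v + alpha n s 0 * (surf n).real Set.univ ≤ deficit n s q v := by
  have hS := surf_real_univ_pos (n := n)
  have h := Real.rpow_nonneg (div_pos (integral_rpow_pos hv q) hS).le (2 / q)
  have h1 := mul_nonneg_of_nonpos_of_nonpos (mul_neg_of_neg_of_pos (alpha_zero_neg hn hs) hS).le
    (neg_nonpos.2 h)
  rw [deficit]
  linarith

lemma tendsto_integral_mul {v : ℕ → C(Sph n, ℝ)} {w : C(Sph n, ℝ)} (h : Tendsto v atTop (𝓝 w))
    (f : C(Sph n, ℝ)) :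
    Tendsto (fun k => ∫ x, v k x * f x ∂(surf n)) atTop (𝓝 (∫ x, w x * f x ∂(surf n))) := by
  simp only [← inner_toL2]
  exact (((toL2 n).continuous.tendsto _).comp h).inner tendsto_const_nhds

lemma IsNormalized.of_tendsto {v : ℕ → C(Sph n, ℝ)} {w : C(Sph n, ℝ)} (h : Tendsto v atTop (𝓝 w))
    (hv : ∀ k, IsNormalized (v k)) : IsNormalized w := by
  refine ⟨?_, fun B => ?_⟩
  · have h1 := tendsto_integral_mul h 1
    simp only [ContinuousMap.one_apply, mul_one, (hv _).integral_eq] at h1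
    exact tendsto_nhds_unique h1 tendsto_const_nhds
  · have h1 := tendsto_integral_mul h (affineC 0 B)
    simp only [affineC_apply, zero_add, (hv _).integral_inner_eq] at h1
    exact tendsto_nhds_unique h1 tendsto_const_nhds

lemma IsNormalized.integral_smul_coe {v : C(Sph n, ℝ)} (hv : IsNormalized v) :
    ∫ x, v x • (x : Amb n) ∂(surf n) = 0 := by
  refine ext_inner_left ℝ fun B => ?_
  have h := integral_inner (𝕜 := ℝ)
    (integrable_surf (⟨fun x : Sph n => v x • (x : Amb n), by fun_prop⟩ : C(Sph n, Amb n))) B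
  simp only [ContinuousMap.coe_mk, real_inner_smul_right, hv.integral_inner_eq] at h
  rw [← h, inner_zero_right]

/-- Limits of normalized minimizing sequences are not optimizers. -/
lemma notMem_optimizers_of_tendsto (hn : 2 ≤ n) (hs : s - (n : ℝ) / 2 ∈ Set.Ioo (0 : ℝ) 1)
    {v : ℕ → C(Sph n, ℝ)} {w : C(Sph n, ℝ)} (h : Tendsto v atTop (𝓝 w))
    (hv : ∀ k, IsNormalized (v k)) (hm : ∀ k, MemHs n s (toL2 n (v k))) (hpos : ∀ k x, 0 < v k x)
    (h1 : ∀ k, v k ≠ 1) (hE : Tendsto (fun k => deficit n s (2 * n / ((n : ℝ) - 2 * s)) (v k) /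
      gap n s (v k)) atTop (𝓝 (cBE n s))) : w ∉ optimizers n s := by
  intro hw
  have hw1 := (IsNormalized.of_tendsto h hv).eq_one_of_mem_optimizers hs.1 hw
  subst hw1
  have ha1 := alpha_succ_pos hs 0
  have ha2 := alpha_succ_pos hs 1
  simp only [zero_add, Nat.reduceAdd] at ha1 ha2
  have hr : 0 < alpha n s 1 / alpha n s 2 := div_pos ha1 ha2
  have hc := cBE_lt hn hs
  set r := alpha n s 1 / alpha n s 2
  -- This δ uses up half of the room in the strict bound.
  obtain ⟨δ, hδ, hδ1⟩ : ∃ δ : ℝ, 0 < δ ∧ cBE n s < 1 - (1 + δ) * r := by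
    refine ⟨(1 - r - cBE n s) / (2 * r), div_pos (by linarith) (by positivity), ?_⟩
    have : (1 + (1 - r - cBE n s) / (2 * r)) * r = r + (1 - r - cBE n s) / 2 := by field_simp
    linarith
  obtain ⟨η, hη, H⟩ := exists_le_deficit hn hs (critExponent_neg hn hs) (alpha_one_eq hs) hδ
  have h2 : ∀ᶠ k in atTop, 1 - (1 + δ) * r ≤
      deficit n s (2 * n / ((n : ℝ) - 2 * s)) (v k) / gap n s (v k) := by
    filter_upwards [Metric.tendsto_nhds.1 h η hη] with k hk
    rw [le_div_iff₀ ((hv k).gap_pos hn hs (hm k) (h1 k))]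
    refine H _ (hv k) (hm k) (hpos k) fun x => ?_
    rw [dist_eq_norm] at hk
    exact (abs_le_norm (v k - 1) x).trans_lt hk
  exact absurd (ge_of_tendsto hE h2) (not_le.2 hδ1)

end MinimizingSequences

end

end RevSobolev

theorem proposition3 (n : ℕ) (hn : 2 ≤ n) (s : ℝ) (hs : s - (n : ℝ) / 2 ∈ Set.Ioo (0 : ℝ) 1)
    (u : ℕ → C(Sph n, ℝ)) (hu : IsMinimizing n s u) :
    ∃ (c : ℕ → ℝ) (Φ : ℕ → ConformalMap n) (w : ℕ → C(Sph n, ℝ)),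
      (∀ k, 0 < c k) ∧
      (∀ k, w k = c k • pullback s (Φ k) (u k)) ∧
      (∀ k, ∫ x, w k x ∂(surf n) = (surf n).real Set.univ) ∧
      (∀ k, ∫ x, w k x • (x : Amb n) ∂(surf n) = 0) ∧
      ∃ (φ : ℕ → ℕ) (v : C(Sph n, ℝ)), StrictMono φ ∧
        MemHs n s (toL2 n v) ∧ v ∉ optimizers n s ∧ (∀ x, 0 ≤ v x) ∧
        WeakConvHs n s (fun k => toL2 n (w (φ k))) (toL2 n v) ∧
        TendstoUniformly (fun k x => w (φ k) x) (fun x => v x) atTop := by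
  choose c b w hc hw hnorm hmem hpos hne hquot using fun k => exists_normalization hn hs (hu.1 k)
  refine ⟨c, fun k => boostConformal (b k), w, hc, fun k => ?_, fun k => (hnorm k).integral_eq,
    fun k => (hnorm k).integral_smul_coe, ?_⟩
  · rw [pullback_boostConformal (by omega), hw k]
  have hS := surf_real_univ_pos (n := n)
  have ha := alpha_zero_neg hn hs
  have hlim := hu.2
  simp only [hquot] at hlim
  have hlt : cBE n s < 1 := by
    have ha1 := alpha_succ_pos hs 0
    have ha2 := alpha_succ_pos hs 1
    have := cBE_lt hn hs
    have := div_pos ha1 ha2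
    simp only [zero_add, Nat.reduceAdd] at this
    linarith
  -- From the index N on, `deficit` < C·`gap`; combined with `gap_add_le_deficit` this gives `gap` ≤
  -- -α(0)|S|/(1-C). The first N terms are discarded, hence the shift by N in the subsequence.
  obtain ⟨C, hC1, hC2⟩ := exists_between hlt
  obtain ⟨N, hN⟩ := eventually_atTop.1 (hlim.eventually_lt_const hC1)
  have hbound : ∀ k, form n s (toL2 n (w (k + N))) (toL2 n (w (k + N))) ≤
      -(alpha n s 0 * (surf n).real Set.univ) / (1 - C) := by
    intro k
    have hg := (hnorm (k + N)).gap_pos hn hs (hmem _) (hne _)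
    have h1 := hN (k + N) (Nat.le_add_left _ _)
    rw [div_lt_iff₀ hg] at h1
    have h2 := gap_add_le_deficit hn hs (2 * n / ((n : ℝ) - 2 * s)) (hpos (k + N))
    have h3 : gap n s (w (k + N)) ≤ -(alpha n s 0 * (surf n).real Set.univ) / (1 - C) := by
      rw [le_div_iff₀ (by linarith)]
      linarith
    have h4 := mul_neg_of_neg_of_pos ha hS
    have h5 : gap n s (w (k + N)) = form n s (toL2 n (w (k + N))) (toL2 n (w (k + N))) -
      alpha n s 0 * (surf n).real Set.univ := rfl
    linarith
  obtain ⟨φ, v, hφ, hv, hweak⟩ := exists_subseq_tendsto hn hs (fun k => w (k + N)) (fun k => hmem _)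
    (fun k => (hnorm _).integral_eq) hbound
  have hφN : StrictMono fun k => φ k + N := fun i j hij => Nat.add_lt_add_right (hφ hij) N
  refine ⟨fun k => φ k + N, v, hφN, hweak.2.1, ?_, fun x => ?_, hweak, ?_⟩
  · exact notMem_optimizers_of_tendsto hn hs hv (fun k => hnorm _) (fun k => hmem _) (fun k => hpos _)
      (fun k => hne _) (hlim.comp hφN.tendsto_atTop)
  · have h1 : Tendsto (fun k => w (φ k + N) x) atTop (𝓝 (v x)) :=
      ((continuous_eval_const x).tendsto v).comp hv
    exact ge_of_tendsto' h1 fun k => (hpos _ x).le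
  · exact ContinuousMap.tendsto_iff_tendstoUniformly.1 hv
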